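/- **Setting.** Let $K\ge 2$, $[K]=\{1,\dots,K\}$, and let $\mathcal P(K)$ be the probability simplex in $\mathbb R^K$. In each round $t=1,2,\dots$ an environment chooses a loss vector $\ell_t\in[0,1]^K$, possibly at random and depending on the history $(\ell_s,I(s))_{s<t}$; the player draws $I(t)\in[K]$ and observes only $\ell_{t,I(t)}$. The regret is $R_T=\max_{i\in[K]}\mathbb E\big[\sum_{t=1}^T\ell_{t,I(t)}-\sum_{t=1}^T\ell_{t,i}\big]$. **Algorithm.** Let $\alpha\in(0,1)$, $\bar\alpha=1-\alpha$, $\psi(p)=-\frac1\alpha\sum_{i=1}^K(p_i^\alpha-p_i)$ and $\bar\psi(p)=-\frac1{\bar\alpha}\sum_{i=1}^K(p_i^{\bar\alpha}-p_i)$. The parameters are any $\beta_1\ge\frac{4K}{1-\alpha}$ and any $\bar\beta$ with $\bar\beta=0$ if $\alpha\le\frac12$, and $\bar\beta\ge\frac{32K}{(1-\alpha)^2\beta_1}$ if $\alpha>\frac12$. In round $t$ the player computes $$q_t\in\operatorname*{arg\,min}_{p\in\mathcal P(K)}\Big\{\sum_{s=1}^{t-1}\langle\hat\ell_s,p\rangle+\beta_t\psi(p)+\bar\beta\bar\psi(p)\Big\},$$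 draws $I(t)$ with $\Pr[I(t)=i\mid (\ell_s,I(s))_{s<t},\ell_t]=q_{ti}$, and sets $\hat\ell_{ti}=\frac{\mathbf 1[I(t)=i]}{q_{ti}}\ell_{ti}$ and $$h_t=-\psi(q_t),\qquad z_t=\frac1{1-\alpha}\sum_{i=1}^K\min\{q_{ti},q_{t*}\}^{1-\alpha},\qquad q_{t*}=\min\{\|q_t\|_\infty,1-\|q_t\|_\infty\},\qquad \beta_{t+1}=\beta_t+\frac{z_t}{\beta_th_t}.$$ Write $\log_+x=\max\{1,\log x\}$ and $\bar h=-\bar\psi(q_1)$; note that $q_1$, $h_1$ and $\bar h$ are deterministic. For $z_{\max}>0$ put $\kappa=\frac{z_{\max}}{\beta_1}+\beta_1h_1+\bar\beta\bar h$. **Theorem.** There is an absolute constant $c>0$ such that for all $K\ge2$, $\alpha\in(0,1)$, all $\beta_1,\bar\beta$ as above, and every environment, the following holds. 1. There is a $z_{\max}>0$ with $z_t\le z_{\max}$ for all $t$ and $h_1z_{\max}\le c\,\frac{K-1}{\alpha(1-\alpha)}$. 2. (Adversarial regime.) For every $z_{\max}$ such that $z_t\le z_{\max}$ almost surely for all $t$,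 and for every $T$, $$R_T\le c\,\mathbb E\Big[\sqrt{h_1\textstyle\sum_{t=1}^Tz_t}+\kappa\Big]\quad\text{and}\quad R_T\le c\big(\sqrt{h_1z_{\max}T}+\kappa\big).$$ 3. (Self-bounding regime.) Let moreover $i^*\in[K]$, $\Delta\in\mathbb R_{\ge0}^K$ with $\Delta_i>0$ for all $i\ne i^*$, and $C\ge0$ be such that $R_T\ge\mathbb E\big[\sum_{t=1}^T\Delta_{I(t)}\big]-C$. Put $$\omega(\Delta)=\frac2{\alpha(1-\alpha)}\Big(\sum_{i\ne i^*}\Delta_i^{-\frac{\alpha}{1-\alpha}}\Big)^{1-\alpha}\Big(\sum_{i\ne i^*}\Delta_i^{-\frac{1-\alpha}{\alpha}}\Big)^{\alpha}.$$ Then, with $\Lambda=\log_+\Big(\frac{h_1z_{\max}T}{\omega(\Delta)^2+C\omega(\Delta)}\Big)$, $$R_T\le c\Big(\omega(\Delta)\Lambda+\sqrt{C\,\omega(\Delta)\Lambda}+\kappa\Big).$$ 4. For all $i^*\in[K]$ and all $\Delta$ with $\Delta_i>0$ for $i\ne i^*$, $\omega(\Delta)\le\frac{2(K-1)}{\alpha(1-\alpha)\Delta_{\min}}$,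 where $\Delta_{\min}=\min_{i\ne i^*}\Delta_i$. -/

import Mathlib

open MeasureTheory

noncomputable section

namespace TsallisBandit

/-- The (negative) `α`-Tsallis entropy `ψ(p) = -(1/α) ∑ i, (p i ^ α - p i)`. -/
def tsallis {K : ℕ} (α : ℝ) (p : Fin K → ℝ) : ℝ :=
  -(1 / α) * ∑ i, (p i ^ α - p i)

/-- The FTRL objective `⟨L, p⟩ + β ψ(p) + βb ψb(p)`, where `ψ` is the `α`-Tsallis entropy and
`ψb` is the `(1 - α)`-Tsallis entropy. -/
def objective {K : ℕ} (α βb : ℝ) (L : Fin K → ℝ) (β : ℝ) (p : Fin K → ℝ) : ℝ :=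
  (∑ i, L i * p i) + β * tsallis α p + βb * tsallis (1 - α) p

/-- `q` minimises the FTRL objective over the probability simplex. -/
def IsFTRLMin {K : ℕ} (α βb : ℝ) (L : Fin K → ℝ) (β : ℝ) (q : Fin K → ℝ) : Prop :=
  q ∈ stdSimplex ℝ (Fin K) ∧ IsMinOn (objective α βb L β) (stdSimplex ℝ (Fin K)) q

/-- The FTRL distribution: a minimiser of the FTRL objective over the probability simplex.
(For `0 < α < 1`, `0 < β`, `0 ≤ βb` the objective is strictly convex, so there is only one.) -/
def ftrlDist {K : ℕ} (α βb : ℝ) (L : Fin K → ℝ) (β : ℝ) : Fin K → ℝ :=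
  Classical.epsilon (IsFTRLMin α βb L β)

/-- A minimiser exists, so `ftrlDist` is one. -/
theorem ftrlDist_spec {K : ℕ} (hK : 0 < K) {α : ℝ} (h0 : 0 < α) (h1 : α < 1) (βb : ℝ)
    (L : Fin K → ℝ) (β : ℝ) : IsFTRLMin α βb L β (ftrlDist α βb L β) := by
  have hcont : ∀ a : ℝ, 0 < a → Continuous (fun p : Fin K → ℝ => tsallis a p) := by
    intro a ha
    unfold tsallis
    refine continuous_const.mul (continuous_finsetSum _ fun i _ => ?_)
    exact ((continuous_apply i).rpow_const fun _ => Or.inr ha.le).sub (continuous_apply i)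
  have hobj : Continuous (objective α βb L β) := by
    unfold objective
    refine ((continuous_finsetSum _ fun i _ => ?_).add
      (continuous_const.mul (hcont α h0))).add
      (continuous_const.mul (hcont (1 - α) (by linarith)))
    exact continuous_const.mul (continuous_apply i)
  have : Nonempty (Fin K) := ⟨⟨0, hK⟩⟩
  have hne : (stdSimplex ℝ (Fin K)).Nonempty := ⟨_, single_mem_stdSimplex ℝ (⟨0, hK⟩ : Fin K)⟩
  obtain ⟨q, hq, hmin⟩ :=
    (isCompact_stdSimplex ℝ (Fin K)).exists_isMinOn hne hobj.continuousOn
  exact Classical.epsilon_spec (p := IsFTRLMin α βb L β) ⟨q, hq, hmin⟩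

/-- The penalty coefficient `h = -ψ(q)`. -/
def penalty {K : ℕ} (α : ℝ) (q : Fin K → ℝ) : ℝ := -tsallis α q

/-- `q_* = min {‖q‖_∞, 1 - ‖q‖_∞}`; the norm on `Fin K → ℝ` is the sup norm. -/
def qStar {K : ℕ} (q : Fin K → ℝ) : ℝ := min ‖q‖ (1 - ‖q‖)

/-- The stability coefficient `z = (1/(1-α)) ∑ i, (min {q i, q_*}) ^ (1-α)`. -/
def stability {K : ℕ} (α : ℝ) (q : Fin K → ℝ) : ℝ :=
  1 / (1 - α) * ∑ i, (min (q i) (qStar q)) ^ (1 - α)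

/-- The importance-weighted estimate `j ↦ 1[i = j] x / p j` of the loss vector, when arm `i` was
drawn from `p` and the loss `x` was observed. -/
def lossEstimate {K : ℕ} (p : Fin K → ℝ) (i : Fin K) (x : ℝ) : Fin K → ℝ :=
  fun j => if i = j then x / p j else 0

/-- The memory of the algorithm: the sum of the past loss estimates and the current `β`. -/
structure State (K : ℕ) where
  cumLoss : Fin K → ℝ
  beta : ℝ

/-- The distribution that the algorithm plays from in a given state
(there is no extra exploration, so the played distribution is the FTRL distribution). -/
def State.dist {K : ℕ} (α βb : ℝ) (s : State K) : Fin K → ℝ :=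
  ftrlDist α βb s.cumLoss s.beta

/-- The end of a round in which arm `i` was played and the loss `x` was observed: the loss estimate
is added, and `β` is replaced by `β + z / (β h)` (stability-penalty matching). -/
def State.next {K : ℕ} (α βb : ℝ) (s : State K) (i : Fin K) (x : ℝ) : State K where
  cumLoss := fun j => s.cumLoss j + lossEstimate (s.dist α βb) i x j
  beta := s.beta +
    stability α (s.dist α βb) / (s.beta * penalty α (s.dist α βb))

/-- The state before the first round. -/
def initState (K : ℕ) (β₁ : ℝ) : State K := ⟨fun _ => 0, β₁⟩

/-- The state at the beginning of round `t` (rounds are numbered `0, 1, 2, …`), given the arms `a s`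
played and the losses `x s` observed in the rounds `s < t`. -/
def stateAt {K : ℕ} (α β₁ βb : ℝ) (a : ℕ → Fin K) (x : ℕ → ℝ) : ℕ → State K
  | 0 => initState K β₁
  | t + 1 => (stateAt α β₁ βb a x t).next α βb (a t) (x t)

variable {Ω : Type*}

/-- The distribution `q_t` (equal to `p_t`) of round `t`, when the arms `I` are played against the
loss vectors `ℓ`; it uses the losses only through the observed values `ℓ s (I s)`, `s < t`. -/
def playDist {K : ℕ} (α β₁ βb : ℝ) (ℓ : ℕ → Ω → Fin K → ℝ) (I : ℕ → Ω → Fin K)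
    (t : ℕ) (ω : Ω) : Fin K → ℝ :=
  (stateAt α β₁ βb (fun s => I s ω) (fun s => ℓ s ω (I s ω)) t).dist α βb

/-- The information `σ(ℓ_s, I_s : s < t) ∨ σ(ℓ_t)`: the history before round `t`, and the loss
vector that the environment chooses in round `t`. -/
abbrev pastInfo {K : ℕ} (ℓ : ℕ → Ω → Fin K → ℝ) (I : ℕ → Ω → Fin K) (t : ℕ) :
    MeasurableSpace Ω :=
  (⨆ (s : ℕ) (_ : s < t), MeasurableSpace.comap (I s) inferInstance) ⊔
    (⨆ (s : ℕ) (_ : s ≤ t), MeasurableSpace.comap (ℓ s) inferInstance)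

/-- The processes `ℓ` (loss vectors in `[0,1]^K`) and `I` (arms) describe the interaction of the
algorithm with an adaptive, possibly randomised, environment: the loss vector of round `t` may
depend arbitrarily on the past, and given the past and that loss vector, arm `i` is
drawn with probability `q_t i`. -/
structure IsBanditRun [MeasurableSpace Ω] (μ : Measure Ω) {K : ℕ} (α β₁ βb : ℝ)
    (ℓ : ℕ → Ω → Fin K → ℝ) (I : ℕ → Ω → Fin K) : Prop where
  measurable_loss : ∀ t, Measurable (ℓ t)
  measurable_arm : ∀ t, Measurable (I t)
  loss_mem : ∀ t ω i, ℓ t ω i ∈ Set.Icc (0 : ℝ) 1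
  arm_law : ∀ t i,
    μ[(I t ⁻¹' {i}).indicator (fun _ => (1 : ℝ)) | pastInfo ℓ I t]
      =ᵐ[μ] fun ω => playDist α β₁ βb ℓ I t ω i

/-- `R_T(i) = E[∑_{t<T} ℓ_t(I_t) - ∑_{t<T} ℓ_t(i)]`. -/
def regretAgainst [MeasurableSpace Ω] (μ : Measure Ω) {K : ℕ}
    (ℓ : ℕ → Ω → Fin K → ℝ) (I : ℕ → Ω → Fin K) (T : ℕ) (i : Fin K) : ℝ :=
  ∫ ω, ((∑ t ∈ Finset.range T, ℓ t ω (I t ω)) - ∑ t ∈ Finset.range T, ℓ t ω i) ∂μ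

/-- The regret `R_T = max_i R_T(i)`. -/
def regret [MeasurableSpace Ω] (μ : Measure Ω) {K : ℕ}
    (ℓ : ℕ → Ω → Fin K → ℝ) (I : ℕ → Ω → Fin K) (T : ℕ) : ℝ :=
  ⨆ i : Fin K, regretAgainst μ ℓ I T i

/-- The `(Δ, C, T)` self-bounding constraint `R_T ≥ E[∑_{t<T} Δ(I_t)] - C`. -/
def SelfBounding [MeasurableSpace Ω] (μ : Measure Ω) {K : ℕ}
    (ℓ : ℕ → Ω → Fin K → ℝ) (I : ℕ → Ω → Fin K) (Δ : Fin K → ℝ) (C : ℝ) (T : ℕ) : Prop :=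
  (∫ ω, (∑ t ∈ Finset.range T, Δ (I t ω)) ∂μ) - C ≤ regret μ ℓ I T

/-- `log_+ x = max {1, log x}`. -/
def logPlus (x : ℝ) : ℝ := max 1 (Real.log x)

/-- `ω(Δ) = 2/(α(1-α)) (∑_{i≠i*} Δ_i^{-α/(1-α)})^{1-α} (∑_{i≠i*} Δ_i^{-(1-α)/α})^α`. -/
def omega {K : ℕ} (α : ℝ) (Δ : Fin K → ℝ) (iStar : Fin K) : ℝ :=
  2 / (α * (1 - α)) *
    (∑ i ∈ Finset.univ.erase iStar, Δ i ^ (-(α / (1 - α)))) ^ (1 - α) *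
    (∑ i ∈ Finset.univ.erase iStar, Δ i ^ (-((1 - α) / α))) ^ α

/-- `Δ_min = min_{i≠i*} Δ_i`. -/
def gapMin {K : ℕ} (Δ : Fin K → ℝ) (iStar : Fin K) : ℝ :=
  ⨅ i : {i : Fin K // i ≠ iStar}, Δ i

/-- The first distribution `q_1`, which is deterministic. -/
def firstDist (K : ℕ) (α β₁ βb : ℝ) : Fin K → ℝ := (initState K β₁).dist α βb

/-- `κ = z_max / β₁ + β₁ h₁ + βb hb`, with `h₁ = -ψ(q_1)` and `hb = -ψb(q_1)`. -/
def kappa (K : ℕ) (α β₁ βb zmax : ℝ) : ℝ :=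
  zmax / β₁ + β₁ * penalty α (firstDist K α β₁ βb) +
    βb * penalty (1 - α) (firstDist K α β₁ βb)

/-- `h₁ z_max T / (w² + C w)`, the argument of `log_+` in the bound. -/
def logArg (h₁ zmax : ℝ) (T : ℕ) (w C : ℝ) : ℝ := h₁ * zmax * T / (w ^ 2 + C * w)

end TsallisBandit

end

open TsallisBandit

/-!
The regret of FTRL with the `α`-Tsallis entropy is split by a potential argument. The minimal value
of the FTRL objective grows in each round by the observed loss, up to a stability term and the
change of the penalty `(β_{t+1} - β_t) h_{t+1}` (`ValidParams.objective_add_le`,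
`ValidParams.sum_loss_le`).

* Stability. In expectation over the played arm the stability term is `O(z_t / β_t)`. Arms of
  probability at most `1/2` have a nonnegative loss estimate, which is handled by the second-order
  lower bound `sq_le_bregman`. For an arm of probability above `1/2` the estimate is shifted by a
  constant vector, which leaves losses in `[-2, 0]` for the other arms; here `β ≥ 4K/(1-α)` keeps
  the iterates within a constant factor (`estimate_mul_sub_sub_bregman_le`).
* Penalty. The update of `β` gives `(β_{t+1} - β_t) h_{t+1} = z_t h_{t+1} / (β_t h_t)`, which is
  `O(z_t / β_t)` as soon as `h_{t+1} = O(h_t)`. That holds because no probability grows by more than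
  a constant factor in a round (`ValidParams.dist_next_le`), together with the concavity of the
  entropy (`penalty_le_four_mul`). By the first-order conditions `dualMap (q i) = L i + c` the round
  can be treated as two steps. In the step that raises `β` the growth is controlled by the size of
  `β` for `α ≤ 1/2` and by the extra regulariser for `α > 1/2`
  (`ValidParams.dualMap_two_mul_le`). In the step that adds a loss estimate the mass that the played
  arm loses is at most the mass of the largest arm, unless the played arm is itself the largest, in
  which case the estimate is at most `K` (`IsFTRLMin.le_two_mul_of_loss_step`).

Hence the regret is at most a constant times `E ∑ z_t / β_t`, plus terms of `κ`
(`IsBanditRun.regret_le`). Since `β_{t+1} ^ 2 ≥ ∑_{s ≤ t} z_s / h_s`, this sum can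
be bounded path by path. With `h_t ≤ h_1` it is, up to `z_max / β_1`, `O(√(h_1 ∑ z_t))`, which is the
adversarial bound. For the self-bounding regime, rounds of small penalty and an initial stretch of
rounds are split off, and Cauchy-Schwarz with a logarithmic sum bounds the rest by
`√(Λ ∑ h_t z_t)` (`sum_div_le_sqrt_add_logPlus`). Hölder's inequality gives
`h_t z_t ≤ ω(Δ) ∑ Δ_i q_{t,i}` (`stability_mul_penalty_le`), whose expectation the constraint bounds
by `ω(Δ) (R_T + C)`; the resulting quadratic inequality is solved for `R_T`.
-/

namespace TsallisBandit

/-! ### Scalar inequalities for the Tsallis regulariser -/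

lemma half_le_one_sub_two_rpow_neg {s : ℝ} (h0 : 0 ≤ s) (h1 : s ≤ 1) :
    s / 2 ≤ 1 - (2 : ℝ) ^ (-s) := by
  have h := rpow_one_add_le_one_add_mul_self (s := -(1 / 2)) (by norm_num) h0 h1
  rw [show (1 : ℝ) + -(1 / 2) = 2⁻¹ by norm_num, Real.inv_rpow (by norm_num),
    ← Real.rpow_neg (by norm_num)] at h
  linarith

lemma rpow_sub_one_le {α r : ℝ} (h0 : 0 < α) (h1 : α < 1) (hr : 0 < r) :
    r ^ (α - 1) ≤ α + (1 - α) / r := by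
  have h := rpow_one_add_le_one_add_mul_self (s := r⁻¹ - 1) (p := 1 - α)
    (by have := inv_pos.2 hr; linarith) (by linarith) (by linarith)
  rw [show (1 : ℝ) + (r⁻¹ - 1) = r⁻¹ by ring, Real.inv_rpow hr.le, ← Real.rpow_neg hr.le,
    show -(1 - α) = α - 1 by ring] at h
  rw [div_eq_mul_inv]
  linarith

lemma one_add_mul_le_rpow_sub_one {α r : ℝ} (h0 : 0 < α) (h1 : α < 1) (hr : 0 < r)
    (hr1 : r ≤ 1) : 1 + (1 - α) * (1 - r) ≤ r ^ (α - 1) := by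
  have h := rpow_one_add_le_one_add_mul_self (s := r - 1) (p := 1 - α)
    (by linarith) (by linarith) (by linarith)
  rw [show (1 : ℝ) + (r - 1) = r by ring] at h
  have hp := Real.rpow_pos_of_pos hr (1 - α)
  have hu : 0 < 1 + (1 - α) * (1 - r) := by nlinarith
  rw [show α - 1 = -(1 - α) by ring, Real.rpow_neg hr.le, le_inv_comm₀ hu hp]
  refine h.trans ?_
  rw [inv_eq_one_div, le_div_iff₀ hu]
  nlinarith [sq_nonneg ((1 - α) * (1 - r))]

/-- The Bregman divergence of `x ↦ -x ^ α / α`, the nonlinear part of a summand of the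
`α`-Tsallis regulariser. -/
noncomputable def bregman (α x y : ℝ) : ℝ := y ^ (α - 1) * (x - y) - (x ^ α - y ^ α) / α

lemma bregman_eq {α x y : ℝ} (hx : 0 ≤ x) (hy : 0 < y) :
    bregman α x y = y ^ α * (x / y - 1 - ((x / y) ^ α - 1) / α) := by
  have h1 : x ^ α = y ^ α * (x / y) ^ α := by
    rw [← Real.mul_rpow hy.le (by positivity)]; congr 1; field_simp
  unfold bregman
  rw [h1, Real.rpow_sub_one hy.ne']
  field_simp

lemma hasDerivAt_bregman_one {α r : ℝ} (h0 : 0 < α) (hr : 0 < r) :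
    HasDerivAt (fun r : ℝ => r - 1 - (r ^ α - 1) / α) (1 - r ^ (α - 1)) r := by
  have h := ((hasDerivAt_id r).sub_const 1).sub
    (((Real.hasDerivAt_rpow_const (p := α) (Or.inl hr.ne')).sub_const 1).div_const α)
  rwa [mul_div_cancel_left₀ _ h0.ne'] at h

lemma sq_le_bregman_one {α r : ℝ} (h0 : 0 < α) (h1 : α < 1) (hr : 0 ≤ r) (hr1 : r ≤ 1) :
    (1 - α) / 2 * (r - 1) ^ 2 ≤ r - 1 - (r ^ α - 1) / α := by
  have hd : ∀ r : ℝ, 0 < r → HasDerivAt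
      (fun r : ℝ => r - 1 - (r ^ α - 1) / α - (1 - α) / 2 * (r - 1) ^ 2)
      (1 - r ^ (α - 1) - (1 - α) * (r - 1)) r := by
    intro r hr
    have h := (hasDerivAt_bregman_one h0 hr).sub
      ((((hasDerivAt_id r).sub_const 1).pow 2).const_mul ((1 - α) / 2))
    refine h.congr_deriv ?_
    simp only [id, Nat.cast_ofNat]
    ring
  have hanti : AntitoneOn
      (fun r : ℝ => r - 1 - (r ^ α - 1) / α - (1 - α) / 2 * (r - 1) ^ 2) (Set.Icc 0 1) := by
    refine antitoneOn_of_deriv_nonpos (convex_Icc 0 1) ?_ ?_ ?_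
    · refine Continuous.continuousOn ?_
      have : Continuous fun r : ℝ => r ^ α := Real.continuous_rpow_const h0.le
      fun_prop
    · intro r hr
      rw [interior_Icc] at hr
      exact (hd r hr.1).differentiableAt.differentiableWithinAt
    · intro r hr
      rw [interior_Icc] at hr
      rw [(hd r hr.1).deriv]
      have := one_add_mul_le_rpow_sub_one h0 h1 hr.1 hr.2.le
      linarith
  have h := hanti ⟨hr, hr1⟩ (Set.right_mem_Icc.2 zero_le_one) hr1
  simp only [Real.one_rpow] at h
  norm_num at h
  linarith

lemma sub_log_le_bregman_one {α r : ℝ} (h0 : 0 < α) (h1 : α < 1) (hr : 1 ≤ r) :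
    (1 - α) * (r - 1 - Real.log r) ≤ r - 1 - (r ^ α - 1) / α := by
  have hd : ∀ r : ℝ, 0 < r → HasDerivAt
      (fun r : ℝ => r - 1 - (r ^ α - 1) / α - (1 - α) * (r - 1 - Real.log r))
      (1 - r ^ (α - 1) - (1 - α) * (1 - r⁻¹)) r := by
    intro r hr
    exact (hasDerivAt_bregman_one h0 hr).sub
      ((((hasDerivAt_id r).sub_const 1).sub (Real.hasDerivAt_log hr.ne')).const_mul (1 - α))
  have hmono : MonotoneOn
      (fun r : ℝ => r - 1 - (r ^ α - 1) / α - (1 - α) * (r - 1 - Real.log r)) (Set.Ici 1) := by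
    refine monotoneOn_of_deriv_nonneg (convex_Ici 1) ?_ ?_ ?_
    · intro r hr
      exact (hd r (lt_of_lt_of_le one_pos hr)).continuousAt.continuousWithinAt
    · intro r hr
      rw [interior_Ici] at hr
      exact (hd r (one_pos.trans hr)).differentiableAt.differentiableWithinAt
    · intro r hr
      rw [interior_Ici] at hr
      have hr0 : 0 < r := one_pos.trans hr
      rw [(hd r hr0).deriv]
      have := rpow_sub_one_le h0 h1 hr0
      rw [div_eq_mul_inv] at this
      linarith
  have h := hmono Set.self_mem_Ici hr hr
  simp only [Real.one_rpow, Real.log_one] at h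
  norm_num at h
  linarith

lemma sq_le_bregman {α x y : ℝ} (h0 : 0 < α) (h1 : α < 1) (hx : 0 ≤ x) (hy : 0 < y)
    (hxy : x ≤ y) : (1 - α) / 2 * (x - y) ^ 2 / y ^ (2 - α) ≤ bregman α x y := by
  rw [bregman_eq hx hy]
  have h := sq_le_bregman_one h0 h1 (div_nonneg hx hy.le) ((div_le_one hy).2 hxy)
  have h2 := mul_le_mul_of_nonneg_left h (Real.rpow_pos_of_pos hy α).le
  refine le_trans (le_of_eq ?_) h2
  rw [Real.rpow_sub hy, Real.rpow_two]
  have := (Real.rpow_pos_of_pos hy α).ne'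
  field_simp

lemma sub_log_le_bregman {α x y : ℝ} (h0 : 0 < α) (h1 : α < 1) (hy : 0 < y)
    (hxy : y ≤ x) :
    y ^ α * ((1 - α) * (x / y - 1 - Real.log (x / y))) ≤ bregman α x y := by
  rw [bregman_eq (hy.le.trans hxy) hy]
  exact mul_le_mul_of_nonneg_left (sub_log_le_bregman_one h0 h1 ((one_le_div hy).2 hxy))
    (Real.rpow_pos_of_pos hy α).le

lemma bregman_nonneg {α x y : ℝ} (h0 : 0 < α) (h1 : α < 1) (hx : 0 ≤ x) (hy : 0 < y) :
    0 ≤ bregman α x y := by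
  have h1' : 0 < 1 - α := by linarith
  rcases le_total x y with h | h
  · exact le_trans (by positivity) (sq_le_bregman h0 h1 hx hy h)
  · refine le_trans ?_ (sub_log_le_bregman h0 h1 hy h)
    have hr : 0 < x / y := div_pos (hy.trans_le h) hy
    have := Real.log_le_sub_one_of_pos hr
    have h2 : 0 ≤ x / y - 1 - Real.log (x / y) := by linarith
    positivity

/-- Stability of one coordinate under a nonnegative loss. -/
lemma mul_sub_sub_bregman_le {α β a x y : ℝ} (h0 : 0 < α) (h1 : α < 1) (hβ : 0 < β)
    (ha : 0 ≤ a) (hx : 0 ≤ x) (hy : 0 < y) :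
    a * (y - x) - β * bregman α x y ≤ a ^ 2 * y ^ (2 - α) / (2 * (β * (1 - α))) := by
  have h1' : 0 < 1 - α := by linarith
  have hw := Real.rpow_pos_of_pos hy (2 - α)
  rcases le_total x y with h | h
  · have hb := mul_le_mul_of_nonneg_left (sq_le_bregman h0 h1 hx hy h) hβ.le
    generalize y ^ (2 - α) = w at *
    have key : a ^ 2 * w / (2 * (β * (1 - α))) - a * (y - x)
        + β * ((1 - α) / 2 * (x - y) ^ 2 / w)
        = (β * (1 - α) * (y - x) - a * w) ^ 2 / (2 * (β * (1 - α)) * w) := by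
      field_simp
      ring
    have : 0 ≤ (β * (1 - α) * (y - x) - a * w) ^ 2 / (2 * (β * (1 - α)) * w) := by positivity
    linarith
  · have h2 : 0 ≤ a * (x - y) := mul_nonneg ha (by linarith)
    have h3 : 0 ≤ β * bregman α x y := mul_nonneg hβ.le (bregman_nonneg h0 h1 hx hy)
    have h4 : 0 ≤ a ^ 2 * y ^ (2 - α) / (2 * (β * (1 - α))) := by positivity
    linarith

/-- Stability of one coordinate under a loss that may be as low as `-2`. The coefficient `β` is
large enough for the iterate to move by at most a constant factor. -/
lemma mul_sub_sub_bregman_le_of_le_two {α β b x y : ℝ} (h0 : 0 < α) (h1 : α < 1)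
    (hβ : 8 ≤ β * (1 - α)) (hb : 0 ≤ b) (hb2 : b ≤ 2) (hx : 0 ≤ x) (hy : 0 < y) (hy1 : y ≤ 1) :
    b * (x - y) - β * bregman α x y ≤ 6 * y ^ (2 - α) / (β * (1 - α)) := by
  have h1' : 0 < 1 - α := by linarith
  have hβ0 : 0 < β := by by_contra h; nlinarith
  rcases le_total x y with h | h
  · have h2 : 0 ≤ b * (y - x) := mul_nonneg hb (by linarith)
    have h3 : 0 ≤ β * bregman α x y := mul_nonneg hβ0.le (bregman_nonneg h0 h1 hx hy)
    have h4 : 0 ≤ 6 * y ^ (2 - α) / (β * (1 - α)) := by positivity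
    linarith
  · have hb' := mul_le_mul_of_nonneg_left (sub_log_le_bregman h0 h1 hy h) hβ0.le
    have hyp : 1 ≤ y ^ (α - 1) :=
      Real.one_le_rpow_of_pos_of_le_one_of_nonpos hy hy1 (by linarith)
    have e1 : y ^ α = y * y ^ (α - 1) := by
      rw [Real.rpow_sub_one hy.ne']; field_simp
    have e2 : y ^ (2 - α) = y / y ^ (α - 1) := by
      rw [← Real.rpow_one_sub' hy.le]
      · congr 1; ring
      · linarith
    rw [e1] at hb'
    rw [e2]
    obtain ⟨B, hB⟩ : ∃ B, B = β * (1 - α) * y ^ (α - 1) := ⟨_, rfl⟩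
    have hB8 : 8 ≤ B := by rw [hB]; nlinarith
    obtain ⟨r, hr⟩ : ∃ r, r = x / y := ⟨_, rfl⟩
    have hxr : x = y * r := by rw [hr]; field_simp
    have hr1 : 1 ≤ r := by rw [hr]; exact (one_le_div hy).2 h
    have hD : 0 < (B - b) / B := div_pos (by linarith) (by linarith)
    have hl1 : Real.log (r * ((B - b) / B)) ≤ r * ((B - b) / B) - 1 :=
      Real.log_le_sub_one_of_pos (by positivity)
    rw [Real.log_mul (by positivity) hD.ne'] at hl1
    have hl2 : 1 - ((B - b) / B)⁻¹ ≤ Real.log ((B - b) / B) :=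
      Real.one_sub_inv_le_log_of_pos hD
    have hB0 : 0 < B := by linarith
    have hl3 : B * Real.log r ≤ B * (r * ((B - b) / B) - 2 + ((B - b) / B)⁻¹) :=
      mul_le_mul_of_nonneg_left (by linarith) hB0.le
    have hl4 : B * (r * ((B - b) / B) - 2 + ((B - b) / B)⁻¹)
        = r * (B - b) - B + B * b / (B - b) := by
      have : B - b ≠ 0 := by linarith
      field_simp
      ring
    have hl5 : B * b / (B - b) = b + b ^ 2 / (B - b) := by
      have : B - b ≠ 0 := by linarith
      field_simp
      ring
    have hl6 : b ^ 2 / (B - b) ≤ 6 / B := by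
      have hbb : b ^ 2 ≤ 4 := by nlinarith
      rw [div_le_div_iff₀ (by linarith) hB0]
      nlinarith
    have hfin : b * (r - 1) - B * (r - 1 - Real.log r) ≤ 6 / B := by nlinarith
    have hfin2 := mul_le_mul_of_nonneg_left hfin hy.le
    have e3 : 6 * (y / y ^ (α - 1)) / (β * (1 - α)) = y * (6 / B) := by
      rw [hB]; field_simp
    rw [e3]
    refine le_trans ?_ hfin2
    rw [← hr] at hb'
    have e4 : β * (y * y ^ (α - 1) * ((1 - α) * (r - 1 - Real.log r)))
        = y * (B * (r - 1 - Real.log r)) := by rw [hB]; ring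
    rw [e4] at hb'
    rw [hxr] at hb' ⊢
    linarith

/-- A summand of the Tsallis entropy `-ψ`. -/
noncomputable def entropyTerm (α x : ℝ) : ℝ := (x ^ α - x) / α

lemma penalty_eq_sum {K : ℕ} (α : ℝ) (q : Fin K → ℝ) :
    penalty α q = ∑ i, entropyTerm α (q i) := by
  unfold penalty tsallis entropyTerm
  rw [← Finset.sum_div]
  ring

lemma concaveOn_entropyTerm {α : ℝ} (h0 : 0 < α) (h1 : α < 1) :
    ConcaveOn ℝ (Set.Ici 0) (entropyTerm α) := by
  have h := ((Real.concaveOn_rpow h0.le h1.le).sub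
    (convexOn_id (convex_Ici (0 : ℝ)))).smul (inv_pos.2 h0).le
  refine h.congr fun x _ => ?_
  simp [entropyTerm, div_eq_inv_mul]

lemma entropyTerm_nonneg {α x : ℝ} (h0 : 0 < α) (h1 : α < 1) (hx : 0 ≤ x) (hx1 : x ≤ 1) :
    0 ≤ entropyTerm α x := by
  refine div_nonneg (sub_nonneg.2 ?_) h0.le
  exact Real.self_le_rpow_of_le_one hx hx1 h1.le

lemma entropyTerm_zero {α : ℝ} (h0 : 0 < α) : entropyTerm α 0 = 0 := by
  simp [entropyTerm, h0.ne']

lemma entropyTerm_one {α : ℝ} : entropyTerm α 1 = 0 := by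
  simp [entropyTerm]

lemma entropyTerm_le_of_le_mul {α c x y : ℝ} (h0 : 0 < α) (h1 : α < 1) (hx : 0 < x)
    (hx1 : x ≤ 1) (hxy : x ≤ y) (hyc : y ≤ c * x) :
    entropyTerm α y ≤ c * entropyTerm α x := by
  have hy : 0 < y := hx.trans_le hxy
  have h := (concaveOn_entropyTerm h0 h1).2 (Set.mem_Ici.2 hy.le) (Set.self_mem_Ici (a := (0 : ℝ)))
    (show 0 ≤ x / y by positivity)
    (show 0 ≤ 1 - x / y from sub_nonneg.2 ((div_le_one hy).2 hxy)) (by ring)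
  simp only [smul_eq_mul, entropyTerm_zero h0, mul_zero, add_zero] at h
  rw [div_mul_cancel₀ _ hy.ne', div_mul_eq_mul_div, div_le_iff₀ hy] at h
  have hg := entropyTerm_nonneg h0 h1 hx.le hx1
  have : x * entropyTerm α y ≤ x * (c * entropyTerm α x) := by nlinarith
  exact le_of_mul_le_mul_left this hx

lemma entropyTerm_le_of_one_sub_le_mul {α c x y : ℝ} (h0 : 0 < α) (h1 : α < 1) (hy : 0 ≤ y)
    (hx1 : x ≤ 1) (hxy : y ≤ x) (hyc : 1 - y ≤ c * (1 - x)) :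
    entropyTerm α y ≤ c * entropyTerm α x := by
  rcases hxy.eq_or_lt with rfl | hlt
  · rcases hx1.eq_or_lt with rfl | hlt
    · simp [entropyTerm_one]
    · have hc : 1 ≤ c := by by_contra h; nlinarith
      have := entropyTerm_nonneg h0 h1 hy hx1
      nlinarith
  have hy1 : 0 < 1 - y := by linarith
  have h := (concaveOn_entropyTerm h0 h1).2 (Set.mem_Ici.2 hy) (Set.mem_Ici.2 zero_le_one)
    (show 0 ≤ (1 - x) / (1 - y) from div_nonneg (by linarith) hy1.le)
    (show 0 ≤ 1 - (1 - x) / (1 - y) from sub_nonneg.2 ((div_le_one hy1).2 (by linarith)))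
    (by ring)
  simp only [smul_eq_mul, entropyTerm_one, mul_zero, add_zero] at h
  rw [show (1 - x) / (1 - y) * y + (1 - (1 - x) / (1 - y)) * 1 = x by field_simp; ring,
    div_mul_eq_mul_div, div_le_iff₀ hy1] at h
  have hg := entropyTerm_nonneg h0 h1 (hy.trans hxy) hx1
  have hx1' : 0 < 1 - x := by
    rcases hx1.eq_or_lt with rfl | h
    · linarith
    · linarith
  have : (1 - x) * entropyTerm α y ≤ (1 - x) * (c * entropyTerm α x) := by nlinarith
  exact le_of_mul_le_mul_left this hx1'

/-! ### Optimality conditions for the FTRL distribution -/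

/-- The decreasing function `x ↦ β x ^ (α - 1) + βb x ^ (-α)`: up to an additive constant, the
negative of the derivative of the regulariser in one coordinate. At an FTRL distribution it equals
the cumulative loss plus a Lagrange multiplier. -/
noncomputable def dualMap (α βb β x : ℝ) : ℝ := β * x ^ (α - 1) + βb * x ^ (-α)

/-- The contribution of one coordinate to the FTRL objective. -/
noncomputable def coordObjective (α βb β l x : ℝ) : ℝ :=
  l * x - β * entropyTerm α x - βb * entropyTerm (1 - α) x

lemma objective_eq_sum {K : ℕ} (α βb : ℝ) (L : Fin K → ℝ) (β : ℝ) (p : Fin K → ℝ) :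
    objective α βb L β p = ∑ i, coordObjective α βb β (L i) (p i) := by
  have h1 : tsallis α p = -∑ i, entropyTerm α (p i) := by
    rw [← penalty_eq_sum]; simp [penalty]
  have h2 : tsallis (1 - α) p = -∑ i, entropyTerm (1 - α) (p i) := by
    rw [← penalty_eq_sum]; simp [penalty]
  unfold objective coordObjective
  rw [h1, h2, Finset.sum_sub_distrib, Finset.sum_sub_distrib, ← Finset.mul_sum, ← Finset.mul_sum]
  ring

lemma coordObjective_sub {α : ℝ} (h0 : 0 < α) (h1 : α < 1) (βb β l x y : ℝ) :
    coordObjective α βb β l x - coordObjective α βb β l y =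
      (l - dualMap α βb β y + (β / α + βb / (1 - α))) * (x - y)
        + (β * bregman α x y + βb * bregman (1 - α) x y) := by
  have h1' : 1 - α ≠ 0 := by linarith
  unfold coordObjective dualMap bregman entropyTerm
  rw [show 1 - α - 1 = -α by ring]
  field_simp
  ring

section

variable {K : ℕ} {α βb β : ℝ} {L q : Fin K → ℝ}

lemma dualMap_strictAnti (h0 : 0 < α) (h1 : α < 1) (hβ : 0 < β) (hb : 0 ≤ βb) {x y : ℝ}
    (hx : 0 < x) (hxy : x < y) : dualMap α βb β y < dualMap α βb β x := by
  unfold dualMap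
  have e1 : y ^ (α - 1) < x ^ (α - 1) := Real.rpow_lt_rpow_of_neg hx hxy (by linarith)
  have e2 : y ^ (-α) < x ^ (-α) := Real.rpow_lt_rpow_of_neg hx hxy (by linarith)
  have := mul_lt_mul_of_pos_left e1 hβ
  have := mul_le_mul_of_nonneg_left e2.le hb
  linarith

lemma dualMap_anti (h0 : 0 < α) (h1 : α < 1) (hβ : 0 < β) (hb : 0 ≤ βb) {x y : ℝ}
    (hx : 0 < x) (hxy : x ≤ y) : dualMap α βb β y ≤ dualMap α βb β x := by
  rcases hxy.eq_or_lt with rfl | h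
  · exact le_rfl
  · exact (dualMap_strictAnti h0 h1 hβ hb hx h).le

lemma le_of_dualMap_le (h0 : 0 < α) (h1 : α < 1) (hβ : 0 < β) (hb : 0 ≤ βb) {x y : ℝ}
    (hx : 0 < x) (h : dualMap α βb β x ≤ dualMap α βb β y) : y ≤ x := by
  by_contra! hc
  exact absurd h (not_le.2 (dualMap_strictAnti h0 h1 hβ hb hx hc))

lemma eq_of_mem_stdSimplex_of_le {p q : Fin K → ℝ} (hp : p ∈ stdSimplex ℝ (Fin K))
    (hq : q ∈ stdSimplex ℝ (Fin K)) (h : ∀ i, p i ≤ q i) : p = q := by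
  funext i
  exact (Finset.sum_eq_sum_iff_of_le fun i _ => h i).1 (hp.2.trans hq.2.symm) i
    (Finset.mem_univ i)

lemma le_one_of_mem_stdSimplex (hq : q ∈ stdSimplex ℝ (Fin K)) (i : Fin K) : q i ≤ 1 := by
  rw [← hq.2]
  exact Finset.single_le_sum (fun j _ => hq.1 j) (Finset.mem_univ i)

/-- Moving mass `ε` from `j` to `i` does not improve on a minimiser. The comparison uses the
gradient at the new point, so it needs no positivity of `q i`. -/
lemma IsFTRLMin.dualMap_add_le (h0 : 0 < α) (h1 : α < 1) (hβ : 0 < β) (hb : 0 ≤ βb)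
    (hq : IsFTRLMin α βb L β q) {i j : Fin K} (hij : i ≠ j) {ε : ℝ} (hε : 0 < ε)
    (hεj : ε < q j) :
    dualMap α βb β (q i + ε) ≤ L i - L j + dualMap α βb β (q j - ε) := by
  have hi0 := hq.1.1 i
  have hj0 := hq.1.1 j
  set p : Fin K → ℝ := fun k => q k + ((if k = i then ε else 0) - (if k = j then ε else 0))
    with hp
  have hpi : p i = q i + ε := by simp [hp, hij]
  have hpj : p j = q j - ε := by simp [hp, hij.symm]; ring
  have hpk : ∀ k, k ≠ i → k ≠ j → p k = q k := by intro k h h'; simp [hp, h, h']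
  have hpmem : p ∈ stdSimplex ℝ (Fin K) := by
    refine ⟨fun k => ?_, ?_⟩
    · by_cases hki : k = i
      · rw [hki, hpi]; linarith
      · by_cases hkj : k = j
        · rw [hkj, hpj]; linarith
        · rw [hpk k hki hkj]; exact hq.1.1 k
    · simp [hp, Finset.sum_add_distrib, hq.1.2]
  have hmin := hq.2 hpmem
  simp only [Set.mem_ofPred_eq] at hmin
  rw [objective_eq_sum, objective_eq_sum, ← sub_nonpos, ← Finset.sum_sub_distrib,
    Finset.sum_eq_add_of_mem i j (Finset.mem_univ _) (Finset.mem_univ _) hij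
      (fun k _ hk => by rw [hpk k hk.1 hk.2, sub_self]),
    coordObjective_sub h0 h1, coordObjective_sub h0 h1, hpi, hpj] at hmin
  have h1' : 0 < 1 - α := by linarith
  have b1 := bregman_nonneg h0 h1 hi0 (show 0 < q i + ε by linarith)
  have b2 := bregman_nonneg h1' (by linarith) hi0 (show 0 < q i + ε by linarith)
  have b3 := bregman_nonneg h0 h1 hj0 (show 0 < q j - ε by linarith)
  have b4 := bregman_nonneg h1' (by linarith) hj0 (show 0 < q j - ε by linarith)
  have b1 := mul_nonneg hβ.le b1
  have b2 := mul_nonneg hb b2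
  have b3 := mul_nonneg hβ.le b3
  have b4 := mul_nonneg hb b4
  have : 0 ≤ ε * (L i - L j + dualMap α βb β (q j - ε) - dualMap α βb β (q i + ε)) := by
    nlinarith
  have := nonneg_of_mul_nonneg_right this hε
  linarith

lemma continuousAt_dualMap {x : ℝ} (hx : 0 < x) :
    ContinuousAt (fun x => dualMap α βb β x) x := by
  unfold dualMap
  have e1 : ContinuousAt (fun x : ℝ => x ^ (α - 1)) x :=
    Real.continuousAt_rpow_const _ _ (Or.inl hx.ne')
  have e2 : ContinuousAt (fun x : ℝ => x ^ (-α)) x :=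
    Real.continuousAt_rpow_const _ _ (Or.inl hx.ne')
  fun_prop

lemma IsFTRLMin.pos (h0 : 0 < α) (h1 : α < 1) (hβ : 0 < β) (hb : 0 ≤ βb)
    (hq : IsFTRLMin α βb L β q) (i : Fin K) : 0 < q i := by
  by_contra hneg
  have hqi : q i = 0 := le_antisymm (not_lt.1 hneg) (hq.1.1 i)
  obtain ⟨j, hj⟩ : ∃ j, 0 < q j := by
    by_contra! hcon
    have : ∑ j, q j ≤ 0 := Finset.sum_nonpos fun j _ => hcon j
    rw [hq.1.2] at this
    linarith
  have hij : i ≠ j := by rintro rfl; linarith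
  have hlim : Filter.Tendsto (fun ε : ℝ => L i - L j + dualMap α βb β (q j - ε))
      (nhdsWithin 0 (Set.Ioi 0)) (nhds (L i - L j + dualMap α βb β (q j))) := by
    refine tendsto_const_nhds.add ?_
    have h2 : Filter.Tendsto (fun ε : ℝ => q j - ε) (nhdsWithin 0 (Set.Ioi 0)) (nhds (q j)) := by
      have : Continuous fun ε : ℝ => q j - ε := by fun_prop
      have h3 := this.tendsto 0
      rw [sub_zero] at h3
      exact h3.mono_left nhdsWithin_le_nhds
    exact (continuousAt_dualMap hj).tendsto.comp h2
  have htop : Filter.Tendsto (fun ε : ℝ => β * ε ^ (α - 1)) (nhdsWithin 0 (Set.Ioi 0))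
      Filter.atTop := by
    refine Filter.Tendsto.const_mul_atTop hβ ?_
    exact tendsto_rpow_neg_nhdsGT_zero (by linarith)
  have hle : ∀ᶠ ε in nhdsWithin (0 : ℝ) (Set.Ioi 0),
      β * ε ^ (α - 1) ≤ L i - L j + dualMap α βb β (q j - ε) := by
    filter_upwards [Ioo_mem_nhdsGT hj] with ε hε
    have h := hq.dualMap_add_le h0 h1 hβ hb hij hε.1 hε.2
    rw [hqi, zero_add] at h
    refine le_trans ?_ h
    unfold dualMap
    have := mul_nonneg hb (Real.rpow_nonneg hε.1.le (-α))
    linarith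
  have := htop.eventually_gt_atTop (L i - L j + dualMap α βb β (q j) + 1)
  have h3 := hlim.eventually_lt_const (lt_add_one (L i - L j + dualMap α βb β (q j)))
  obtain ⟨ε, ⟨h4, h5⟩, h6⟩ := ((this.and h3).and hle).exists
  linarith

lemma IsFTRLMin.dualMap_le (h0 : 0 < α) (h1 : α < 1) (hβ : 0 < β) (hb : 0 ≤ βb)
    (hq : IsFTRLMin α βb L β q) (i j : Fin K) :
    dualMap α βb β (q i) ≤ L i - L j + dualMap α βb β (q j) := by
  rcases eq_or_ne i j with rfl | hij
  · simp
  have hi := hq.pos h0 h1 hβ hb i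
  have hj := hq.pos h0 h1 hβ hb j
  have c1 : Filter.Tendsto (fun ε : ℝ => dualMap α βb β (q i + ε)) (nhdsWithin 0 (Set.Ioi 0))
      (nhds (dualMap α βb β (q i))) := by
    have : Filter.Tendsto (fun ε : ℝ => q i + ε) (nhds 0) (nhds (q i)) := by
      have : Continuous fun ε : ℝ => q i + ε := by fun_prop
      simpa using this.tendsto 0
    exact ((continuousAt_dualMap hi).tendsto.comp this).mono_left nhdsWithin_le_nhds
  have c2 : Filter.Tendsto (fun ε : ℝ => L i - L j + dualMap α βb β (q j - ε))
      (nhdsWithin 0 (Set.Ioi 0)) (nhds (L i - L j + dualMap α βb β (q j))) := by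
    have : Filter.Tendsto (fun ε : ℝ => q j - ε) (nhds 0) (nhds (q j)) := by
      have : Continuous fun ε : ℝ => q j - ε := by fun_prop
      simpa using this.tendsto 0
    exact (tendsto_const_nhds.add ((continuousAt_dualMap hj).tendsto.comp this)).mono_left
      nhdsWithin_le_nhds
  refine le_of_tendsto_of_tendsto c1 c2 ?_
  filter_upwards [Ioo_mem_nhdsGT hj] with ε hε
  exact hq.dualMap_add_le h0 h1 hβ hb hij hε.1 hε.2

/-- First-order optimality at a minimiser, with Lagrange multiplier `c`. -/
lemma IsFTRLMin.exists_dualMap_eq (h0 : 0 < α) (h1 : α < 1) (hβ : 0 < β) (hb : 0 ≤ βb)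
    (hq : IsFTRLMin α βb L β q) : ∃ c, ∀ i, dualMap α βb β (q i) = L i + c := by
  rcases isEmpty_or_nonempty (Fin K) with h | ⟨⟨j⟩⟩
  · exact ⟨0, fun i => h.elim i⟩
  · refine ⟨dualMap α βb β (q j) - L j, fun i => ?_⟩
    have := hq.dualMap_le h0 h1 hβ hb i j
    have := hq.dualMap_le h0 h1 hβ hb j i
    linarith

lemma IsFTRLMin.eq (h0 : 0 < α) (h1 : α < 1) (hβ : 0 < β) (hb : 0 ≤ βb) {p : Fin K → ℝ}
    (hp : IsFTRLMin α βb L β p) (hq : IsFTRLMin α βb L β q) : p = q := by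
  obtain ⟨c, hc⟩ := hp.exists_dualMap_eq h0 h1 hβ hb
  obtain ⟨d, hd⟩ := hq.exists_dualMap_eq h0 h1 hβ hb
  have key : ∀ {p q : Fin K → ℝ} {c d : ℝ}, IsFTRLMin α βb L β p → IsFTRLMin α βb L β q →
      (∀ i, dualMap α βb β (p i) = L i + c) → (∀ i, dualMap α βb β (q i) = L i + d) →
      c ≤ d → q = p := by
    intro p q c d hp hq hc hd hcd
    refine eq_of_mem_stdSimplex_of_le hq.1 hp.1 fun i => ?_
    have hle : dualMap α βb β (p i) ≤ dualMap α βb β (q i) := by rw [hc, hd]; linarith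
    exact le_of_dualMap_le h0 h1 hβ hb (hp.pos h0 h1 hβ hb i) hle
  rcases le_total c d with h | h
  · exact (key hp hq hc hd h).symm
  · exact key hq hp hd hc h

/-- The objective grows away from its minimiser at least like the Bregman divergence of the
`α`-Tsallis part of the regulariser. -/
lemma IsFTRLMin.add_bregman_le (h0 : 0 < α) (h1 : α < 1) (hβ : 0 < β) (hb : 0 ≤ βb)
    (hq : IsFTRLMin α βb L β q) {p : Fin K → ℝ} (hp : p ∈ stdSimplex ℝ (Fin K)) :
    objective α βb L β q + β * ∑ i, bregman α (p i) (q i) ≤ objective α βb L β p := by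
  obtain ⟨c, hc⟩ := hq.exists_dualMap_eq h0 h1 hβ hb
  rw [← le_sub_iff_add_le', objective_eq_sum, objective_eq_sum, ← Finset.sum_sub_distrib]
  have e : ∀ i, coordObjective α βb β (L i) (p i) - coordObjective α βb β (L i) (q i) =
      (β / α + βb / (1 - α) - c) * (p i - q i)
        + (β * bregman α (p i) (q i) + βb * bregman (1 - α) (p i) (q i)) := by
    intro i
    rw [coordObjective_sub h0 h1, hc]
    ring
  rw [Finset.sum_congr rfl fun i _ => e i, Finset.sum_add_distrib, ← Finset.mul_sum,
    Finset.sum_sub_distrib, hp.2, hq.1.2, sub_self, mul_zero, zero_add, Finset.mul_sum]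
  refine Finset.sum_le_sum fun i _ => ?_
  have := mul_nonneg hb (bregman_nonneg (α := 1 - α) (by linarith) (by linarith) (hp.1 i)
    (hq.pos h0 h1 hβ hb i))
  linarith

end

/-! ### The stability and penalty coefficients on the simplex -/

lemma sum_rpow_le_rpow_sum_of_le_one {ι : Type*} [DecidableEq ι] (s : Finset ι) (f : ι → ℝ)
    (hf : ∀ i, 0 ≤ f i) {p : ℝ} (h0 : 0 < p) (h1 : p ≤ 1) :
    (∑ i ∈ s, f i) ^ p ≤ ∑ i ∈ s, f i ^ p := by
  induction s using Finset.induction_on with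
  | empty => simp [Real.zero_rpow h0.ne']
  | insert a s ha ih =>
    rw [Finset.sum_insert ha, Finset.sum_insert ha]
    exact (Real.rpow_add_le_add_rpow (hf a) (Finset.sum_nonneg fun i _ => hf i) h0.le h1).trans
      (by linarith)

section

variable {K : ℕ} {α βb β : ℝ} {L q : Fin K → ℝ}

lemma exists_norm_eq_of_mem_stdSimplex (hK : 0 < K) (hq : q ∈ stdSimplex ℝ (Fin K)) :
    ∃ m, ‖q‖ = q m ∧ ∀ j, q j ≤ q m := by
  have : Nonempty (Fin K) := ⟨⟨0, hK⟩⟩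
  obtain ⟨m, hm⟩ := Finite.exists_max q
  refine ⟨m, le_antisymm ?_ ?_, hm⟩
  · rw [pi_norm_le_iff_of_nonneg (hq.1 m)]
    intro i
    rw [Real.norm_of_nonneg (hq.1 i)]
    exact hm i
  · exact (le_abs_self _).trans (norm_le_pi_norm q m)

lemma add_le_one_of_mem_stdSimplex (hq : q ∈ stdSimplex ℝ (Fin K)) {i j : Fin K} (hij : i ≠ j) :
    q i + q j ≤ 1 := by
  rw [← hq.2, ← Finset.sum_pair hij]
  exact Finset.sum_le_sum_of_subset_of_nonneg (Finset.subset_univ _) fun k _ _ => hq.1 k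

lemma sum_erase_eq_one_sub (hq : q ∈ stdSimplex ℝ (Fin K)) (m : Fin K) :
    ∑ i ∈ Finset.univ.erase m, q i = 1 - q m := by
  have := Finset.add_sum_erase Finset.univ q (Finset.mem_univ m)
  rw [hq.2] at this
  linarith

lemma qStar_nonneg (hK : 0 < K) (hq : q ∈ stdSimplex ℝ (Fin K)) : 0 ≤ qStar q := by
  obtain ⟨m, hm, -⟩ := exists_norm_eq_of_mem_stdSimplex hK hq
  have := le_one_of_mem_stdSimplex hq m
  exact le_min (norm_nonneg _) (by linarith)

lemma min_one_sub_le_min_qStar (hK : 0 < K) (hq : q ∈ stdSimplex ℝ (Fin K)) (i : Fin K) :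
    min (q i) (1 - q i) ≤ min (q i) (qStar q) := by
  obtain ⟨m, hm, hmax⟩ := exists_norm_eq_of_mem_stdSimplex hK hq
  refine le_min (min_le_left _ _) (le_min ?_ ?_)
  · rw [hm]; exact (min_le_left _ _).trans (hmax i)
  · rw [hm]
    rcases eq_or_ne i m with rfl | h
    · exact min_le_right _ _
    · have := add_le_one_of_mem_stdSimplex hq h
      exact (min_le_left _ _).trans (by linarith)

/-- In the stability coefficient any one arm `m` may be left out at the cost of a factor `2`: it
is either dominated by a larger arm, or `q_*` is at most the total mass of the other arms. -/
lemma sum_min_qStar_rpow_le (hK : 0 < K) (h0 : 0 < α) (h1 : α < 1)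
    (hq : q ∈ stdSimplex ℝ (Fin K)) (m : Fin K) :
    ∑ i, min (q i) (qStar q) ^ (1 - α) ≤
      2 * ∑ i ∈ Finset.univ.erase m, q i ^ (1 - α) := by
  have h1' : 0 < 1 - α := by linarith
  have hs := qStar_nonneg hK hq
  have hmin : ∀ i, 0 ≤ min (q i) (qStar q) := fun i => le_min (hq.1 i) hs
  rw [← Finset.add_sum_erase Finset.univ _ (Finset.mem_univ m), two_mul]
  refine add_le_add ?_ (Finset.sum_le_sum fun i _ =>
    Real.rpow_le_rpow (hmin i) (min_le_left _ _) h1'.le)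
  obtain ⟨k, hk, hmax⟩ := exists_norm_eq_of_mem_stdSimplex hK hq
  rcases eq_or_ne k m with rfl | hkm
  · refine le_trans ?_ (sum_rpow_le_rpow_sum_of_le_one _ q hq.1 h1' (by linarith))
    rw [sum_erase_eq_one_sub hq]
    refine Real.rpow_le_rpow (hmin _) ?_ h1'.le
    refine (min_le_right _ _).trans ((min_le_right _ _).trans ?_)
    rw [hk]
  · refine le_trans ?_ (Finset.single_le_sum (f := fun i => q i ^ (1 - α))
      (fun i _ => Real.rpow_nonneg (hq.1 i) _) (Finset.mem_erase.2 ⟨hkm, Finset.mem_univ k⟩))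
    exact Real.rpow_le_rpow (hmin _) ((min_le_left _ _).trans (hmax m)) h1'.le

lemma stability_nonneg (hK : 0 < K) (h1 : α < 1) (hq : q ∈ stdSimplex ℝ (Fin K)) :
    0 ≤ stability α q := by
  have h1' : 0 < 1 - α := by linarith
  have hs := qStar_nonneg hK hq
  unfold stability
  refine mul_nonneg (by positivity) (Finset.sum_nonneg fun i _ => ?_)
  exact Real.rpow_nonneg (le_min (hq.1 i) hs) _

lemma stability_le (hK : 0 < K) (h0 : 0 < α) (h1 : α < 1)
    (hq : q ∈ stdSimplex ℝ (Fin K)) (m : Fin K) :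
    stability α q ≤ 2 / (1 - α) * ∑ i ∈ Finset.univ.erase m, q i ^ (1 - α) := by
  have h1' : 0 < 1 - α := by linarith
  have h := mul_le_mul_of_nonneg_left (sum_min_qStar_rpow_le hK h0 h1 hq m)
    (show 0 ≤ 1 / (1 - α) by positivity)
  unfold stability
  refine h.trans (le_of_eq ?_)
  ring

lemma le_half_of_ne_max (hq : q ∈ stdSimplex ℝ (Fin K)) {m i : Fin K}
    (hm : ∀ j, q j ≤ q m) (hi : i ≠ m) : q i ≤ 1 / 2 := by
  have := add_le_one_of_mem_stdSimplex hq hi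
  have := hm i
  linarith

lemma rpow_le_entropyTerm (h0 : 0 < α) (h1 : α < 1) {x : ℝ} (hx : 0 ≤ x) (hx2 : x ≤ 1 / 2) :
    (1 - α) / (2 * α) * x ^ α ≤ entropyTerm α x := by
  rcases hx.eq_or_lt with rfl | hx
  · rw [entropyTerm_zero h0, Real.zero_rpow h0.ne', mul_zero]
  have h2 : x ^ (1 - α) ≤ (2 : ℝ) ^ (-(1 - α)) := by
    rw [Real.rpow_neg (by norm_num), ← Real.inv_rpow (by norm_num)]
    exact Real.rpow_le_rpow hx.le (by linarith) (by linarith)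
  have h3 := half_le_one_sub_two_rpow_neg (s := 1 - α) (by linarith) (by linarith)
  have h4 : x = x ^ α * x ^ (1 - α) := by
    rw [← Real.rpow_add hx]; simp
  have hp := Real.rpow_pos_of_pos hx α
  have h5 : x ^ α * ((1 - α) / 2) ≤ x ^ α - x := by
    calc x ^ α * ((1 - α) / 2) ≤ x ^ α * (1 - x ^ (1 - α)) :=
          mul_le_mul_of_nonneg_left (by linarith) hp.le
      _ = x ^ α - x ^ α * x ^ (1 - α) := by ring
      _ = x ^ α - x := by rw [← h4]
  unfold entropyTerm
  rw [le_div_iff₀ h0]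
  refine le_trans (le_of_eq ?_) h5
  field_simp

lemma penalty_nonneg (h0 : 0 < α) (h1 : α < 1) (hq : q ∈ stdSimplex ℝ (Fin K)) :
    0 ≤ penalty α q := by
  rw [penalty_eq_sum]
  exact Finset.sum_nonneg fun i _ =>
    entropyTerm_nonneg h0 h1 (hq.1 i) (le_one_of_mem_stdSimplex hq i)

lemma le_penalty (h0 : 0 < α) (h1 : α < 1) (hq : q ∈ stdSimplex ℝ (Fin K)) {m : Fin K}
    (hm : ∀ j, q j ≤ q m) :
    (1 - α) / (2 * α) * ∑ i ∈ Finset.univ.erase m, q i ^ α ≤ penalty α q := by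
  rw [penalty_eq_sum, Finset.mul_sum]
  refine (Finset.sum_le_sum fun i hi => ?_).trans
    (Finset.sum_le_sum_of_subset_of_nonneg (Finset.erase_subset m _) fun i _ _ =>
      entropyTerm_nonneg h0 h1 (hq.1 i) (le_one_of_mem_stdSimplex hq i))
  exact rpow_le_entropyTerm h0 h1 (hq.1 i) (le_half_of_ne_max hq hm (Finset.ne_of_mem_erase hi))

lemma penalty_pos (hK : 2 ≤ K) (h0 : 0 < α) (h1 : α < 1) (hq : q ∈ stdSimplex ℝ (Fin K))
    (hpos : ∀ i, 0 < q i) : 0 < penalty α q := by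
  obtain ⟨m, -, hm⟩ := exists_norm_eq_of_mem_stdSimplex (by omega) hq
  refine lt_of_lt_of_le ?_ (le_penalty h0 h1 hq hm)
  have : Nontrivial (Fin K) := Fin.nontrivial_iff_two_le.2 hK
  obtain ⟨k, hk⟩ := exists_ne m
  have h1' : 0 < 1 - α := by linarith
  refine mul_pos (by positivity) (Finset.sum_pos (fun i _ => Real.rpow_pos_of_pos (hpos i) _)
    ⟨k, Finset.mem_erase.2 ⟨hk, Finset.mem_univ k⟩⟩)

/-- For `α ≤ 1/2` stability is dominated by penalty. -/
lemma stability_le_eight_mul_penalty (hK : 0 < K) (h0 : 0 < α) (h1 : α ≤ 1 / 2)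
    (hq : q ∈ stdSimplex ℝ (Fin K)) (hpos : ∀ i, 0 < q i) :
    stability α q ≤ 8 * penalty α q := by
  obtain ⟨m, -, hm⟩ := exists_norm_eq_of_mem_stdSimplex hK hq
  have hz := stability_le hK h0 (by linarith) hq m
  have hh := le_penalty h0 (by linarith) hq hm
  have hS : ∑ i ∈ Finset.univ.erase m, q i ^ (1 - α) ≤ ∑ i ∈ Finset.univ.erase m, q i ^ α :=
    Finset.sum_le_sum fun i _ => Real.rpow_le_rpow_of_exponent_ge (hpos i)
      (le_one_of_mem_stdSimplex hq i) (by linarith)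
  have hS0 : 0 ≤ ∑ i ∈ Finset.univ.erase m, q i ^ α :=
    Finset.sum_nonneg fun i _ => Real.rpow_nonneg (hq.1 i) _
  have h1' : 0 < 1 - α := by linarith
  refine hz.trans (le_trans ?_ (mul_le_mul_of_nonneg_left hh (by norm_num)))
  calc 2 / (1 - α) * ∑ i ∈ Finset.univ.erase m, q i ^ (1 - α)
      ≤ 2 / (1 - α) * ∑ i ∈ Finset.univ.erase m, q i ^ α :=
        mul_le_mul_of_nonneg_left hS (by positivity)
    _ ≤ 8 * ((1 - α) / (2 * α)) * ∑ i ∈ Finset.univ.erase m, q i ^ α := by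
        refine mul_le_mul_of_nonneg_right ?_ hS0
        rw [show 8 * ((1 - α) / (2 * α)) = 4 * (1 - α) / α by field_simp; norm_num,
          div_le_div_iff₀ h1' h0]
        nlinarith
    _ = _ := by ring

/-- For `α > 1/2` the ratio of stability and penalty is controlled by a power of the probability
of any arm other than the largest. -/
lemma stability_le_rpow_mul_penalty (hK : 0 < K) (h0 : 1 / 2 < α) (h1 : α < 1)
    (hq : q ∈ stdSimplex ℝ (Fin K)) (hpos : ∀ i, 0 < q i) {m i : Fin K}
    (hm : ∀ j, q j ≤ q m) (hi : i ≠ m) :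
    stability α q ≤ 4 * K / (1 - α) ^ 2 * q i ^ (1 - 2 * α) * penalty α q := by
  have h00 : 0 < α := by linarith
  have h1' : 0 < 1 - α := by linarith
  have hz := stability_le hK h00 h1 hq m
  have hh := le_penalty h00 h1 hq hm
  have hmem : i ∈ Finset.univ.erase m := Finset.mem_erase.2 ⟨hi, Finset.mem_univ i⟩
  obtain ⟨k, hk, hkmax⟩ := Finset.exists_max_image (Finset.univ.erase m) q ⟨i, hmem⟩
  set S := ∑ j ∈ Finset.univ.erase m, q j ^ α
  have hkS : q k ^ α ≤ S := Finset.single_le_sum (f := fun j => q j ^ α)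
    (fun j _ => Real.rpow_nonneg (hq.1 j) _) hk
  have hS0 : 0 ≤ S := (Real.rpow_nonneg (hq.1 k) _).trans hkS
  have hki : q k ^ (1 - 2 * α) ≤ q i ^ (1 - 2 * α) :=
    Real.rpow_le_rpow_of_nonpos (hpos i) (hkmax i hmem) (by linarith)
  have hri := Real.rpow_nonneg (hq.1 i) (1 - 2 * α)
  have hone : ∀ j ∈ Finset.univ.erase m, q j ^ (1 - α) ≤ q i ^ (1 - 2 * α) * S := by
    intro j hj
    calc q j ^ (1 - α) ≤ q k ^ (1 - α) := Real.rpow_le_rpow (hq.1 j) (hkmax j hj) h1'.le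
      _ = q k ^ (1 - 2 * α) * q k ^ α := by
          rw [← Real.rpow_add (hpos k)]; congr 1; ring
      _ ≤ q i ^ (1 - 2 * α) * S :=
          mul_le_mul hki hkS (Real.rpow_nonneg (hq.1 k) _) hri
  have hsum := Finset.sum_le_card_nsmul _ _ _ hone
  have hcard : ((Finset.univ.erase m).card : ℝ) ≤ K := by
    have := Finset.card_le_univ (Finset.univ.erase m)
    rw [Fintype.card_fin] at this
    exact_mod_cast this
  rw [nsmul_eq_mul] at hsum
  have hsum2 := hsum.trans (mul_le_mul_of_nonneg_right hcard (mul_nonneg hri hS0))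
  have hh2 : (1 - α) / 2 * S ≤ penalty α q := by
    refine le_trans (mul_le_mul_of_nonneg_right ?_ hS0) hh
    exact div_le_div_of_nonneg_left h1'.le (by positivity) (by linarith)
  have hS2 : S ≤ 2 / (1 - α) * penalty α q := by
    rw [div_mul_eq_mul_div, le_div_iff₀ h1']
    linarith
  calc stability α q ≤ 2 / (1 - α) * (K * (q i ^ (1 - 2 * α) * S)) :=
        hz.trans (mul_le_mul_of_nonneg_left hsum2 (by positivity))
    _ ≤ 2 / (1 - α) * (K * (q i ^ (1 - 2 * α) * (2 / (1 - α) * penalty α q))) := by gcongr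
    _ = _ := by field_simp; ring

end

/-! ### Consecutive FTRL distributions are comparable -/

/-- The standing assumptions on the parameters of the algorithm. -/
structure ValidParams (K : ℕ) (α β₁ βb : ℝ) : Prop where
  two_le : 2 ≤ K
  pos : 0 < α
  lt_one : α < 1
  le_beta : 4 * K / (1 - α) ≤ β₁
  betaBar_eq : α ≤ 1 / 2 → βb = 0
  le_betaBar : 1 / 2 < α → 32 * K / ((1 - α) ^ 2 * β₁) ≤ βb

section

variable {K : ℕ} {α β₁ βb β β' : ℝ} {L L' q q' : Fin K → ℝ}

namespace ValidParams

variable (hv : ValidParams K α β₁ βb)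

include hv

lemma card_pos : 0 < K := by have := hv.two_le; omega

lemma one_sub_pos : 0 < 1 - α := by have := hv.lt_one; linarith

lemma two_le_cast : (2 : ℝ) ≤ K := by exact_mod_cast hv.two_le

lemma mul_le_mul_beta : 4 * K ≤ β₁ * (1 - α) :=
  (div_le_iff₀ hv.one_sub_pos).1 hv.le_beta

lemma eight_le : 8 ≤ β₁ * (1 - α) := by
  have := hv.mul_le_mul_beta
  have := hv.two_le_cast
  linarith

lemma eight_le_beta : 8 ≤ β₁ := by
  have h1 := hv.eight_le
  have h2 := hv.one_sub_pos
  have h3 := hv.pos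
  by_contra h
  nlinarith

lemma beta_pos : 0 < β₁ := by have := hv.eight_le_beta; linarith

lemma betaBar_nonneg : 0 ≤ βb := by
  rcases le_or_gt α (1 / 2) with h | h
  · rw [hv.betaBar_eq h]
  · refine le_trans ?_ (hv.le_betaBar h)
    have := hv.beta_pos
    have := hv.one_sub_pos
    positivity

end ValidParams

/-- Raising `β` lowers the largest probability. Therefore the Lagrange multiplier does not decrease,
and the values of the dual maps grow in all coordinates. -/
lemma IsFTRLMin.le_of_beta_le (h0 : 0 < α) (h1 : α < 1) (hβ : 0 < β) (hβ' : β ≤ β')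
    (hb : 0 ≤ βb) (hq : IsFTRLMin α βb L β q) (hq' : IsFTRLMin α βb L β' q') {m : Fin K}
    (hm : ∀ j, q j ≤ q m) :
    q' m ≤ q m ∧ ∀ i, dualMap α βb β (q i) ≤ dualMap α βb β' (q' i) := by
  obtain ⟨c, hc⟩ := hq.exists_dualMap_eq h0 h1 hβ hb
  obtain ⟨c', hc'⟩ := hq'.exists_dualMap_eq h0 h1 (hβ.trans_le hβ') hb
  have hpos := hq.pos h0 h1 hβ hb
  have hpos' := hq'.pos h0 h1 (hβ.trans_le hβ') hb
  have hsplit : ∀ x, dualMap α βb β' x = dualMap α βb β x + (β' - β) * x ^ (α - 1) := by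
    intro x; unfold dualMap; ring
  have hmm : q' m ≤ q m := by
    by_contra! hlt
    have e1 := dualMap_strictAnti h0 h1 (hβ.trans_le hβ') hb (hpos m) hlt
    rw [hsplit (q m), hc, hc'] at e1
    -- every probability would grow
    have hall : ∀ i, q i ≤ q' i := by
      intro i
      refine le_of_dualMap_le h0 h1 (hβ.trans_le hβ') hb (hpos' i) ?_
      rw [hsplit (q i), hc, hc']
      have hp : q m ^ (α - 1) ≤ q i ^ (α - 1) :=
        Real.rpow_le_rpow_of_nonpos (hpos i) (hm i) (by linarith)
      have := mul_le_mul_of_nonneg_left hp (sub_nonneg.2 hβ')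
      linarith
    rw [eq_of_mem_stdSimplex_of_le hq.1 hq'.1 hall] at hlt
    exact lt_irrefl _ hlt
  refine ⟨hmm, fun i => ?_⟩
  have e1 := dualMap_anti h0 h1 (hβ.trans_le hβ') hb (hpos' m) hmm
  rw [hsplit (q m), hc, hc'] at e1
  have : 0 ≤ (β' - β) * q m ^ (α - 1) :=
    mul_nonneg (sub_nonneg.2 hβ') (Real.rpow_nonneg (hpos m).le _)
  rw [hc, hc']
  linarith

/-- The stability-penalty-matching increment of `β` at `q` is so small that halving the scale
compensates for it. For `α ≤ 1/2` this uses that `β` is large, otherwise the additional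
regulariser with coefficient `βb`. -/
lemma ValidParams.dualMap_two_mul_le (hv : ValidParams K α β₁ βb) (hβ : β₁ ≤ β)
    (hq : q ∈ stdSimplex ℝ (Fin K)) (hpos : ∀ i, 0 < q i) {m i : Fin K}
    (hm : ∀ j, q j ≤ q m) (hi : i ≠ m) :
    dualMap α βb (β + stability α q / (β * penalty α q)) (2 * q i) ≤
      dualMap α βb β (q i) := by
  have h0 := hv.pos
  have h1 := hv.lt_one
  have h1' := hv.one_sub_pos
  have hβ0 : 0 < β := hv.beta_pos.trans_le hβ
  have hh := penalty_pos hv.two_le h0 h1 hq hpos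
  have hqi := hpos i
  have hP := Real.rpow_pos_of_pos hqi (α - 1)
  have hN := Real.rpow_pos_of_pos hqi (-α)
  unfold dualMap
  rw [Real.mul_rpow (by norm_num) hqi.le, Real.mul_rpow (by norm_num) hqi.le]
  have h2a : (2 : ℝ) ^ (α - 1) ≤ 1 :=
    Real.rpow_le_one_of_one_le_of_nonpos (by norm_num) (by linarith)
  have h2p : 0 < (2 : ℝ) ^ (α - 1) := by positivity
  rcases le_or_gt α (1 / 2) with hα | hα
  · rw [hv.betaBar_eq hα]
    have hz := stability_le_eight_mul_penalty hv.card_pos h0 hα hq hpos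
    have hinc : stability α q / (β * penalty α q) ≤ β / 8 := by
      rw [div_le_div_iff₀ (by positivity) (by norm_num)]
      have : 8 ≤ β := hv.eight_le_beta.trans hβ
      have : 64 * penalty α q ≤ β * β * penalty α q :=
        mul_le_mul_of_nonneg_right (by nlinarith) hh.le
      nlinarith
    have h34 : (2 : ℝ) ^ (α - 1) ≤ 3 / 4 := by
      have := half_le_one_sub_two_rpow_neg (s := 1 - α) h1'.le (by linarith)
      rw [show -(1 - α) = α - 1 by ring] at this
      linarith
    have : (β + stability α q / (β * penalty α q)) * 2 ^ (α - 1) ≤ (β + β / 8) * (3 / 4) :=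
      mul_le_mul (by linarith) h34 h2p.le (by positivity)
    have : (β + stability α q / (β * penalty α q)) * 2 ^ (α - 1) ≤ β := by linarith
    have := mul_le_mul_of_nonneg_right this hP.le
    linarith
  · have hz := stability_le_rpow_mul_penalty hv.card_pos hα h1 hq hpos hm hi
    have hβ₁ := hv.beta_pos
    have hR := Real.rpow_pos_of_pos hqi (1 - 2 * α)
    have hinc : stability α q / (β * penalty α q) ≤ βb / 8 * q i ^ (1 - 2 * α) := by
      have hK0 : (0 : ℝ) < K := by exact_mod_cast hv.card_pos
      calc stability α q / (β * penalty α q)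
          ≤ 4 * K / (1 - α) ^ 2 * q i ^ (1 - 2 * α) * penalty α q / (β₁ * penalty α q) := by
            gcongr
        _ = 32 * K / ((1 - α) ^ 2 * β₁) / 8 * q i ^ (1 - 2 * α) := by field_simp; norm_num
        _ ≤ βb / 8 * q i ^ (1 - 2 * α) := by have := hv.le_betaBar hα; gcongr
    have hcomb : q i ^ (1 - 2 * α) * q i ^ (α - 1) = q i ^ (-α) := by
      rw [← Real.rpow_add hqi]; congr 1; ring
    have h78 : (2 : ℝ) ^ (-α) ≤ 3 / 4 := by
      have := half_le_one_sub_two_rpow_neg h0.le h1.le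
      linarith
    have e1 : (β + stability α q / (β * penalty α q)) * (2 ^ (α - 1) * q i ^ (α - 1)) ≤
        (β + stability α q / (β * penalty α q)) * q i ^ (α - 1) := by
      have : 0 ≤ stability α q / (β * penalty α q) :=
        div_nonneg (stability_nonneg hv.card_pos h1 hq) (by positivity)
      refine mul_le_mul_of_nonneg_left ?_ (by positivity)
      nlinarith
    have e2 : stability α q / (β * penalty α q) * q i ^ (α - 1) ≤ βb / 8 * q i ^ (-α) := by
      rw [← hcomb, ← mul_assoc]
      exact mul_le_mul_of_nonneg_right hinc hP.le
    have e3 : βb * (2 ^ (-α) * q i ^ (-α)) ≤ βb * (3 / 4 * q i ^ (-α)) :=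
      mul_le_mul_of_nonneg_left (mul_le_mul_of_nonneg_right h78 hN.le) hv.betaBar_nonneg
    have e4 : 0 ≤ βb * q i ^ (-α) := mul_nonneg hv.betaBar_nonneg hN.le
    linarith

lemma IsFTRLMin.le_two_mul_of_beta_step (hv : ValidParams K α β₁ βb) (hβ : β₁ ≤ β)
    (hq : IsFTRLMin α βb L β q)
    (hq' : IsFTRLMin α βb L (β + stability α q / (β * penalty α q)) q') (i : Fin K) :
    q' i ≤ 2 * q i := by
  have hβ0 : 0 < β := hv.beta_pos.trans_le hβ
  have hpos := hq.pos hv.pos hv.lt_one hβ0 hv.betaBar_nonneg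
  have hinc : 0 ≤ stability α q / (β * penalty α q) :=
    div_nonneg (stability_nonneg hv.card_pos hv.lt_one hq.1)
      (mul_nonneg hβ0.le (penalty_nonneg hv.pos hv.lt_one hq.1))
  obtain ⟨m, -, hm⟩ := exists_norm_eq_of_mem_stdSimplex hv.card_pos hq.1
  obtain ⟨hmm, hdual⟩ := hq.le_of_beta_le hv.pos hv.lt_one hβ0 (le_add_of_nonneg_right hinc)
    hv.betaBar_nonneg hq' hm
  rcases eq_or_ne i m with rfl | hi
  · linarith [hpos i]
  · have := hpos i
    exact le_of_dualMap_le hv.pos hv.lt_one (by linarith) hv.betaBar_nonneg (by linarith)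
      ((hv.dualMap_two_mul_le hβ hq.1 hpos hm hi).trans (hdual i))

lemma IsFTRLMin.le_iff_le (h0 : 0 < α) (h1 : α < 1) (hβ : 0 < β)
    (hb : 0 ≤ βb) (hq : IsFTRLMin α βb L β q) (i j : Fin K) : q i ≤ q j ↔ L j ≤ L i := by
  obtain ⟨c, hc⟩ := hq.exists_dualMap_eq h0 h1 hβ hb
  have hpos := hq.pos h0 h1 hβ hb
  constructor
  · intro h
    have := dualMap_anti h0 h1 hβ hb (hpos i) h
    rw [hc, hc] at this
    linarith
  · intro h
    refine le_of_dualMap_le h0 h1 hβ hb (hpos j) ?_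
    rw [hc, hc]
    linarith

lemma dualMap_sub_two_mul_anti (h0 : 0 < α) (h1 : α < 1) (hβ : 0 < β) (hb : 0 ≤ βb) {x y : ℝ}
    (hx : 0 < x) (hxy : x ≤ y) :
    dualMap α βb β y - dualMap α βb β (2 * y) ≤ dualMap α βb β x - dualMap α βb β (2 * x) := by
  have e : ∀ z : ℝ, 0 < z → dualMap α βb β z - dualMap α βb β (2 * z) =
      β * (1 - 2 ^ (α - 1)) * z ^ (α - 1) + βb * (1 - 2 ^ (-α)) * z ^ (-α) := by
    intro z hz
    unfold dualMap
    rw [Real.mul_rpow (by norm_num) hz.le, Real.mul_rpow (by norm_num) hz.le]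
    ring
  rw [e x hx, e y (hx.trans_le hxy)]
  have a1 : (2 : ℝ) ^ (α - 1) ≤ 1 :=
    Real.rpow_le_one_of_one_le_of_nonpos (by norm_num) (by linarith)
  have a2 : (2 : ℝ) ^ (-α) ≤ 1 := Real.rpow_le_one_of_one_le_of_nonpos (by norm_num) (by linarith)
  have b1 : y ^ (α - 1) ≤ x ^ (α - 1) := Real.rpow_le_rpow_of_nonpos hx hxy (by linarith)
  have b2 : y ^ (-α) ≤ x ^ (-α) := Real.rpow_le_rpow_of_nonpos hx hxy (by linarith)
  have a1' : 0 ≤ β * (1 - (2 : ℝ) ^ (α - 1)) := mul_nonneg hβ.le (by linarith)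
  have a2' : 0 ≤ βb * (1 - (2 : ℝ) ^ (-α)) := mul_nonneg hb (by linarith)
  exact add_le_add (mul_le_mul_of_nonneg_left b1 a1') (mul_le_mul_of_nonneg_left b2 a2')

lemma ValidParams.card_le_dualMap_sub (hv : ValidParams K α β₁ βb) (hβ : β₁ ≤ β) {x : ℝ}
    (hx : 0 < x) (hx1 : x ≤ 1) : (K : ℝ) ≤ dualMap α βb β x - dualMap α βb β (2 * x) := by
  have hβ0 : 0 < β := hv.beta_pos.trans_le hβ
  have h := dualMap_sub_two_mul_anti hv.pos hv.lt_one hβ0 hv.betaBar_nonneg hx hx1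
  refine le_trans ?_ h
  unfold dualMap
  simp only [Real.one_rpow, mul_one]
  have a1 := half_le_one_sub_two_rpow_neg (s := 1 - α) hv.one_sub_pos.le (by linarith [hv.pos])
  rw [show -(1 - α) = α - 1 by ring] at a1
  have a2 : (2 : ℝ) ^ (-α) ≤ 1 :=
    Real.rpow_le_one_of_one_le_of_nonpos (by norm_num) (by linarith [hv.pos])
  have b1 := mul_le_mul_of_nonneg_left a1 hβ0.le
  have b2 : 0 ≤ βb * (1 - (2 : ℝ) ^ (-α)) := mul_nonneg hv.betaBar_nonneg (by linarith)
  have b3 := hv.mul_le_mul_beta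
  have b4 := mul_le_mul_of_nonneg_right hβ hv.one_sub_pos.le
  have := hv.two_le_cast
  linarith

/-- Adding a loss to a single arm `I` at most doubles every probability. If `I` is not the largest
arm, this is because the mass `q I` that is set free is smaller than the mass of the largest arm,
and the relative growth of an arm increases with its probability; if `I` is the largest arm, the
loss is at most `K`. -/
lemma IsFTRLMin.le_two_mul_of_loss_step (hv : ValidParams K α β₁ βb) (hβ : β₁ ≤ β)
    {I : Fin K} {a : ℝ} (ha : 0 ≤ a) (hL : ∀ j, L' j = L j + if I = j then a else 0)
    (hq : IsFTRLMin α βb L β q) (hq' : IsFTRLMin α βb L' β q')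
    (hmax : (∀ j, q j ≤ q I) → a ≤ K) (j : Fin K) : q' j ≤ 2 * q j := by
  have h0 := hv.pos
  have h1 := hv.lt_one
  have hb := hv.betaBar_nonneg
  have hβ0 : 0 < β := hv.beta_pos.trans_le hβ
  obtain ⟨c, hc⟩ := hq.exists_dualMap_eq h0 h1 hβ0 hb
  obtain ⟨c', hc'⟩ := hq'.exists_dualMap_eq h0 h1 hβ0 hb
  have hpos := hq.pos h0 h1 hβ0 hb
  have hpos' := hq'.pos h0 h1 hβ0 hb
  have hge : ∀ k, L k + c' ≤ dualMap α βb β (q' k) := by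
    intro k
    rw [hc', hL]
    split_ifs <;> linarith
  have hle : ∀ k, dualMap α βb β (q' k) ≤ L k + a + c' := by
    intro k
    rw [hc', hL]
    split_ifs <;> linarith
  have hcc : c' ≤ c := by
    by_contra! hlt
    have hall : ∀ k, q' k ≤ q k := fun k =>
      le_of_dualMap_le h0 h1 hβ0 hb (hpos k) (by rw [hc]; linarith [hge k])
    have heq := eq_of_mem_stdSimplex_of_le hq'.1 hq.1 hall
    have := hge I
    rw [heq, hc] at this
    linarith
  have hca : c ≤ c' + a := by
    by_contra! hlt
    have hall : ∀ k, q k ≤ q' k := fun k =>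
      le_of_dualMap_le h0 h1 hβ0 hb (hpos' k) (by rw [hc]; linarith [hle k])
    have heq := eq_of_mem_stdSimplex_of_le hq.1 hq'.1 hall
    have := hle I
    rw [← heq, hc] at this
    linarith
  have hup : ∀ k, I ≠ k → q k ≤ q' k := by
    intro k hk
    refine le_of_dualMap_le h0 h1 hβ0 hb (hpos' k) ?_
    rw [hc, hc', hL, if_neg hk]
    linarith
  -- it suffices to bound the change of the Lagrange multiplier
  suffices hδ : c - c' ≤ dualMap α βb β (q j) - dualMap α βb β (2 * q j) by
    refine le_of_dualMap_le h0 h1 hβ0 hb (by linarith [hpos j]) ?_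
    have := hge j
    rw [hc] at hδ
    linarith
  by_cases hI : ∀ j, q j ≤ q I
  · have := hv.card_le_dualMap_sub hβ (hpos j) (le_one_of_mem_stdSimplex hq.1 j)
    linarith [hmax hI]
  · obtain ⟨m, -, hm⟩ := exists_norm_eq_of_mem_stdSimplex hv.card_pos hq.1
    have hmI : I ≠ m := by
      rintro rfl
      exact hI hm
    refine le_trans ?_ (dualMap_sub_two_mul_anti h0 h1 hβ0 hb (hpos j) (hm j))
    have hmass : q' m ≤ 2 * q m := by
      have e1 := sum_erase_eq_one_sub hq.1 m
      have e2 := sum_erase_eq_one_sub hq'.1 m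
      have hmem : I ∈ Finset.univ.erase m := Finset.mem_erase.2 ⟨hmI, Finset.mem_univ I⟩
      rw [← Finset.add_sum_erase _ _ hmem] at e1 e2
      have : ∑ k ∈ (Finset.univ.erase m).erase I, q k ≤
          ∑ k ∈ (Finset.univ.erase m).erase I, q' k :=
        Finset.sum_le_sum fun k hk => hup k (Finset.ne_of_mem_erase hk).symm
      linarith [hm I, hpos' I]
    have := dualMap_anti h0 h1 hβ0 hb (hpos' m) hmass
    rw [hc', hL, if_neg hmI] at this
    rw [hc]
    linarith

/-- The state update at most quadruples every probability. -/
lemma ValidParams.dist_next_le (hv : ValidParams K α β₁ βb) (s : State K) (hβ : β₁ ≤ s.beta)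
    (I : Fin K) {x : ℝ} (hx0 : 0 ≤ x) (hx1 : x ≤ 1) (i : Fin K) :
    (s.next α βb I x).dist α βb i ≤ 4 * s.dist α βb i := by
  have h0 := hv.pos
  have h1 := hv.lt_one
  have hb := hv.betaBar_nonneg
  have hβ0 : 0 < s.beta := hv.beta_pos.trans_le hβ
  have hq : IsFTRLMin α βb s.cumLoss s.beta (s.dist α βb) :=
    ftrlDist_spec hv.card_pos h0 h1 _ _ _
  have hq' : IsFTRLMin α βb (s.next α βb I x).cumLoss (s.next α βb I x).beta
    ((s.next α βb I x).dist α βb) := ftrlDist_spec hv.card_pos h0 h1 _ _ _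
  -- the intermediate distribution: new `β`, old losses
  have hr : IsFTRLMin α βb s.cumLoss (s.next α βb I x).beta
    (ftrlDist α βb s.cumLoss (s.next α βb I x).beta) := ftrlDist_spec hv.card_pos h0 h1 _ _ _
  generalize ftrlDist α βb s.cumLoss (s.next α βb I x).beta = r at hr
  have hpos := hq.pos h0 h1 hβ0 hb
  have hβ' : β₁ ≤ (s.next α βb I x).beta := by
    refine hβ.trans (le_add_of_nonneg_right ?_)
    exact div_nonneg (stability_nonneg hv.card_pos h1 hq.1)
      (mul_nonneg hβ0.le (penalty_nonneg h0 h1 hq.1))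
  have hβ0' := hv.beta_pos.trans_le hβ'
  have e1 := hq.le_two_mul_of_beta_step hv hβ hr i
  have e2 := hr.le_two_mul_of_loss_step hv hβ' (a := x / s.dist α βb I)
    (L' := (s.next α βb I x).cumLoss) (I := I) (div_nonneg hx0 (hpos I).le) ?_ hq' ?_ i
  · linarith
  · intro j
    show s.cumLoss j + lossEstimate (s.dist α βb) I x j = _
    unfold lossEstimate
    by_cases hIj : I = j
    · subst hIj; simp
    · simp [hIj]
  · intro hmax
    have hmax' : ∀ j, s.dist α βb j ≤ s.dist α βb I := fun j =>
      (hq.le_iff_le h0 h1 hβ0 hb j I).2 ((hr.le_iff_le h0 h1 hβ0' hb j I).1 (hmax j))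
    have hsum := Finset.sum_le_card_nsmul Finset.univ _ _ fun j _ => hmax' j
    rw [hq.1.2, Finset.card_univ, Fintype.card_fin, nsmul_eq_mul] at hsum
    rw [div_le_iff₀ (hpos I)]
    linarith

lemma penalty_le_four_mul (h0 : 0 < α) (h1 : α < 1) (hq : q ∈ stdSimplex ℝ (Fin K))
    (hq' : q' ∈ stdSimplex ℝ (Fin K)) (hpos : ∀ i, 0 < q i) (h : ∀ i, q' i ≤ 4 * q i) :
    penalty α q' ≤ 4 * penalty α q := by
  rw [penalty_eq_sum, penalty_eq_sum, Finset.mul_sum]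
  refine Finset.sum_le_sum fun i _ => ?_
  rcases le_total (q i) (q' i) with hle | hle
  · exact entropyTerm_le_of_le_mul h0 h1 (hpos i) (le_one_of_mem_stdSimplex hq i) hle (h i)
  · refine entropyTerm_le_of_one_sub_le_mul h0 h1 (hq'.1 i) (le_one_of_mem_stdSimplex hq i) hle ?_
    rw [← sum_erase_eq_one_sub hq, ← sum_erase_eq_one_sub hq', Finset.mul_sum]
    exact Finset.sum_le_sum fun j _ => h j

end

/-! ### The pathwise regret bound -/

section

variable {K : ℕ} {α β₁ βb β : ℝ} {L p q : Fin K → ℝ}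

/-- The stability of one round in which arm `I` was played. If `q I ≤ 1/2`, only the coordinate of
`I` moves essentially. If `q I > 1/2`, the estimate is first shifted by a constant vector so that
arm `I` has loss `0` and the others have a loss in `[-2, 0]`. -/
lemma estimate_mul_sub_sub_bregman_le (h0 : 0 < α) (h1 : α < 1) (hβ : 8 ≤ β * (1 - α))
    (hq : q ∈ stdSimplex ℝ (Fin K)) (hpos : ∀ i, 0 < q i) (hp : p ∈ stdSimplex ℝ (Fin K))
    (I : Fin K) {x : ℝ} (hx0 : 0 ≤ x) (hx1 : x ≤ 1) :
    x / q I * (q I - p I) - β * ∑ j, bregman α (p j) (q j) ≤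
      6 * min (q I) (1 - q I) ^ (1 - α) / (q I * (β * (1 - α))) := by
  have h1' : 0 < 1 - α := by linarith
  have hβ0 : 0 < β := by by_contra h; nlinarith
  have hI := hpos I
  have hI1 := le_one_of_mem_stdSimplex hq I
  have ha : 0 ≤ x / q I := div_nonneg hx0 hI.le
  have hbr : ∀ j, 0 ≤ bregman α (p j) (q j) := fun j => bregman_nonneg h0 h1 (hp.1 j) (hpos j)
  have hB : 0 < β * (1 - α) := by linarith
  rw [← Finset.add_sum_erase _ _ (Finset.mem_univ I)]
  rcases le_or_gt (q I) (1 / 2) with hhalf | hhalf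
  · rw [min_eq_left (by linarith)]
    have e1 := mul_sub_sub_bregman_le (β := β) h0 h1 hβ0 ha (hp.1 I) hI
    have e2 : 0 ≤ ∑ j ∈ Finset.univ.erase I, bregman α (p j) (q j) :=
      Finset.sum_nonneg fun j _ => hbr j
    have e3 : (x / q I) ^ 2 * q I ^ (2 - α) ≤ q I ^ (1 - α) / q I := by
      have : q I ^ (2 - α) = q I ^ (1 - α) * q I := by
        rw [← Real.rpow_add_one hI.ne']; congr 1; ring
      rw [this, show (x / q I) ^ 2 * (q I ^ (1 - α) * q I) = x ^ 2 * (q I ^ (1 - α) / q I) by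
        field_simp]
      refine mul_le_of_le_one_left (by positivity) (pow_le_one₀ hx0 hx1)
    have e4 : (x / q I) ^ 2 * q I ^ (2 - α) / (2 * (β * (1 - α))) ≤
        6 * q I ^ (1 - α) / (q I * (β * (1 - α))) := by
      calc _ ≤ q I ^ (1 - α) / q I / (2 * (β * (1 - α))) := by gcongr
        _ = 1 / 2 * (q I ^ (1 - α) / (q I * (β * (1 - α)))) := by field_simp
        _ ≤ 6 * (q I ^ (1 - α) / (q I * (β * (1 - α)))) := by
            refine mul_le_mul_of_nonneg_right (by norm_num) (by positivity)
        _ = _ := by ring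
    have := mul_nonneg hβ0.le e2
    linarith
  · rw [min_eq_right (by linarith)]
    have e0 : q I - p I = ∑ j ∈ Finset.univ.erase I, (p j - q j) := by
      rw [Finset.sum_sub_distrib, sum_erase_eq_one_sub hq, sum_erase_eq_one_sub hp]; ring
    have ha2 : x / q I ≤ 2 := by rw [div_le_iff₀ hI]; linarith
    have hterm : ∀ j ∈ Finset.univ.erase I,
        x / q I * (p j - q j) - β * bregman α (p j) (q j) ≤
          6 / (β * (1 - α)) * (q j * (1 - q I) ^ (1 - α)) := by
      intro j hj
      have e1 := mul_sub_sub_bregman_le_of_le_two h0 h1 hβ ha ha2 (hp.1 j) (hpos j)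
        (le_one_of_mem_stdSimplex hq j)
      have e2 : q j ^ (2 - α) ≤ q j * (1 - q I) ^ (1 - α) := by
        have : q j ^ (2 - α) = q j * q j ^ (1 - α) := by
          rw [mul_comm, ← Real.rpow_add_one (hpos j).ne']; congr 1; ring
        rw [this]
        refine mul_le_mul_of_nonneg_left (Real.rpow_le_rpow (hpos j).le ?_ h1'.le) (hpos j).le
        have := add_le_one_of_mem_stdSimplex hq (Finset.ne_of_mem_erase hj)
        linarith
      calc _ ≤ _ := e1
        _ = 6 / (β * (1 - α)) * q j ^ (2 - α) := by ring
        _ ≤ _ := mul_le_mul_of_nonneg_left e2 (by positivity)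
    have hsum := Finset.sum_le_sum hterm
    rw [Finset.sum_sub_distrib, ← Finset.mul_sum, ← Finset.mul_sum, ← Finset.mul_sum,
      ← Finset.sum_mul, sum_erase_eq_one_sub hq, ← e0] at hsum
    have hR : 0 ≤ (1 - q I) ^ (1 - α) := Real.rpow_nonneg (by linarith) _
    have e5 : 6 / (β * (1 - α)) * ((1 - q I) * (1 - q I) ^ (1 - α)) ≤
        6 * (1 - q I) ^ (1 - α) / (q I * (β * (1 - α))) := by
      calc _ ≤ 6 / (β * (1 - α)) * ((1 / q I) * (1 - q I) ^ (1 - α)) := by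
            have : 1 - q I ≤ 1 / q I := by
              rw [le_div_iff₀ hI]; nlinarith
            gcongr
        _ = _ := by field_simp
    have := mul_nonneg hβ0.le (hbr I)
    linarith

/-! ### Sequences of states -/

lemma ValidParams.isFTRLMin_dist (hv : ValidParams K α β₁ βb) (s : State K) :
    IsFTRLMin α βb s.cumLoss s.beta (s.dist α βb) :=
  ftrlDist_spec hv.card_pos hv.pos hv.lt_one _ _ _

lemma ValidParams.dist_pos (hv : ValidParams K α β₁ βb) {s : State K} (hs : β₁ ≤ s.beta)
    (i : Fin K) : 0 < s.dist α βb i :=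
  (hv.isFTRLMin_dist s).pos hv.pos hv.lt_one (hv.beta_pos.trans_le hs) hv.betaBar_nonneg i

lemma ValidParams.stability_nonneg (hv : ValidParams K α β₁ βb) (s : State K) :
    0 ≤ stability α (s.dist α βb) :=
  TsallisBandit.stability_nonneg hv.card_pos hv.lt_one (hv.isFTRLMin_dist s).1

lemma ValidParams.penalty_pos (hv : ValidParams K α β₁ βb) {s : State K} (hs : β₁ ≤ s.beta) :
    0 < penalty α (s.dist α βb) :=
  TsallisBandit.penalty_pos hv.two_le hv.pos hv.lt_one (hv.isFTRLMin_dist s).1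
    (hv.dist_pos hs)

lemma ValidParams.beta_le_next (hv : ValidParams K α β₁ βb) {s : State K} (hs : β₁ ≤ s.beta)
    (I : Fin K) (x : ℝ) : s.beta ≤ (s.next α βb I x).beta :=
  le_add_of_nonneg_right (div_nonneg (hv.stability_nonneg s)
    (mul_nonneg (hv.beta_pos.le.trans hs) (hv.penalty_pos hs).le))

lemma ValidParams.le_beta_stateAt (hv : ValidParams K α β₁ βb) (a : ℕ → Fin K) (x : ℕ → ℝ)
    (t : ℕ) : β₁ ≤ (stateAt α β₁ βb a x t).beta := by
  induction t with
  | zero => exact le_rfl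
  | succ t ih => exact ih.trans (hv.beta_le_next ih _ _)

/-- The squared learning-rate parameters grow by at least the ratios of stability and penalty. -/
lemma ValidParams.sum_le_beta_sq (hv : ValidParams K α β₁ βb) (a : ℕ → Fin K) (x : ℕ → ℝ)
    (t : ℕ) :
    ∑ s ∈ Finset.range t, stability α ((stateAt α β₁ βb a x s).dist α βb) /
      penalty α ((stateAt α β₁ βb a x s).dist α βb) ≤ (stateAt α β₁ βb a x t).beta ^ 2 := by
  induction t with
  | zero => simp only [Finset.range_zero, Finset.sum_empty]; positivity
  | succ t ih =>
    rw [Finset.sum_range_succ]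
    have hs := hv.le_beta_stateAt a x t
    set s := stateAt α β₁ βb a x t
    have e : (stateAt α β₁ βb a x (t + 1)).beta = s.beta +
      stability α (s.dist α βb) / (s.beta * penalty α (s.dist α βb)) := rfl
    have hz := hv.stability_nonneg s
    have hh := hv.penalty_pos hs
    have hβ := hv.beta_pos.trans_le hs
    rw [e]
    have e2 : s.beta * (stability α (s.dist α βb) / (s.beta * penalty α (s.dist α βb))) =
      stability α (s.dist α βb) / penalty α (s.dist α βb) := by field_simp
    have e3 : 0 ≤ stability α (s.dist α βb) / penalty α (s.dist α βb) := by positivity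
    nlinarith [sq_nonneg (stability α (s.dist α βb) / (s.beta * penalty α (s.dist α βb)))]

lemma objective_next (s : State K) (I : Fin K) (x : ℝ) (p : Fin K → ℝ) :
    objective α βb (s.next α βb I x).cumLoss (s.next α βb I x).beta p =
      objective α βb s.cumLoss s.beta p + x / s.dist α βb I * p I
        - stability α (s.dist α βb) / (s.beta * penalty α (s.dist α βb)) * penalty α p := by
  have e : ∑ j, lossEstimate (s.dist α βb) I x j * p j = x / s.dist α βb I * p I := by
    unfold lossEstimate
    rw [Finset.sum_eq_single I]
    · simp
    · intro j _ hj; rw [if_neg hj.symm, zero_mul]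
    · simp
  unfold objective State.next penalty
  simp only [add_mul, Finset.sum_add_distrib]
  rw [e]
  ring

/-- The potential argument for one round: the minimal value of the objective grows by the observed
loss, up to the stability term of the round and the change of the penalty. -/
lemma ValidParams.objective_add_le (hv : ValidParams K α β₁ βb) {s : State K} (hs : β₁ ≤ s.beta)
    (I : Fin K) {x : ℝ} (hx0 : 0 ≤ x) (hx1 : x ≤ 1) :
    objective α βb s.cumLoss s.beta (s.dist α βb) + x ≤
      objective α βb (s.next α βb I x).cumLoss (s.next α βb I x).beta
        ((s.next α βb I x).dist α βb)
      + (6 * min (s.dist α βb I) (qStar (s.dist α βb)) ^ (1 - α)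
          / (s.dist α βb I * (s.beta * (1 - α)))
        + 4 * (stability α (s.dist α βb) / s.beta)) := by
  rw [objective_next]
  have hq := hv.isFTRLMin_dist (α := α) (βb := βb) s
  have hq' := hv.isFTRLMin_dist (α := α) (βb := βb) (s.next α βb I x)
  have hpos := hv.dist_pos hs
  have hfour := hv.dist_next_le s hs I hx0 hx1
  have hβ0 := hv.beta_pos.trans_le hs
  have h8 : 8 ≤ s.beta * (1 - α) :=
    hv.eight_le.trans (mul_le_mul_of_nonneg_right hs hv.one_sub_pos.le)
  have hh := hv.penalty_pos hs
  have hz := hv.stability_nonneg s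
  set p := (s.next α βb I x).dist α βb
  set q := s.dist α βb
  have e1 := hq.add_bregman_le hv.pos hv.lt_one hβ0 hv.betaBar_nonneg hq'.1
  have e2 := estimate_mul_sub_sub_bregman_le hv.pos hv.lt_one h8 hq.1 hpos hq'.1 I hx0 hx1
  have e3 := penalty_le_four_mul hv.pos hv.lt_one hq.1 hq'.1 hpos hfour
  have e4 : stability α q / (s.beta * penalty α q) * penalty α p ≤
      4 * (stability α q / s.beta) := by
    calc _ ≤ stability α q / (s.beta * penalty α q) * (4 * penalty α q) :=
          mul_le_mul_of_nonneg_left e3 (by positivity)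
      _ = _ := by field_simp
  have e5 : 6 * min (q I) (1 - q I) ^ (1 - α) / (q I * (s.beta * (1 - α))) ≤
      6 * min (q I) (qStar q) ^ (1 - α) / (q I * (s.beta * (1 - α))) := by
    have := hv.one_sub_pos
    have hI := hpos I
    have h3 : 0 ≤ min (q I) (1 - q I) :=
      le_min hI.le (sub_nonneg.2 (le_one_of_mem_stdSimplex hq.1 I))
    have := Real.rpow_le_rpow h3 (min_one_sub_le_min_qStar hv.card_pos hq.1 I) this.le
    gcongr
  have e6 : x / q I * (q I - p I) = x - x / q I * p I := by
    have := (hpos I).ne'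
    field_simp
  linarith

lemma penalty_single (h0 : 0 < α) (i : Fin K) : penalty α (Pi.single i (1 : ℝ)) = 0 := by
  rw [penalty_eq_sum]
  refine Finset.sum_eq_zero fun j _ => ?_
  rcases eq_or_ne j i with rfl | h
  · rw [Pi.single_eq_same, entropyTerm_one]
  · rw [Pi.single_eq_of_ne h, entropyTerm_zero h0]

/-- The regret of the estimated losses against arm `i` on one path. -/
lemma ValidParams.sum_loss_le (hv : ValidParams K α β₁ βb) (a : ℕ → Fin K) {x : ℕ → ℝ}
    (hx : ∀ t, x t ∈ Set.Icc (0 : ℝ) 1) (T : ℕ) (i : Fin K) :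
    ∑ t ∈ Finset.range T, x t ≤
      ∑ t ∈ Finset.range T, lossEstimate ((stateAt α β₁ βb a x t).dist α βb) (a t) (x t) i
      + ∑ t ∈ Finset.range T,
        (6 * min ((stateAt α β₁ βb a x t).dist α βb (a t))
            (qStar ((stateAt α β₁ βb a x t).dist α βb)) ^ (1 - α)
          / ((stateAt α β₁ βb a x t).dist α βb (a t)
            * ((stateAt α β₁ βb a x t).beta * (1 - α)))
        + 4 * (stability α ((stateAt α β₁ βb a x t).dist α βb) / (stateAt α β₁ βb a x t).beta))
      + (β₁ * penalty α (firstDist K α β₁ βb) + βb * penalty (1 - α) (firstDist K α β₁ βb)) := by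
  set s := stateAt α β₁ βb a x with hs
  have hcum : ∀ T, (s T).cumLoss i =
      ∑ t ∈ Finset.range T, lossEstimate ((s t).dist α βb) (a t) (x t) i := by
    intro T
    induction T with
    | zero => rfl
    | succ T ih => rw [Finset.sum_range_succ, ← ih]; rfl
  have hpot : ∀ T, objective α βb (s 0).cumLoss (s 0).beta ((s 0).dist α βb)
      + ∑ t ∈ Finset.range T, x t ≤
      objective α βb (s T).cumLoss (s T).beta ((s T).dist α βb)
      + ∑ t ∈ Finset.range T,
        (6 * min ((s t).dist α βb (a t)) (qStar ((s t).dist α βb)) ^ (1 - α)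
          / ((s t).dist α βb (a t) * ((s t).beta * (1 - α)))
        + 4 * (stability α ((s t).dist α βb) / (s t).beta)) := by
    intro T
    induction T with
    | zero => simp
    | succ T ih =>
      rw [Finset.sum_range_succ, Finset.sum_range_succ]
      have := hv.objective_add_le (hv.le_beta_stateAt a x T) (a T) (hx T).1 (hx T).2
      have e : s (T + 1) = (s T).next α βb (a T) (x T) := rfl
      rw [e]
      linarith
  have hinit : objective α βb (s 0).cumLoss (s 0).beta ((s 0).dist α βb) =
      -(β₁ * penalty α (firstDist K α β₁ βb) + βb * penalty (1 - α) (firstDist K α β₁ βb)) := by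
    have e : s 0 = initState K β₁ := rfl
    rw [e]
    unfold objective penalty firstDist
    simp [initState]
    ring
  have hfin : objective α βb (s T).cumLoss (s T).beta ((s T).dist α βb) ≤ (s T).cumLoss i := by
    refine ((hv.isFTRLMin_dist (s T)).2 (single_mem_stdSimplex ℝ i)).trans (le_of_eq ?_)
    have e1 := penalty_single hv.pos i
    have e2 := penalty_single hv.one_sub_pos i
    unfold penalty at e1 e2
    unfold objective
    rw [neg_eq_zero.1 e1, neg_eq_zero.1 e2]
    simp [Pi.single_apply]
  have := hpot T
  rw [hinit] at this
  rw [hcum] at hfin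
  linarith

/-! ### The first distribution is uniform and maximises the penalty -/

lemma sum_rpow_le_card_rpow (hK : 0 < K) (h0 : 0 < α) (h1 : α < 1)
    (hq : q ∈ stdSimplex ℝ (Fin K)) : ∑ i, q i ^ α ≤ (K : ℝ) ^ (1 - α) := by
  have hK0 : (0 : ℝ) < K := by exact_mod_cast hK
  have h := (Real.concaveOn_rpow h0.le h1.le).le_map_sum (t := Finset.univ)
    (w := fun _ : Fin K => (K : ℝ)⁻¹) (p := q) (fun _ _ => by positivity)
    (by simp [hK0.ne']) (fun i _ => hq.1 i)
  simp only [smul_eq_mul] at h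
  rw [← Finset.mul_sum, ← Finset.mul_sum, hq.2, mul_one, Real.inv_rpow hK0.le,
    inv_mul_le_iff₀ hK0] at h
  rwa [Real.rpow_sub hK0, Real.rpow_one, div_eq_mul_inv]

lemma penalty_eq_sum_rpow (hq : q ∈ stdSimplex ℝ (Fin K)) :
    penalty α q = (∑ i, q i ^ α - 1) / α := by
  unfold penalty tsallis
  rw [Finset.sum_sub_distrib, hq.2]
  ring

lemma ValidParams.firstDist_mem (hv : ValidParams K α β₁ βb) :
    firstDist K α β₁ βb ∈ stdSimplex ℝ (Fin K) :=
  (hv.isFTRLMin_dist (initState K β₁)).1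

lemma ValidParams.firstDist_eq (hv : ValidParams K α β₁ βb) (i : Fin K) :
    firstDist K α β₁ βb i = (K : ℝ)⁻¹ := by
  have hq := hv.isFTRLMin_dist (initState K β₁)
  have hall : ∀ j, firstDist K α β₁ βb j = firstDist K α β₁ βb i := by
    intro j
    have hiff := hq.le_iff_le hv.pos hv.lt_one hv.beta_pos hv.betaBar_nonneg
    exact le_antisymm ((hiff j i).2 le_rfl) ((hiff i j).2 le_rfl)
  have hsum := hv.firstDist_mem.2
  rw [Finset.sum_congr rfl fun j _ => hall j, Finset.sum_const, Finset.card_univ,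
    Fintype.card_fin, nsmul_eq_mul] at hsum
  exact eq_inv_of_mul_eq_one_right hsum

lemma ValidParams.penalty_firstDist (hv : ValidParams K α β₁ βb) :
    penalty α (firstDist K α β₁ βb) = ((K : ℝ) ^ (1 - α) - 1) / α := by
  have hK0 : (0 : ℝ) < K := by exact_mod_cast hv.card_pos
  rw [penalty_eq_sum_rpow hv.firstDist_mem, Finset.sum_congr rfl fun i _ => by rw [hv.firstDist_eq]]
  rw [Finset.sum_const, Finset.card_univ, Fintype.card_fin, nsmul_eq_mul, Real.inv_rpow hK0.le,
    Real.rpow_sub hK0, Real.rpow_one, ← div_eq_mul_inv]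

lemma ValidParams.penalty_le (hv : ValidParams K α β₁ βb) (hq : q ∈ stdSimplex ℝ (Fin K)) :
    penalty α q ≤ penalty α (firstDist K α β₁ βb) := by
  rw [hv.penalty_firstDist, penalty_eq_sum_rpow hq]
  have := sum_rpow_le_card_rpow hv.card_pos hv.pos hv.lt_one hq
  exact div_le_div_of_nonneg_right (by linarith) hv.pos.le

lemma stability_le_card_rpow (hK : 0 < K) (h0 : 0 < α) (h1 : α < 1)
    (hq : q ∈ stdSimplex ℝ (Fin K)) : stability α q ≤ (K : ℝ) ^ α / (1 - α) := by
  have h1' : 0 < 1 - α := by linarith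
  have e := sum_rpow_le_card_rpow (α := 1 - α) hK h1' (by linarith) hq
  rw [sub_sub_cancel] at e
  have e2 : ∑ i, min (q i) (qStar q) ^ (1 - α) ≤ ∑ i, q i ^ (1 - α) :=
    Finset.sum_le_sum fun i _ => Real.rpow_le_rpow
      (le_min (hq.1 i) (qStar_nonneg hK hq)) (min_le_left _ _) h1'.le
  unfold stability
  rw [one_div, inv_mul_eq_div]
  exact div_le_div_of_nonneg_right (e2.trans e) h1'.le

/-- The worst-case stability bound `K ^ α / (1 - α)` is matched to the initial penalty. -/
lemma ValidParams.penalty_firstDist_mul_le (hv : ValidParams K α β₁ βb) :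
    penalty α (firstDist K α β₁ βb) * ((K : ℝ) ^ α / (1 - α)) ≤ (K - 1) / (α * (1 - α)) := by
  have h0 := hv.pos
  have h1' := hv.one_sub_pos
  have hK1 : (1 : ℝ) ≤ K := by have := hv.two_le_cast; linarith
  rw [hv.penalty_firstDist, div_mul_div_comm]
  refine div_le_div_of_nonneg_right ?_ (by positivity)
  rw [sub_mul, ← Real.rpow_add (by linarith), sub_add_cancel, Real.rpow_one, one_mul]
  have := Real.one_le_rpow hK1 h0.le
  linarith

end

/-! ### Sums over adaptive learning rates -/

lemma div_le_two_mul_sqrt_sub {u b V : ℝ} (hV : 0 ≤ V) (hu : 0 ≤ u) (hb : 0 < b)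
    (hVb : V + u ≤ b ^ 2) : u / b ≤ 2 * (√(V + u) - √V) := by
  have h1 := Real.sq_sqrt hV
  have h2 := Real.sq_sqrt (add_nonneg hV hu)
  have h3 : √(V + u) ≤ b := Real.sqrt_le_iff.2 ⟨hb.le, hVb⟩
  have h4 : √V ≤ √(V + u) := Real.sqrt_le_sqrt (by linarith)
  have h5 := Real.sqrt_nonneg V
  rw [div_le_iff₀ hb]
  nlinarith

lemma div_add_le_log_sub {u V : ℝ} (hV : 0 < V) (hu : 0 ≤ u) :
    u / (V + u) ≤ Real.log (V + u) - Real.log V := by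
  have h := Real.one_sub_inv_le_log_of_pos (show 0 < (V + u) / V by positivity)
  rw [Real.log_div (by positivity) hV.ne'] at h
  refine le_trans (le_of_eq ?_) h
  field_simp
  ring

lemma sum_div_le_two_mul_sqrt {z b : ℕ → ℝ} {G : ℝ} (hG : 0 < G) (hz : ∀ t, 0 ≤ z t)
    (hb : ∀ t, 0 < b t) (hbz : ∀ t, ∑ s ∈ Finset.range (t + 1), z s / G ≤ b t ^ 2) (T : ℕ) :
    ∑ t ∈ Finset.range T, z t / b t ≤ 2 * √(G * ∑ t ∈ Finset.range T, z t) := by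
  have hnn : ∀ t, 0 ≤ ∑ s ∈ Finset.range t, z s / G := fun t =>
    Finset.sum_nonneg fun s _ => div_nonneg (hz s) hG.le
  have key : ∑ t ∈ Finset.range T, z t / b t ≤
      2 * (G * √(∑ s ∈ Finset.range T, z s / G)) := by
    induction T with
    | zero => simp
    | succ T ih =>
      rw [Finset.sum_range_succ, Finset.sum_range_succ]
      have h := hbz T
      rw [Finset.sum_range_succ] at h
      have h1 := div_le_two_mul_sqrt_sub (hnn T) (div_nonneg (hz T) hG.le) (hb T) h
      have h2 := mul_le_mul_of_nonneg_left h1 hG.le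
      rw [show G * (z T / G / b T) = z T / b T by field_simp] at h2
      linarith
  refine key.trans (le_of_eq ?_)
  rw [← Finset.sum_div]
  have e : G * (∑ t ∈ Finset.range T, z t) = G ^ 2 * ((∑ t ∈ Finset.range T, z t) / G) := by
    field_simp
  rw [e, Real.sqrt_mul (by positivity), Real.sqrt_sq hG.le]

/-- The rounds up to the time at which `∑ z / h` exceeds `s₀` cost at most `2 H √s₀`; the later
ones are bounded by Cauchy-Schwarz and a logarithmic sum. -/
lemma sum_div_le_sqrt_mul_log {z h b : ℕ → ℝ} {H s₀ : ℝ} (hs : 0 < s₀) (hz : ∀ t, 0 ≤ z t)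
    (hh : ∀ t, 0 < h t) (hH : ∀ t, h t ≤ H) (hb : ∀ t, 0 < b t)
    (hbz : ∀ t, ∑ s ∈ Finset.range (t + 1), z s / h s ≤ b t ^ 2) (T : ℕ) :
    ∑ t ∈ Finset.range T, z t / b t ≤ 2 * (H * √s₀) +
      √2 * (√(∑ t ∈ Finset.range T, z t * h t) *
        √(Real.log (1 + (∑ t ∈ Finset.range T, z t / h t) / s₀))) := by
  set U : ℕ → ℝ := fun t => ∑ s ∈ Finset.range t, z s / h s with hU
  have hu : ∀ t, 0 ≤ z t / h t := fun t => div_nonneg (hz t) (hh t).le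
  have hU0 : ∀ t, 0 ≤ U t := fun t => Finset.sum_nonneg fun s _ => hu s
  have hUs : ∀ t, U (t + 1) = U t + z t / h t := fun t => Finset.sum_range_succ _ _
  have hH0 : 0 < H := (hh 0).trans_le (hH 0)
  have hmain : ∑ t ∈ Finset.range T, z t / b t ≤ 2 * (H * √(min (U T) s₀)) +
      √2 * ∑ t ∈ Finset.range T, z t / √(s₀ + U (t + 1)) := by
    induction T with
    | zero => simp [hU, hs.le]
    | succ T ih =>
      rw [Finset.sum_range_succ, Finset.sum_range_succ]
      rcases le_or_gt (U (T + 1)) s₀ with hle | hgt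
      · have h0 : U T ≤ s₀ := by have := hUs T; have := hu T; linarith
        rw [min_eq_left h0] at ih
        rw [min_eq_left hle]
        have hbT := hbz T
        change U (T + 1) ≤ _ at hbT
        rw [hUs] at hbT
        have h1 := div_le_two_mul_sqrt_sub (hU0 T) (hu T) (hb T) hbT
        have h2 : z T / b T ≤ H * (z T / h T / b T) := by
          rw [← mul_div_assoc]
          refine div_le_div_of_nonneg_right ?_ (hb T).le
          rw [mul_div_assoc', le_div_iff₀ (hh T), mul_comm]
          exact mul_le_mul_of_nonneg_right (hH T) (hz T)
        have h3 := mul_le_mul_of_nonneg_left h1 hH0.le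
        rw [← hUs] at h3
        have h4 : 0 ≤ √2 * (z T / √(s₀ + U (T + 1))) := by have := hz T; positivity
        linarith
      · have h1 : min (U T) s₀ ≤ min (U (T + 1)) s₀ :=
          min_le_min_right _ (by have := hUs T; have := hu T; linarith)
        have h2 := mul_le_mul_of_nonneg_left (Real.sqrt_le_sqrt h1) hH0.le
        have h3 : z T / b T ≤ √2 * (z T / √(s₀ + U (T + 1))) := by
          have hpos : 0 < √(s₀ + U (T + 1)) := Real.sqrt_pos.2 (by linarith)
          have h5 : √(s₀ + U (T + 1)) ≤ √2 * b T := by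
            rw [Real.sqrt_le_iff]
            refine ⟨by have := hb T; positivity, ?_⟩
            rw [mul_pow, Real.sq_sqrt (by norm_num)]
            have := hbz T
            change U (T + 1) ≤ _ at this
            linarith
          rw [← mul_div_assoc, div_le_div_iff₀ (hb T) hpos]
          have := mul_le_mul_of_nonneg_left h5 (hz T)
          linarith
        linarith
  have hlog : ∑ t ∈ Finset.range T, z t / h t / (s₀ + U (t + 1)) ≤
      Real.log (s₀ + U T) - Real.log s₀ := by
    clear hmain
    induction T with
    | zero => simp [hU]
    | succ T ih =>
      rw [Finset.sum_range_succ]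
      have := div_add_le_log_sub (V := s₀ + U T) (by have := hU0 T; linarith) (hu T)
      rw [add_assoc, ← hUs] at this
      linarith
  have hlog2 : Real.log (s₀ + U T) - Real.log s₀ = Real.log (1 + U T / s₀) := by
    rw [← Real.log_div (by have := hU0 T; linarith) hs.ne', add_div, div_self hs.ne']
  rw [hlog2] at hlog
  have hpos : ∀ t, 0 < s₀ + U (t + 1) := fun t => by have := hU0 (t + 1); linarith
  have hcs : ∑ t ∈ Finset.range T, z t / √(s₀ + U (t + 1)) ≤
      √(∑ t ∈ Finset.range T, z t * h t) * √(Real.log (1 + U T / s₀)) := by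
    have h1 := Real.sum_sqrt_mul_sqrt_le (Finset.range T) (f := fun t => z t * h t)
      (g := fun t => z t / h t / (s₀ + U (t + 1)))
      (fun t => mul_nonneg (hz t) (hh t).le) (fun t => div_nonneg (hu t) (hpos t).le)
    refine le_trans (le_of_eq (Finset.sum_congr rfl fun t _ => ?_))
      (h1.trans (mul_le_mul_of_nonneg_left (Real.sqrt_le_sqrt hlog) (Real.sqrt_nonneg _)))
    rw [← Real.sqrt_mul (mul_nonneg (hz t) (hh t).le),
      show z t * h t * (z t / h t / (s₀ + U (t + 1))) = z t ^ 2 / (s₀ + U (t + 1)) by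
        have := (hh t).ne'
        field_simp,
      Real.sqrt_div (by positivity), Real.sqrt_sq (hz t)]
  refine hmain.trans (add_le_add ?_ (mul_le_mul_of_nonneg_left hcs (Real.sqrt_nonneg 2)))
  have := mul_le_mul_of_nonneg_left (Real.sqrt_le_sqrt (min_le_right (U T) s₀)) hH0.le
  linarith

lemma logPlus_nonneg (x : ℝ) : 0 ≤ logPlus x := zero_le_one.trans (le_max_left _ _)

lemma log_one_add_sq_le {x : ℝ} (hx : 0 ≤ x) : Real.log (1 + x ^ 2) ≤ 3 * logPlus x := by
  have h1 : 1 ≤ logPlus x := le_max_left _ _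
  have h2 : Real.log x ≤ logPlus x := le_max_right _ _
  have hlog2 : Real.log 2 ≤ 1 := by
    have := Real.log_le_sub_one_of_pos (show (0 : ℝ) < 2 by norm_num); linarith
  rcases le_total x 1 with hx1 | hx1
  · have : Real.log (1 + x ^ 2) ≤ Real.log 2 :=
      Real.log_le_log (by positivity) (by nlinarith)
    linarith
  · have : Real.log (1 + x ^ 2) ≤ Real.log (2 * x ^ 2) :=
      Real.log_le_log (by positivity) (by nlinarith)
    rw [Real.log_mul (by norm_num) (by positivity), Real.log_pow] at this
    push_cast at this
    linarith

/-- Rounds with a small penalty `h t < θ H` are cheap because of the small penalty, and for the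
other ones `z / h` is bounded, which keeps the logarithm under control. The threshold `θ` and the
starting point `s₀` of the logarithmic sum balance the error terms at `√W`. -/
lemma sum_div_le_sqrt_add_logPlus {z h b : ℕ → ℝ} {H Z W : ℝ} (hW : 0 < W) (hZ : 0 < Z)
    (hz : ∀ t, 0 ≤ z t) (hzZ : ∀ t, z t ≤ Z)
    (hh : ∀ t, 0 < h t) (hH : ∀ t, h t ≤ H) (hb : ∀ t, 0 < b t)
    (hbz : ∀ t, ∑ s ∈ Finset.range (t + 1), z s / h s ≤ b t ^ 2) (T : ℕ) :
    ∑ t ∈ Finset.range T, z t / b t ≤ 4 * √W +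
      3 * √(logPlus (H * Z * T / W) * ∑ t ∈ Finset.range T, z t * h t) := by
  rcases Nat.eq_zero_or_pos T with rfl | hT
  · simp
  have hT0 : (0 : ℝ) < T := by exact_mod_cast hT
  have hH0 : 0 < H := (hh 0).trans_le (hH 0)
  obtain ⟨θ, hθ⟩ : ∃ θ, θ = W / (H * Z * T) := ⟨_, rfl⟩
  obtain ⟨s₀, hs⟩ : ∃ s₀, s₀ = W / H ^ 2 := ⟨_, rfl⟩
  have hθ0 : 0 < θ := by rw [hθ]; positivity
  have hs0 : 0 < s₀ := by rw [hs]; positivity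
  set zA : ℕ → ℝ := fun t => if θ * H ≤ h t then z t else 0 with hzA
  set zB : ℕ → ℝ := fun t => if θ * H ≤ h t then 0 else z t with hzB
  have hAB : ∀ t, z t = zA t + zB t := by
    intro t; simp only [hzA, hzB]; split_ifs <;> simp
  have hA0 : ∀ t, 0 ≤ zA t := by
    intro t; simp only [hzA]; split_ifs; exacts [hz t, le_rfl]
  have hB0 : ∀ t, 0 ≤ zB t := by
    intro t; simp only [hzB]; split_ifs; exacts [le_rfl, hz t]
  have hA1 : ∀ t, zA t ≤ z t := fun t => by have := hAB t; have := hB0 t; linarith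
  have hB1 : ∀ t, zB t ≤ z t := fun t => by have := hAB t; have := hA0 t; linarith
  have hbA : ∀ t, ∑ s ∈ Finset.range (t + 1), zA s / h s ≤ b t ^ 2 := fun t =>
    (Finset.sum_le_sum fun s _ => div_le_div_of_nonneg_right (hA1 s) (hh s).le).trans (hbz t)
  have hbB : ∀ t, ∑ s ∈ Finset.range (t + 1), zB s / (θ * H) ≤ b t ^ 2 := by
    intro t
    refine (Finset.sum_le_sum fun s _ => ?_).trans (hbz t)
    simp only [hzB]
    split_ifs with hc
    · rw [zero_div]; exact div_nonneg (hz s) (hh s).le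
    · exact div_le_div_of_nonneg_left (hz s) (hh s) (not_le.1 hc).le
  have hB := sum_div_le_two_mul_sqrt (mul_pos hθ0 hH0) hB0 hb hbB T
  have hA := sum_div_le_sqrt_mul_log hs0 hA0 hh hH hb hbA T
  have hsumZ : ∀ y : ℕ → ℝ, (∀ t, y t ≤ z t) → ∑ t ∈ Finset.range T, y t ≤ T * Z := by
    intro y hy
    refine (Finset.sum_le_card_nsmul _ _ Z fun t _ => (hy t).trans (hzZ t)).trans ?_
    rw [Finset.card_range, nsmul_eq_mul]
  have hBW : √(θ * H * ∑ t ∈ Finset.range T, zB t) ≤ √W := by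
    refine Real.sqrt_le_sqrt ?_
    calc _ ≤ θ * H * (T * Z) := mul_le_mul_of_nonneg_left (hsumZ _ hB1) (by positivity)
      _ = W := by rw [hθ]; field_simp
  have hsW : H * √s₀ = √W := by
    rw [hs, Real.sqrt_div hW.le, Real.sqrt_sq hH0.le]; field_simp
  have hU : (∑ t ∈ Finset.range T, zA t / h t) / s₀ ≤ (H * Z * T / W) ^ 2 := by
    have h1 : ∑ t ∈ Finset.range T, zA t / h t ≤ T * Z / (θ * H) := by
      calc _ ≤ ∑ t ∈ Finset.range T, zA t / (θ * H) := by
            refine Finset.sum_le_sum fun t _ => ?_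
            simp only [hzA]
            split_ifs with hc
            · exact div_le_div_of_nonneg_left (hz t) (by positivity) hc
            · simp
        _ = (∑ t ∈ Finset.range T, zA t) / (θ * H) := by rw [Finset.sum_div]
        _ ≤ _ := div_le_div_of_nonneg_right (hsumZ _ hA1) (by positivity)
    calc _ ≤ T * Z / (θ * H) / s₀ := div_le_div_of_nonneg_right h1 hs0.le
      _ = _ := by rw [hθ, hs]; field_simp
  have hU0 : 0 ≤ (∑ t ∈ Finset.range T, zA t / h t) / s₀ :=
    div_nonneg (Finset.sum_nonneg fun t _ => div_nonneg (hA0 t) (hh t).le) hs0.le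
  have hlog : Real.log (1 + (∑ t ∈ Finset.range T, zA t / h t) / s₀) ≤
      3 * logPlus (H * Z * T / W) :=
    (Real.log_le_log (by linarith) (by linarith)).trans (log_one_add_sq_le (by positivity))
  have hzh : ∑ t ∈ Finset.range T, zA t * h t ≤ ∑ t ∈ Finset.range T, z t * h t :=
    Finset.sum_le_sum fun t _ => mul_le_mul_of_nonneg_right (hA1 t) (hh t).le
  have hzh0 : 0 ≤ ∑ t ∈ Finset.range T, z t * h t :=
    Finset.sum_nonneg fun t _ => mul_nonneg (hz t) (hh t).le
  have hfin : √2 * (√(∑ t ∈ Finset.range T, zA t * h t) *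
        √(Real.log (1 + (∑ t ∈ Finset.range T, zA t / h t) / s₀))) ≤
      3 * √(logPlus (H * Z * T / W) * ∑ t ∈ Finset.range T, z t * h t) := by
    calc _ ≤ √2 * (√(∑ t ∈ Finset.range T, z t * h t) * √(3 * logPlus (H * Z * T / W))) := by
          gcongr
      _ = √(6 * (logPlus (H * Z * T / W) * ∑ t ∈ Finset.range T, z t * h t)) := by
          rw [← Real.sqrt_mul hzh0, ← Real.sqrt_mul (by norm_num)]
          congr 1; ring
      _ ≤ √(3 ^ 2 * (logPlus (H * Z * T / W) * ∑ t ∈ Finset.range T, z t * h t)) := by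
          refine Real.sqrt_le_sqrt (mul_le_mul_of_nonneg_right (by norm_num) ?_)
          exact mul_nonneg (logPlus_nonneg _) hzh0
      _ = _ := by rw [Real.sqrt_mul (by norm_num), Real.sqrt_sq (by norm_num)]
  have hsplit : ∑ t ∈ Finset.range T, z t / b t =
      ∑ t ∈ Finset.range T, zA t / b t + ∑ t ∈ Finset.range T, zB t / b t := by
    rw [← Finset.sum_add_distrib]
    exact Finset.sum_congr rfl fun t _ => by rw [← add_div, ← hAB]
  rw [hsplit]
  rw [hsW] at hA
  linarith

/-- Passing from `β (t + 1)` to `β t` costs a telescoping sum. -/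
lemma sum_div_le_add_sum_div_succ {z β : ℕ → ℝ} {Z : ℝ} (hZ : 0 ≤ Z) (hzZ : ∀ t, z t ≤ Z)
    (hβ : ∀ t, 0 < β t) (hmono : ∀ t, β t ≤ β (t + 1)) (T : ℕ) :
    ∑ t ∈ Finset.range T, z t / β t ≤ Z / β 0 + ∑ t ∈ Finset.range T, z t / β (t + 1) := by
  have key : ∑ t ∈ Finset.range T, z t / β t ≤
      Z * (1 / β 0 - 1 / β T) + ∑ t ∈ Finset.range T, z t / β (t + 1) := by
    induction T with
    | zero => simp
    | succ T ih =>
      rw [Finset.sum_range_succ, Finset.sum_range_succ]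
      have h1 : 0 ≤ 1 / β T - 1 / β (T + 1) :=
        sub_nonneg.2 (one_div_le_one_div_of_le (hβ T) (hmono T))
      have h2 := mul_le_mul_of_nonneg_right (hzZ T) h1
      have e1 : z T / β T = z T * (1 / β T) := by ring
      have e2 : z T / β (T + 1) = z T * (1 / β (T + 1)) := by ring
      rw [e1, e2]
      linarith
  have : 0 ≤ Z * (1 / β T) := mul_nonneg hZ (one_div_pos.2 (hβ T)).le
  have e : Z / β 0 = Z * (1 / β 0) := by ring
  rw [e]
  linarith

/-! ### Gaps and the quantity `ω(Δ)` -/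

section

variable {K : ℕ} {α : ℝ} {q Δ : Fin K → ℝ}

lemma sum_rpow_le_of_gap {ι : Type*} (s : Finset ι) {q Δ : ι → ℝ} (h0 : 0 < α) (h1 : α < 1)
    (hq : ∀ i, 0 ≤ q i) (hΔ : ∀ i ∈ s, 0 < Δ i) :
    ∑ i ∈ s, q i ^ α ≤ (∑ i ∈ s, Δ i * q i) ^ α * (∑ i ∈ s, Δ i ^ (-(α / (1 - α)))) ^ (1 - α) := by
  have h1' : 0 < 1 - α := by linarith
  have hpq : (1 / α).HolderConjugate (1 / (1 - α)) := by
    rw [Real.holderConjugate_iff]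
    refine ⟨(one_lt_div h0).2 h1, ?_⟩
    simp
  have h := Real.inner_le_Lp_mul_Lq_of_nonneg s hpq (f := fun i => (Δ i * q i) ^ α)
    (g := fun i => Δ i ^ (-α))
    (fun i hi => Real.rpow_nonneg (mul_nonneg (hΔ i hi).le (hq i)) _)
    (fun i hi => Real.rpow_nonneg (hΔ i hi).le _)
  rw [one_div_one_div, one_div_one_div] at h
  refine le_trans (le_of_eq (Finset.sum_congr rfl fun i hi => ?_)) (h.trans (le_of_eq ?_))
  · rw [Real.mul_rpow (hΔ i hi).le (hq i), mul_right_comm, ← Real.rpow_add (hΔ i hi)]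
    simp
  · congr 2
    · refine Finset.sum_congr rfl fun i hi => ?_
      rw [← Real.rpow_mul (mul_nonneg (hΔ i hi).le (hq i)), mul_one_div_cancel h0.ne',
        Real.rpow_one]
    · refine Finset.sum_congr rfl fun i hi => ?_
      rw [← Real.rpow_mul (hΔ i hi).le]
      congr 1
      ring

/-- Hölder's inequality bounds stability times penalty by the expected gap. -/
lemma stability_mul_penalty_le (hK : 0 < K) (h0 : 0 < α) (h1 : α < 1)
    (hq : q ∈ stdSimplex ℝ (Fin K)) {iStar : Fin K} (hΔ0 : ∀ i, 0 ≤ Δ i)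
    (hΔ : ∀ i, i ≠ iStar → 0 < Δ i) :
    stability α q * penalty α q ≤ omega α Δ iStar * ∑ i, Δ i * q i := by
  have h1' : 0 < 1 - α := by linarith
  have hΔ' : ∀ i ∈ Finset.univ.erase iStar, 0 < Δ i := fun i hi => hΔ i (Finset.ne_of_mem_erase hi)
  have hz := stability_le hK h0 h1 hq iStar
  have hh : penalty α q ≤ 1 / α * ∑ i ∈ Finset.univ.erase iStar, q i ^ α := by
    rw [penalty_eq_sum_rpow hq, ← Finset.add_sum_erase _ _ (Finset.mem_univ iStar),
      one_div, inv_mul_eq_div]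
    have := Real.rpow_le_one (hq.1 iStar) (le_one_of_mem_stdSimplex hq iStar) h0.le
    exact div_le_div_of_nonneg_right (by linarith) h0.le
  have hp := sum_rpow_le_of_gap (Finset.univ.erase iStar) h0 h1 hq.1 hΔ'
  have hp' := sum_rpow_le_of_gap (α := 1 - α) (Finset.univ.erase iStar) h1' (by linarith) hq.1 hΔ'
  rw [sub_sub_cancel] at hp'
  have hS0 : 0 ≤ ∑ i ∈ Finset.univ.erase iStar, Δ i * q i :=
    Finset.sum_nonneg fun i _ => mul_nonneg (hΔ0 i) (hq.1 i)
  have hSle : ∑ i ∈ Finset.univ.erase iStar, Δ i * q i ≤ ∑ i, Δ i * q i :=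
    Finset.sum_le_sum_of_subset_of_nonneg (Finset.erase_subset _ _)
      fun i _ _ => mul_nonneg (hΔ0 i) (hq.1 i)
  have hA0 : 0 ≤ ∑ i ∈ Finset.univ.erase iStar, Δ i ^ (-(α / (1 - α))) :=
    Finset.sum_nonneg fun i _ => Real.rpow_nonneg (hΔ0 i) _
  have hB0 : 0 ≤ ∑ i ∈ Finset.univ.erase iStar, Δ i ^ (-((1 - α) / α)) :=
    Finset.sum_nonneg fun i _ => Real.rpow_nonneg (hΔ0 i) _
  set S := ∑ i ∈ Finset.univ.erase iStar, Δ i * q i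
  set A := ∑ i ∈ Finset.univ.erase iStar, Δ i ^ (-(α / (1 - α)))
  set B := ∑ i ∈ Finset.univ.erase iStar, Δ i ^ (-((1 - α) / α))
  have hom : 0 ≤ omega α Δ iStar := by
    unfold omega
    exact mul_nonneg (mul_nonneg (by positivity) (Real.rpow_nonneg hA0 _)) (Real.rpow_nonneg hB0 _)
  refine le_trans ?_ (mul_le_mul_of_nonneg_left hSle hom)
  have hSS : S ^ (1 - α) * S ^ α = S := by
    rw [← Real.rpow_add' hS0 (by simp)]; simp
  calc stability α q * penalty α q
      ≤ (2 / (1 - α) * (S ^ (1 - α) * B ^ α)) * (1 / α * (S ^ α * A ^ (1 - α))) := by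
        refine mul_le_mul (hz.trans ?_) (hh.trans ?_) (penalty_nonneg h0 h1 hq) (by positivity)
        · exact mul_le_mul_of_nonneg_left hp' (by positivity)
        · exact mul_le_mul_of_nonneg_left hp (by positivity)
    _ = 2 / (α * (1 - α)) * A ^ (1 - α) * B ^ α * (S ^ (1 - α) * S ^ α) := by
        field_simp
    _ = omega α Δ iStar * S := by rw [hSS]; rfl

lemma omega_pos (hK : 2 ≤ K) (h0 : 0 < α) (h1 : α < 1) {iStar : Fin K}
    (hΔ : ∀ i, i ≠ iStar → 0 < Δ i) : 0 < omega α Δ iStar := by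
  have h1' : 0 < 1 - α := by linarith
  have : Nontrivial (Fin K) := Fin.nontrivial_iff_two_le.2 hK
  obtain ⟨k, hk⟩ := exists_ne iStar
  have hne : (Finset.univ.erase iStar).Nonempty := ⟨k, Finset.mem_erase.2 ⟨hk, Finset.mem_univ k⟩⟩
  have hs : ∀ e : ℝ, 0 < ∑ i ∈ Finset.univ.erase iStar, Δ i ^ e := fun e =>
    Finset.sum_pos (fun i hi => Real.rpow_pos_of_pos (hΔ i (Finset.ne_of_mem_erase hi)) _) hne
  unfold omega
  have := hs (-(α / (1 - α)))
  have := hs (-((1 - α) / α))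
  positivity

lemma omega_le (hK : 2 ≤ K) (h0 : 0 < α) (h1 : α < 1) {iStar : Fin K}
    (hΔ : ∀ i, i ≠ iStar → 0 < Δ i) :
    omega α Δ iStar ≤ 2 * (K - 1) / (α * (1 - α) * gapMin Δ iStar) := by
  have h1' : 0 < 1 - α := by linarith
  have : Nontrivial (Fin K) := Fin.nontrivial_iff_two_le.2 hK
  obtain ⟨k, hk⟩ := exists_ne iStar
  have hne : Nonempty {i : Fin K // i ≠ iStar} := ⟨⟨k, hk⟩⟩
  obtain ⟨m, hm⟩ := exists_eq_ciInf_of_finite (f := fun i : {i : Fin K // i ≠ iStar} => Δ i)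
  have hg : 0 < gapMin Δ iStar := by unfold gapMin; rw [← hm]; exact hΔ m m.2
  have hle : ∀ i, i ≠ iStar → gapMin Δ iStar ≤ Δ i := fun i hi =>
    ciInf_le (Finite.bddBelow_range _) (⟨i, hi⟩ : {i : Fin K // i ≠ iStar})
  have hK1 : (0 : ℝ) < K - 1 := by
    have : (2 : ℝ) ≤ K := by exact_mod_cast hK
    linarith
  set g := gapMin Δ iStar
  have hs : ∀ e : ℝ, 0 ≤ e → ∑ i ∈ Finset.univ.erase iStar, Δ i ^ (-e) ≤ (K - 1) * g ^ (-e) := by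
    intro e he
    refine (Finset.sum_le_card_nsmul _ _ (g ^ (-e)) fun i hi => ?_).trans (le_of_eq ?_)
    · exact Real.rpow_le_rpow_of_nonpos hg (hle i (Finset.ne_of_mem_erase hi)) (by linarith)
    · rw [Finset.card_erase_of_mem (Finset.mem_univ _), Finset.card_univ, Fintype.card_fin,
        nsmul_eq_mul, Nat.cast_sub (by omega), Nat.cast_one]
  have hnn : ∀ e : ℝ, 0 ≤ ∑ i ∈ Finset.univ.erase iStar, Δ i ^ e := fun e =>
    Finset.sum_nonneg fun i hi =>
      Real.rpow_nonneg (hΔ i (Finset.ne_of_mem_erase hi)).le _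
  have e1 : (∑ i ∈ Finset.univ.erase iStar, Δ i ^ (-(α / (1 - α)))) ^ (1 - α) ≤
      (K - 1) ^ (1 - α) * g ^ (-α) := by
    refine (Real.rpow_le_rpow (hnn _) (hs _ (by positivity)) h1'.le).trans (le_of_eq ?_)
    rw [Real.mul_rpow hK1.le (by positivity), ← Real.rpow_mul hg.le]
    congr 2
    field_simp
  have e2 : (∑ i ∈ Finset.univ.erase iStar, Δ i ^ (-((1 - α) / α))) ^ α ≤
      (K - 1) ^ α * g ^ (-(1 - α)) := by
    refine (Real.rpow_le_rpow (hnn _) (hs _ (by positivity)) h0.le).trans (le_of_eq ?_)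
    rw [Real.mul_rpow hK1.le (by positivity), ← Real.rpow_mul hg.le]
    congr 2
    field_simp
  unfold omega
  rw [mul_assoc]
  calc _ ≤ 2 / (α * (1 - α)) * (((K - 1) ^ (1 - α) * g ^ (-α)) * ((K - 1) ^ α * g ^ (-(1 - α)))) :=
        mul_le_mul_of_nonneg_left (mul_le_mul e1 e2 (Real.rpow_nonneg (hnn _) _) (by positivity))
          (by positivity)
    _ = 2 / (α * (1 - α)) * (((K - 1) ^ (1 - α) * (K - 1) ^ α) * (g ^ (-α) * g ^ (-(1 - α)))) := by
        ring
    _ = 2 / (α * (1 - α)) * ((K - 1) * g⁻¹) := by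
        rw [← Real.rpow_add hK1, ← Real.rpow_add hg, sub_add_cancel, Real.rpow_one,
          show -α + -(1 - α) = -1 by ring, Real.rpow_neg_one]
    _ = _ := by field_simp

end

/-! ### Measurability of the algorithm -/

section

variable {K : ℕ} {α β₁ βb : ℝ} {Ω : Type*}

lemma continuous_tsallis {a : ℝ} (ha : 0 < a) : Continuous fun p : Fin K → ℝ => tsallis a p := by
  unfold tsallis
  refine continuous_const.mul (continuous_finsetSum _ fun i _ => ?_)
  exact ((continuous_apply i).rpow_const fun _ => Or.inr ha.le).sub (continuous_apply i)

/-- The FTRL distribution depends continuously on the cumulative loss and on `β`, by compactness of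
the simplex and uniqueness of the minimiser. The truncation of `β` at `β₁ > 0` is harmless, as the
algorithm never goes below `β₁`. -/
lemma ValidParams.continuous_ftrlDist (hv : ValidParams K α β₁ βb) :
    Continuous fun v : (Fin K → ℝ) × ℝ => ftrlDist α βb v.1 (max v.2 β₁) := by
  have hobj : Continuous fun w : ((Fin K → ℝ) × ℝ) × (Fin K → ℝ) =>
      objective α βb w.1.1 (max w.1.2 β₁) w.2 := by
    have h1 := (continuous_tsallis (K := K) hv.pos).comp
      (continuous_snd : Continuous fun w : ((Fin K → ℝ) × ℝ) × (Fin K → ℝ) => w.2)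
    have h2 := (continuous_tsallis (K := K) hv.one_sub_pos).comp
      (continuous_snd : Continuous fun w : ((Fin K → ℝ) × ℝ) × (Fin K → ℝ) => w.2)
    simp only [Function.comp_def] at h1 h2
    unfold objective
    fun_prop
  have hspec : ∀ v : (Fin K → ℝ) × ℝ, IsFTRLMin α βb v.1 (max v.2 β₁)
      (ftrlDist α βb v.1 (max v.2 β₁)) := fun v => ftrlDist_spec hv.card_pos hv.pos hv.lt_one _ _ _
  rw [continuous_iff_continuousAt]
  intro v
  refine (isCompact_stdSimplex ℝ (Fin K)).tendsto_nhds_of_unique_mapClusterPt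
    (Filter.Eventually.of_forall fun w => (hspec w).1) fun y hy hcl => ?_
  obtain ⟨U, hU, hUy⟩ := mapClusterPt_iff_ultrafilter.1 hcl
  have hmin : IsFTRLMin α βb v.1 (max v.2 β₁) y := by
    refine ⟨hy, fun p hp => ?_⟩
    have t1 := (hobj.tendsto (v, y)).comp ((Filter.tendsto_id'.2 hU).prodMk_nhds hUy)
    have t2 := (hobj.tendsto (v, p)).comp
      ((Filter.tendsto_id'.2 hU).prodMk_nhds (tendsto_const_nhds (x := p)))
    exact le_of_tendsto_of_tendsto' t1 t2 fun w => (hspec w).2 hp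
  exact hmin.eq hv.pos hv.lt_one (lt_max_of_lt_right hv.beta_pos) hv.betaBar_nonneg (hspec v)

/-- The state at the beginning of round `t` of the interaction with the environment. -/
noncomputable def runState (α β₁ βb : ℝ) (ℓ : ℕ → Ω → Fin K → ℝ) (I : ℕ → Ω → Fin K) (t : ℕ)
    (ω : Ω) : State K :=
  stateAt α β₁ βb (fun s => I s ω) (fun s => ℓ s ω (I s ω)) t

lemma ValidParams.le_beta_runState (hv : ValidParams K α β₁ βb) (ℓ : ℕ → Ω → Fin K → ℝ)
    (I : ℕ → Ω → Fin K) (t : ℕ) (ω : Ω) : β₁ ≤ (runState α β₁ βb ℓ I t ω).beta :=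
  hv.le_beta_stateAt _ _ _

lemma measurable_eval_fin [MeasurableSpace Ω] {f : Fin K → Ω → ℝ} {i : Ω → Fin K}
    (hf : ∀ j, Measurable (f j)) (hi : Measurable i) : Measurable fun ω => f (i ω) ω := by
  have e : (fun ω => f (i ω) ω) = fun ω => ∑ j, (i ⁻¹' {j}).indicator (f j) ω := by
    funext ω
    rw [Finset.sum_eq_single (i ω)]
    · simp
    · intro j _ hj; simp [hj.symm]
    · simp
  rw [e]
  exact Finset.measurable_fun_sum _ fun j _ =>
    (hf j).indicator (hi (MeasurableSet.singleton j))

lemma ValidParams.measurable_dist (hv : ValidParams K α β₁ βb) [MeasurableSpace Ω]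
    {s : Ω → State K} (h1 : Measurable fun ω => (s ω).cumLoss) (h2 : Measurable fun ω => (s ω).beta)
    (hβ : ∀ ω, β₁ ≤ (s ω).beta) : Measurable fun ω => (s ω).dist α βb := by
  have e : (fun ω => (s ω).dist α βb) =
      fun ω => ftrlDist α βb (s ω).cumLoss (max (s ω).beta β₁) := by
    funext ω
    rw [max_eq_left (hβ ω)]
    rfl
  rw [e]
  have h3 := hv.continuous_ftrlDist.measurable.comp (h1.prodMk h2)
  simpa only [Function.comp_def] using h3

lemma measurable_penalty (a : ℝ) : Measurable fun q : Fin K → ℝ => penalty a q := by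
  unfold penalty tsallis
  fun_prop

lemma measurable_qStar : Measurable fun q : Fin K → ℝ => qStar q := by
  unfold qStar
  fun_prop

lemma measurable_stability (a : ℝ) : Measurable fun q : Fin K → ℝ => stability a q := by
  have := measurable_qStar (K := K)
  unfold stability
  fun_prop

lemma ValidParams.measurable_runState (hv : ValidParams K α β₁ βb) [MeasurableSpace Ω]
    {ℓ : ℕ → Ω → Fin K → ℝ} {I : ℕ → Ω → Fin K} (t : ℕ)
    (hℓ : ∀ s < t, Measurable (ℓ s)) (hI : ∀ s < t, Measurable (I s)) :
    Measurable (fun ω => (runState α β₁ βb ℓ I t ω).cumLoss) ∧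
      Measurable (fun ω => (runState α β₁ βb ℓ I t ω).beta) := by
  induction t with
  | zero => exact ⟨measurable_const, measurable_const⟩
  | succ t ih =>
    obtain ⟨h1, h2⟩ := ih (fun s hs => hℓ s (hs.trans t.lt_succ_self))
      (fun s hs => hI s (hs.trans t.lt_succ_self))
    have hd := hv.measurable_dist h1 h2 (hv.le_beta_runState ℓ I t)
    have hIt := hI t t.lt_succ_self
    have hℓt := hℓ t t.lt_succ_self
    have hx : Measurable fun ω => ℓ t ω (I t ω) :=
      measurable_eval_fin (f := fun j ω => ℓ t ω j) (fun j => (measurable_pi_apply j).comp hℓt) hIt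
    constructor
    · refine measurable_pi_iff.2 fun j => ?_
      change Measurable fun ω => (runState α β₁ βb ℓ I t ω).cumLoss j
        + (if I t ω = j then ℓ t ω (I t ω) / (runState α β₁ βb ℓ I t ω).dist α βb j else 0)
      refine ((measurable_pi_apply j).comp h1).add (Measurable.ite ?_ ?_ measurable_const)
      · exact hIt (MeasurableSet.singleton j)
      · exact hx.div ((measurable_pi_apply j).comp hd)
    · have hz := (measurable_stability (K := K) α).comp hd
      have hh := (measurable_penalty (K := K) α).comp hd
      exact h2.add (hz.div (h2.mul hh))

variable {ℓ : ℕ → Ω → Fin K → ℝ} {I : ℕ → Ω → Fin K}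

lemma measurable_arm_pastInfo {s t : ℕ} (hst : s < t) : Measurable[pastInfo ℓ I t] (I s) :=
  (comap_measurable (I s)).mono
    ((le_iSup₂ (f := fun (s : ℕ) (_ : s < t) => MeasurableSpace.comap (I s) inferInstance)
      s hst).trans le_sup_left) le_rfl

lemma measurable_loss_pastInfo {s t : ℕ} (hst : s ≤ t) : Measurable[pastInfo ℓ I t] (ℓ s) :=
  (comap_measurable (ℓ s)).mono
    ((le_iSup₂ (f := fun (s : ℕ) (_ : s ≤ t) => MeasurableSpace.comap (ℓ s) inferInstance)
      s hst).trans le_sup_right) le_rfl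

lemma ValidParams.measurable_beta_pastInfo (hv : ValidParams K α β₁ βb) (t : ℕ) :
    Measurable[pastInfo ℓ I t] fun ω => (runState α β₁ βb ℓ I t ω).beta :=
  (@ValidParams.measurable_runState K α β₁ βb Ω hv (pastInfo ℓ I t) ℓ I t
    (fun _ hs => measurable_loss_pastInfo hs.le) (fun _ hs => measurable_arm_pastInfo hs)).2

lemma ValidParams.measurable_playDist_pastInfo (hv : ValidParams K α β₁ βb) (t : ℕ) :
    Measurable[pastInfo ℓ I t] (playDist α β₁ βb ℓ I t) := by
  obtain ⟨h1, h2⟩ := @ValidParams.measurable_runState K α β₁ βb Ω hv (pastInfo ℓ I t) ℓ I t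
    (fun _ hs => measurable_loss_pastInfo hs.le) (fun _ hs => measurable_arm_pastInfo hs)
  exact @ValidParams.measurable_dist K α β₁ βb Ω hv (pastInfo ℓ I t) _ h1 h2
    (hv.le_beta_runState ℓ I t)

lemma ValidParams.playDist_mem (hv : ValidParams K α β₁ βb) (t : ℕ) (ω : Ω) :
    playDist α β₁ βb ℓ I t ω ∈ stdSimplex ℝ (Fin K) :=
  (hv.isFTRLMin_dist (runState α β₁ βb ℓ I t ω)).1

lemma ValidParams.playDist_pos (hv : ValidParams K α β₁ βb) (t : ℕ) (ω : Ω) (i : Fin K) :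
    0 < playDist α β₁ βb ℓ I t ω i :=
  hv.dist_pos (hv.le_beta_runState ℓ I t ω) i

/-! ### Expectations over the played arm -/

variable [MeasurableSpace Ω] {μ : Measure Ω}

lemma IsBanditRun.pastInfo_le (hr : IsBanditRun μ α β₁ βb ℓ I) (t : ℕ) :
    pastInfo ℓ I t ≤ ‹MeasurableSpace Ω› :=
  sup_le (iSup₂_le fun s _ => (hr.measurable_arm s).comap_le)
    (iSup₂_le fun s _ => (hr.measurable_loss s).comap_le)

/-- The law of the played arm, in a form that allows unbounded integrands: on the σ-algebra of the
past, `μ` restricted to `{I t = i}` has density `q t i` with respect to `μ`. -/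
lemma IsBanditRun.lintegral_arm [IsProbabilityMeasure μ] (hr : IsBanditRun μ α β₁ βb ℓ I)
    (hv : ValidParams K α β₁ βb) (t : ℕ) (i : Fin K) {f : Ω → ENNReal}
    (hf : Measurable[pastInfo ℓ I t] f) :
    ∫⁻ ω in I t ⁻¹' {i}, f ω ∂μ =
      ∫⁻ ω, ENNReal.ofReal (playDist α β₁ βb ℓ I t ω i) * f ω ∂μ := by
  have hm := hr.pastInfo_le t
  have hA : MeasurableSet (I t ⁻¹' {i}) := hr.measurable_arm t (MeasurableSet.singleton i)
  have hqm : Measurable fun ω => playDist α β₁ βb ℓ I t ω i :=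
    (measurable_pi_apply i).comp ((hv.measurable_playDist_pastInfo t).mono hm le_rfl)
  have hqi : Integrable (fun ω => playDist α β₁ βb ℓ I t ω i) μ := by
    refine Integrable.of_bound hqm.aestronglyMeasurable 1 (Filter.Eventually.of_forall fun ω => ?_)
    rw [Real.norm_of_nonneg ((hv.playDist_mem t ω).1 i)]
    exact le_one_of_mem_stdSimplex (hv.playDist_mem t ω) i
  have hq0 : ∀ ω, 0 ≤ playDist α β₁ βb ℓ I t ω i := fun ω => (hv.playDist_mem t ω).1 i
  have hmeas : (μ.restrict (I t ⁻¹' {i})).trim hm =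
      (μ.withDensity fun ω => ENNReal.ofReal (playDist α β₁ βb ℓ I t ω i)).trim hm := by
    refine @Measure.ext _ (pastInfo ℓ I t) _ _ fun s hs => ?_
    rw [trim_measurableSet_eq hm hs, trim_measurableSet_eq hm hs, withDensity_apply _ (hm s hs),
      Measure.restrict_apply (hm s hs),
      ← ofReal_integral_eq_lintegral_ofReal hqi.restrict (Filter.Eventually.of_forall hq0),
      ← setIntegral_congr_ae (hm s hs) ((hr.arm_law t i).mono fun ω h _ => h),
      setIntegral_condExp hm ((integrable_const (1 : ℝ)).indicator hA) hs,
      setIntegral_indicator hA]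
    simp
  have h1 := lintegral_trim (μ := μ.restrict (I t ⁻¹' {i})) hm hf
  have h2 := lintegral_trim
    (μ := μ.withDensity fun ω => ENNReal.ofReal (playDist α β₁ βb ℓ I t ω i)) hm hf
  rw [← h1, hmeas, h2, lintegral_withDensity_eq_lintegral_mul _ hqm.ennreal_ofReal
    (hf.mono hm le_rfl)]
  rfl

/-- Averaging over the arm of round `t`: a nonnegative function of the arm and of the past, whose
conditional mean is bounded, is integrable, and its expectation is that of its conditional mean. -/
lemma IsBanditRun.integral_arm [IsProbabilityMeasure μ] (hr : IsBanditRun μ α β₁ βb ℓ I)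
    (hv : ValidParams K α β₁ βb) (t : ℕ) {F : Fin K → Ω → ℝ} {C : ℝ}
    (hF : ∀ j, Measurable[pastInfo ℓ I t] (F j)) (hF0 : ∀ j ω, 0 ≤ F j ω)
    (hC : ∀ ω, ∑ j, playDist α β₁ βb ℓ I t ω j * F j ω ≤ C) :
    Integrable (fun ω => F (I t ω) ω) μ ∧
      ∫ ω, F (I t ω) ω ∂μ = ∫ ω, ∑ j, playDist α β₁ βb ℓ I t ω j * F j ω ∂μ := by
  have hm := hr.pastInfo_le t
  have hFm : ∀ j, Measurable (F j) := fun j => (hF j).mono hm le_rfl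
  have hqm : ∀ j, Measurable fun ω => playDist α β₁ βb ℓ I t ω j := fun j =>
    (measurable_pi_apply j).comp ((hv.measurable_playDist_pastInfo t).mono hm le_rfl)
  have hq0 : ∀ ω j, 0 ≤ playDist α β₁ βb ℓ I t ω j := fun ω j => (hv.playDist_mem t ω).1 j
  have hsum0 : ∀ ω, 0 ≤ ∑ j, playDist α β₁ βb ℓ I t ω j * F j ω := fun ω =>
    Finset.sum_nonneg fun j _ => mul_nonneg (hq0 ω j) (hF0 j ω)
  have hsumm : Measurable fun ω => ∑ j, playDist α β₁ βb ℓ I t ω j * F j ω :=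
    Finset.measurable_fun_sum _ fun j _ => (hqm j).mul (hFm j)
  have hFI : Measurable fun ω => F (I t ω) ω := measurable_eval_fin hFm (hr.measurable_arm t)
  have hL : ∫⁻ ω, ENNReal.ofReal (F (I t ω) ω) ∂μ =
      ∫⁻ ω, ENNReal.ofReal (∑ j, playDist α β₁ βb ℓ I t ω j * F j ω) ∂μ := by
    have e1 : ∀ ω, ENNReal.ofReal (F (I t ω) ω) =
        ∑ j, (I t ⁻¹' {j}).indicator (fun ω => ENNReal.ofReal (F j ω)) ω := by
      intro ω
      rw [Finset.sum_eq_single (I t ω)]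
      · simp
      · intro j _ hj; simp [hj.symm]
      · simp
    have e2 : ∀ ω, ENNReal.ofReal (∑ j, playDist α β₁ βb ℓ I t ω j * F j ω) =
        ∑ j, ENNReal.ofReal (playDist α β₁ βb ℓ I t ω j) * ENNReal.ofReal (F j ω) := by
      intro ω
      rw [ENNReal.ofReal_sum_of_nonneg fun j _ => mul_nonneg (hq0 ω j) (hF0 j ω)]
      exact Finset.sum_congr rfl fun j _ => ENNReal.ofReal_mul (hq0 ω j)
    simp_rw [e1, e2]
    rw [lintegral_finsetSum _ fun j _ => (hFm j).ennreal_ofReal.indicator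
        (hr.measurable_arm t (MeasurableSet.singleton j)),
      lintegral_finsetSum (f := fun j ω => ENNReal.ofReal (playDist α β₁ βb ℓ I t ω j) *
        ENNReal.ofReal (F j ω)) _ fun j _ => (hqm j).ennreal_ofReal.mul (hFm j).ennreal_ofReal]
    refine Finset.sum_congr rfl fun j _ => ?_
    rw [lintegral_indicator (hr.measurable_arm t (MeasurableSet.singleton j))]
    exact hr.lintegral_arm hv t j (@Measurable.ennreal_ofReal _ (pastInfo ℓ I t) _ (hF j))
  have hint : Integrable (fun ω => ∑ j, playDist α β₁ βb ℓ I t ω j * F j ω) μ := by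
    refine Integrable.of_bound hsumm.aestronglyMeasurable C
      (Filter.Eventually.of_forall fun ω => ?_)
    rw [Real.norm_of_nonneg (hsum0 ω)]
    exact hC ω
  constructor
  · refine ⟨hFI.aestronglyMeasurable, ?_⟩
    rw [hasFiniteIntegral_iff_ofReal (Filter.Eventually.of_forall fun ω => hF0 _ ω), hL]
    exact (hasFiniteIntegral_iff_ofReal (Filter.Eventually.of_forall hsum0)).1 hint.2
  · rw [integral_eq_lintegral_of_nonneg_ae (Filter.Eventually.of_forall fun ω => hF0 _ ω)
        hFI.aestronglyMeasurable,
      integral_eq_lintegral_of_nonneg_ae (Filter.Eventually.of_forall hsum0)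
        hsumm.aestronglyMeasurable, hL]

end

/-! ### Regret bounds -/

lemma integral_sqrt_le_sqrt_integral {Ω : Type*} [MeasurableSpace Ω] {μ : Measure Ω}
    [IsProbabilityMeasure μ] {f : Ω → ℝ} (hf0 : ∀ ω, 0 ≤ f ω) (hf : Integrable f μ)
    (hs : Integrable (fun ω => √(f ω)) μ) : ∫ ω, √(f ω) ∂μ ≤ √(∫ ω, f ω ∂μ) :=
  Real.strictConcaveOn_sqrt.concaveOn.le_map_integral Real.continuous_sqrt.continuousOn
    isClosed_Ici (Filter.Eventually.of_forall hf0) hf hs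

lemma integrable_of_mem_Icc {Ω : Type*} [MeasurableSpace Ω] {μ : Measure Ω}
    [IsFiniteMeasure μ] {f : Ω → ℝ} (hf : Measurable f) {C : ℝ} (hf0 : ∀ ω, 0 ≤ f ω)
    (hC : ∀ ω, f ω ≤ C) : Integrable f μ :=
  Integrable.of_bound hf.aestronglyMeasurable C (Filter.Eventually.of_forall fun ω => by
    rw [Real.norm_of_nonneg (hf0 ω)]; exact hC ω)

section

variable {K : ℕ} {α β₁ βb : ℝ} {Ω : Type*} {ℓ : ℕ → Ω → Fin K → ℝ} {I : ℕ → Ω → Fin K}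

lemma ValidParams.stability_playDist_nonneg (hv : ValidParams K α β₁ βb) (t : ℕ) (ω : Ω) :
    0 ≤ stability α (playDist α β₁ βb ℓ I t ω) :=
  hv.stability_nonneg _

lemma ValidParams.stability_playDist_le (hv : ValidParams K α β₁ βb) (t : ℕ) (ω : Ω) :
    stability α (playDist α β₁ βb ℓ I t ω) ≤ (K : ℝ) ^ α / (1 - α) :=
  stability_le_card_rpow hv.card_pos hv.pos hv.lt_one (hv.playDist_mem t ω)

lemma ValidParams.penalty_playDist_pos (hv : ValidParams K α β₁ βb) (t : ℕ) (ω : Ω) :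
    0 < penalty α (playDist α β₁ βb ℓ I t ω) :=
  hv.penalty_pos (hv.le_beta_runState ℓ I t ω)

lemma ValidParams.stability_playDist_pos (hv : ValidParams K α β₁ βb) (t : ℕ) (ω : Ω) :
    0 < stability α (playDist α β₁ βb ℓ I t ω) := by
  have hq := hv.playDist_mem (ℓ := ℓ) (I := I) t ω
  have hpos := hv.playDist_pos (ℓ := ℓ) (I := I) t ω
  have : Nontrivial (Fin K) := Fin.nontrivial_iff_two_le.2 hv.two_le
  have hne : Nonempty (Fin K) := inferInstance
  have h1' := hv.one_sub_pos
  unfold stability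
  refine mul_pos (by positivity) (Finset.sum_pos (fun i _ => Real.rpow_pos_of_pos ?_ _)
    Finset.univ_nonempty)
  refine lt_of_lt_of_le ?_ (min_one_sub_le_min_qStar hv.card_pos hq i)
  obtain ⟨j, hj⟩ := exists_ne i
  have := add_le_one_of_mem_stdSimplex hq hj
  exact lt_min (hpos i) (by linarith [hpos j])

lemma ValidParams.stability_div_beta_le (hv : ValidParams K α β₁ βb) (t : ℕ) (ω : Ω) :
    stability α (playDist α β₁ βb ℓ I t ω) / (runState α β₁ βb ℓ I t ω).beta ≤
      (K : ℝ) ^ α / (1 - α) / β₁ := by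
  have h1 := hv.stability_playDist_le (ℓ := ℓ) (I := I) t ω
  have h2 := hv.le_beta_runState ℓ I t ω
  have h3 := hv.beta_pos
  have h4 := hv.one_sub_pos
  gcongr

variable [MeasurableSpace Ω] {μ : Measure Ω}

lemma IsBanditRun.measurable_playDist (hr : IsBanditRun μ α β₁ βb ℓ I)
    (hv : ValidParams K α β₁ βb) (t : ℕ) : Measurable (playDist α β₁ βb ℓ I t) :=
  (hv.measurable_playDist_pastInfo t).mono (hr.pastInfo_le t) le_rfl

lemma IsBanditRun.measurable_stability (hr : IsBanditRun μ α β₁ βb ℓ I)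
    (hv : ValidParams K α β₁ βb) (t : ℕ) :
    Measurable fun ω => stability α (playDist α β₁ βb ℓ I t ω) :=
  (TsallisBandit.measurable_stability α).comp (hr.measurable_playDist hv t)

variable [IsProbabilityMeasure μ]

lemma IsBanditRun.integrable_stability_div_beta (hr : IsBanditRun μ α β₁ βb ℓ I)
    (hv : ValidParams K α β₁ βb) (t : ℕ) :
    Integrable (fun ω => stability α (playDist α β₁ βb ℓ I t ω) /
      (runState α β₁ βb ℓ I t ω).beta) μ :=
  integrable_of_mem_Icc ((hr.measurable_stability hv t).div
      ((hv.measurable_beta_pastInfo t).mono (hr.pastInfo_le t) le_rfl))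
    (fun ω => div_nonneg (hv.stability_playDist_nonneg t ω)
      (hv.beta_pos.le.trans (hv.le_beta_runState ℓ I t ω)))
    (hv.stability_div_beta_le t)

/-- The importance-weighted estimates are unbiased. -/
lemma IsBanditRun.integral_lossEstimate (hr : IsBanditRun μ α β₁ βb ℓ I)
    (hv : ValidParams K α β₁ βb) (t : ℕ) (i : Fin K) :
    Integrable (fun ω => lossEstimate (playDist α β₁ βb ℓ I t ω) (I t ω) (ℓ t ω (I t ω)) i) μ ∧
      ∫ ω, lossEstimate (playDist α β₁ βb ℓ I t ω) (I t ω) (ℓ t ω (I t ω)) i ∂μ =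
        ∫ ω, ℓ t ω i ∂μ := by
  have hsum : ∀ ω, ∑ j, playDist α β₁ βb ℓ I t ω j *
      (if j = i then ℓ t ω i / playDist α β₁ βb ℓ I t ω i else 0) = ℓ t ω i := by
    intro ω
    have := (hv.playDist_pos (ℓ := ℓ) (I := I) t ω i).ne'
    rw [Finset.sum_eq_single i]
    · rw [if_pos rfl]; field_simp
    · intro j _ hj; rw [if_neg hj, mul_zero]
    · simp
  have h := hr.integral_arm hv t (C := 1)
    (F := fun j ω => if j = i then ℓ t ω i / playDist α β₁ βb ℓ I t ω i else 0) ?_ ?_ ?_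
  · simp_rw [hsum] at h
    have e : (fun ω => lossEstimate (playDist α β₁ βb ℓ I t ω) (I t ω) (ℓ t ω (I t ω)) i) =
        fun ω => if I t ω = i then ℓ t ω i / playDist α β₁ βb ℓ I t ω i else 0 := by
      funext ω
      unfold lossEstimate
      split_ifs with hi
      · rw [hi]
      · rfl
    rw [e]
    exact h
  · intro j
    by_cases hj : j = i
    · simp only [if_pos hj]
      exact Measurable.div
        ((measurable_pi_apply i).comp (measurable_loss_pastInfo (ℓ := ℓ) (I := I) (le_refl t)))
        ((measurable_pi_apply i).comp (hv.measurable_playDist_pastInfo t))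
    · simp only [if_neg hj]
      exact measurable_const
  · intro j ω
    show 0 ≤ (if j = i then ℓ t ω i / playDist α β₁ βb ℓ I t ω i else 0)
    split_ifs
    · exact div_nonneg (hr.loss_mem t ω i).1 (hv.playDist_pos t ω i).le
    · exact le_rfl
  · intro ω
    rw [hsum]
    exact (hr.loss_mem t ω i).2

/-- The expected stability term of a round is of order `z / β`. -/
lemma IsBanditRun.integral_stabilityTerm (hr : IsBanditRun μ α β₁ βb ℓ I)
    (hv : ValidParams K α β₁ βb) (t : ℕ) :
    Integrable (fun ω => 6 * min (playDist α β₁ βb ℓ I t ω (I t ω))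
        (qStar (playDist α β₁ βb ℓ I t ω)) ^ (1 - α) /
      (playDist α β₁ βb ℓ I t ω (I t ω) * ((runState α β₁ βb ℓ I t ω).beta * (1 - α)))) μ ∧
    ∫ ω, 6 * min (playDist α β₁ βb ℓ I t ω (I t ω))
        (qStar (playDist α β₁ βb ℓ I t ω)) ^ (1 - α) /
      (playDist α β₁ βb ℓ I t ω (I t ω) * ((runState α β₁ βb ℓ I t ω).beta * (1 - α))) ∂μ =
    6 * ∫ ω, stability α (playDist α β₁ βb ℓ I t ω) / (runState α β₁ βb ℓ I t ω).beta ∂μ := by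
  have h1' := hv.one_sub_pos
  have hβ : ∀ ω, 0 < (runState α β₁ βb ℓ I t ω).beta := fun ω =>
    hv.beta_pos.trans_le (hv.le_beta_runState ℓ I t ω)
  have hsum : ∀ ω, ∑ j, playDist α β₁ βb ℓ I t ω j *
      (6 * min (playDist α β₁ βb ℓ I t ω j) (qStar (playDist α β₁ βb ℓ I t ω)) ^ (1 - α) /
        (playDist α β₁ βb ℓ I t ω j * ((runState α β₁ βb ℓ I t ω).beta * (1 - α)))) =
      6 * (stability α (playDist α β₁ βb ℓ I t ω) / (runState α β₁ βb ℓ I t ω).beta) := by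
    intro ω
    unfold stability
    rw [Finset.mul_sum, Finset.sum_div, Finset.mul_sum]
    refine Finset.sum_congr rfl fun j _ => ?_
    have := (hv.playDist_pos (ℓ := ℓ) (I := I) t ω j).ne'
    have := (hβ ω).ne'
    field_simp
  have h := hr.integral_arm hv t (C := 6 * ((K : ℝ) ^ α / (1 - α) / β₁))
    (F := fun j ω =>
      6 * min (playDist α β₁ βb ℓ I t ω j) (qStar (playDist α β₁ βb ℓ I t ω)) ^ (1 - α) /
        (playDist α β₁ βb ℓ I t ω j * ((runState α β₁ βb ℓ I t ω).beta * (1 - α)))) ?_ ?_ ?_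
  · simp_rw [hsum] at h
    rw [integral_const_mul] at h
    exact h
  · intro j
    have hφ : Measurable fun v : (Fin K → ℝ) × ℝ =>
        6 * min (v.1 j) (qStar v.1) ^ (1 - α) / (v.1 j * (v.2 * (1 - α))) := by
      have := (measurable_qStar (K := K)).comp
        (measurable_fst : Measurable (Prod.fst : (Fin K → ℝ) × ℝ → Fin K → ℝ))
      simp only [Function.comp_def] at this
      fun_prop
    exact hφ.comp ((hv.measurable_playDist_pastInfo t).prodMk (hv.measurable_beta_pastInfo t))
  · intro j ω
    have hq := hv.playDist_mem (ℓ := ℓ) (I := I) t ω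
    have h2 := hq.1 j
    have h3 : 0 ≤ min (playDist α β₁ βb ℓ I t ω j) (qStar (playDist α β₁ βb ℓ I t ω)) :=
      le_min h2 (qStar_nonneg hv.card_pos hq)
    have h4 := hβ ω
    show 0 ≤ _ / _
    positivity
  · intro ω
    rw [hsum]
    exact mul_le_mul_of_nonneg_left (hv.stability_div_beta_le t ω) (by norm_num)

lemma IsBanditRun.integrable_loss (hr : IsBanditRun μ α β₁ βb ℓ I) (t : ℕ) (i : Fin K) :
    Integrable (fun ω => ℓ t ω i) μ :=
  integrable_of_mem_Icc ((measurable_pi_apply i).comp (hr.measurable_loss t))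
    (fun ω => (hr.loss_mem t ω i).1) (fun ω => (hr.loss_mem t ω i).2)

lemma IsBanditRun.integrable_loss_arm (hr : IsBanditRun μ α β₁ βb ℓ I) (t : ℕ) :
    Integrable (fun ω => ℓ t ω (I t ω)) μ :=
  integrable_of_mem_Icc (measurable_eval_fin (f := fun j ω => ℓ t ω j)
      (fun j => (measurable_pi_apply j).comp (hr.measurable_loss t)) (hr.measurable_arm t))
    (fun ω => (hr.loss_mem t ω _).1) (fun ω => (hr.loss_mem t ω _).2)

/-- The regret is bounded by the sum of the stability terms; the penalty terms have been matched
to them by the choice of `β`. -/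
lemma IsBanditRun.regret_le (hr : IsBanditRun μ α β₁ βb ℓ I)
    (hv : ValidParams K α β₁ βb) (T : ℕ) :
    regret μ ℓ I T ≤ 10 * ∫ ω, ∑ t ∈ Finset.range T,
        stability α (playDist α β₁ βb ℓ I t ω) / (runState α β₁ βb ℓ I t ω).beta ∂μ
      + (β₁ * penalty α (firstDist K α β₁ βb) + βb * penalty (1 - α) (firstDist K α β₁ βb)) := by
  have hne : Nonempty (Fin K) := ⟨⟨0, hv.card_pos⟩⟩
  refine ciSup_le fun i => ?_
  unfold regretAgainst
  set κ := β₁ * penalty α (firstDist K α β₁ βb) + βb * penalty (1 - α) (firstDist K α β₁ βb)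
  have hx := fun t => hr.integrable_loss_arm t
  have hℓ := fun t => hr.integrable_loss t i
  have hE := fun t => hr.integral_lossEstimate hv t i
  have hG := fun t => hr.integral_stabilityTerm hv t
  have hZ := fun t => hr.integrable_stability_div_beta hv t
  have hZ4 := fun t => (hZ t).const_mul 4
  have hpath : ∀ ω, ∑ t ∈ Finset.range T, ℓ t ω (I t ω) ≤
      ∑ t ∈ Finset.range T, lossEstimate (playDist α β₁ βb ℓ I t ω) (I t ω) (ℓ t ω (I t ω)) i
      + ∑ t ∈ Finset.range T, (6 * min (playDist α β₁ βb ℓ I t ω (I t ω))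
        (qStar (playDist α β₁ βb ℓ I t ω)) ^ (1 - α) /
      (playDist α β₁ βb ℓ I t ω (I t ω) * ((runState α β₁ βb ℓ I t ω).beta * (1 - α)))
      + 4 * (stability α (playDist α β₁ βb ℓ I t ω) / (runState α β₁ βb ℓ I t ω).beta)) + κ :=
    fun ω => hv.sum_loss_le (fun s => I s ω) (x := fun s => ℓ s ω (I s ω))
      (fun t => hr.loss_mem t ω _) T i
  have hI1 := integrable_finsetSum (Finset.range T) fun t _ => (hE t).1
  have hI2 := integrable_finsetSum (Finset.range T) fun t _ => (hG t).1.add (hZ4 t)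
  have hmono := integral_mono (integrable_finsetSum (Finset.range T) fun t _ => hx t)
    ((hI1.add hI2).add (integrable_const κ)) hpath
  rw [integral_add' (hI1.add hI2) (integrable_const κ), integral_add' hI1 hI2,
    integral_finsetSum _ fun t _ => (hE t).1, integral_finsetSum _ fun t _ => (hG t).1.add (hZ4 t),
    Finset.sum_congr rfl fun t _ => (hE t).2,
    Finset.sum_congr rfl fun t _ => integral_add' (hG t).1 (hZ4 t)] at hmono
  simp only [(hG _).2, integral_const_mul, integral_const, probReal_univ, one_smul,
    Finset.sum_add_distrib, ← Finset.mul_sum] at hmono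
  rw [integral_sub (integrable_finsetSum _ fun t _ => hx t)
      (integrable_finsetSum _ fun t _ => hℓ t),
    integral_finsetSum _ fun t _ => hℓ t, integral_finsetSum _ fun t _ => hZ t]
  linarith

end

section

variable {K : ℕ} {α β₁ βb : ℝ} {Ω : Type*} {ℓ : ℕ → Ω → Fin K → ℝ} {I : ℕ → Ω → Fin K}

lemma ValidParams.penalty_firstDist_pos (hv : ValidParams K α β₁ βb) :
    0 < penalty α (firstDist K α β₁ βb) :=
  hv.penalty_pos (s := initState K β₁) le_rfl

/-- The part of `κ` that does not depend on `z_max` is nonnegative. -/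
lemma ValidParams.initial_penalty_nonneg (hv : ValidParams K α β₁ βb) :
    0 ≤ β₁ * penalty α (firstDist K α β₁ βb) + βb * penalty (1 - α) (firstDist K α β₁ βb) :=
  add_nonneg (mul_nonneg hv.beta_pos.le hv.penalty_firstDist_pos.le)
    (mul_nonneg hv.betaBar_nonneg
      (penalty_nonneg hv.one_sub_pos (by linarith [hv.pos]) hv.firstDist_mem))

lemma ValidParams.sum_stability_div_beta_le (hv : ValidParams K α β₁ βb) {Z : ℝ} (hZ : 0 ≤ Z)
    {ω : Ω} (hz : ∀ t, stability α (playDist α β₁ βb ℓ I t ω) ≤ Z) (T : ℕ) :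
    ∑ t ∈ Finset.range T, stability α (playDist α β₁ βb ℓ I t ω) /
        (runState α β₁ βb ℓ I t ω).beta ≤
      Z / β₁ + ∑ t ∈ Finset.range T, stability α (playDist α β₁ βb ℓ I t ω) /
        (runState α β₁ βb ℓ I (t + 1) ω).beta :=
  sum_div_le_add_sum_div_succ hZ hz
    (fun t => hv.beta_pos.trans_le (hv.le_beta_runState ℓ I t ω))
    (fun t => hv.beta_le_next (hv.le_beta_runState ℓ I t ω) _ _) T

lemma ValidParams.sum_stability_div_beta_le_sqrt (hv : ValidParams K α β₁ βb) {Z : ℝ} (hZ : 0 ≤ Z)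
    {ω : Ω} (hz : ∀ t, stability α (playDist α β₁ βb ℓ I t ω) ≤ Z) (T : ℕ) :
    ∑ t ∈ Finset.range T, stability α (playDist α β₁ βb ℓ I t ω) /
        (runState α β₁ βb ℓ I t ω).beta ≤
      Z / β₁ + 2 * √(penalty α (firstDist K α β₁ βb) *
        ∑ t ∈ Finset.range T, stability α (playDist α β₁ βb ℓ I t ω)) := by
  refine (hv.sum_stability_div_beta_le hZ hz T).trans (add_le_add le_rfl ?_)
  refine sum_div_le_two_mul_sqrt (z := fun t => stability α (playDist α β₁ βb ℓ I t ω))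
    hv.penalty_firstDist_pos (fun t => hv.stability_playDist_nonneg t ω)
    (fun t => hv.beta_pos.trans_le (hv.le_beta_runState ℓ I (t + 1) ω)) (fun t => ?_) T
  refine (Finset.sum_le_sum fun s _ => ?_).trans (hv.sum_le_beta_sq _ _ (t + 1))
  exact div_le_div_of_nonneg_left (hv.stability_playDist_nonneg s ω)
    (hv.penalty_playDist_pos s ω) (hv.penalty_le (hv.playDist_mem s ω))

lemma ValidParams.sum_stability_div_beta_le_logPlus (hv : ValidParams K α β₁ βb) {Z W : ℝ}
    (hZ : 0 < Z) (hW : 0 < W) {ω : Ω}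
    (hz : ∀ t, stability α (playDist α β₁ βb ℓ I t ω) ≤ Z) (T : ℕ) :
    ∑ t ∈ Finset.range T, stability α (playDist α β₁ βb ℓ I t ω) /
        (runState α β₁ βb ℓ I t ω).beta ≤
      Z / β₁ + (4 * √W + 3 * √(logPlus (penalty α (firstDist K α β₁ βb) * Z * T / W) *
        ∑ t ∈ Finset.range T, stability α (playDist α β₁ βb ℓ I t ω) *
          penalty α (playDist α β₁ βb ℓ I t ω))) := by
  refine (hv.sum_stability_div_beta_le hZ.le hz T).trans (add_le_add le_rfl ?_)
  exact sum_div_le_sqrt_add_logPlus (z := fun t => stability α (playDist α β₁ βb ℓ I t ω))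
    (h := fun t => penalty α (playDist α β₁ βb ℓ I t ω)) hW hZ
    (fun t => hv.stability_playDist_nonneg t ω) hz (fun t => hv.penalty_playDist_pos t ω)
    (fun t => hv.penalty_le (hv.playDist_mem t ω))
    (fun t => hv.beta_pos.trans_le (hv.le_beta_runState ℓ I (t + 1) ω))
    (fun t => hv.sum_le_beta_sq _ _ (t + 1)) T

variable [MeasurableSpace Ω] {μ : Measure Ω} [IsProbabilityMeasure μ]

lemma ValidParams.pos_of_ae_stability_le (hv : ValidParams K α β₁ βb) {Z : ℝ}
    (hz : ∀ᵐ ω ∂μ, ∀ t, stability α (playDist α β₁ βb ℓ I t ω) ≤ Z) : 0 < Z := by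
  obtain ⟨ω, hω⟩ := hz.exists
  exact (hv.stability_playDist_pos 0 ω).trans_le (hω 0)

lemma IsBanditRun.integrable_sqrt_sum_stability (hr : IsBanditRun μ α β₁ βb ℓ I)
    (hv : ValidParams K α β₁ βb) (T : ℕ) :
    Integrable (fun ω => √(penalty α (firstDist K α β₁ βb) *
      ∑ t ∈ Finset.range T, stability α (playDist α β₁ βb ℓ I t ω))) μ := by
  refine integrable_of_mem_Icc (C := √(penalty α (firstDist K α β₁ βb) *
    ∑ t ∈ Finset.range T, (K : ℝ) ^ α / (1 - α))) ?_ (fun ω => Real.sqrt_nonneg _) (fun ω => ?_)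
  · exact (measurable_const.mul
      (Finset.measurable_fun_sum _ fun t _ => hr.measurable_stability hv t)).sqrt
  · exact Real.sqrt_le_sqrt (mul_le_mul_of_nonneg_left
      (Finset.sum_le_sum fun t _ => hv.stability_playDist_le t ω) hv.penalty_firstDist_pos.le)

/-- The adversarial regret bound with the realised stability terms. -/
lemma IsBanditRun.regret_le_integral_sqrt (hr : IsBanditRun μ α β₁ βb ℓ I)
    (hv : ValidParams K α β₁ βb) {Z : ℝ}
    (hz : ∀ᵐ ω ∂μ, ∀ t, stability α (playDist α β₁ βb ℓ I t ω) ≤ Z) (T : ℕ) :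
    regret μ ℓ I T ≤ 20 * ∫ ω, √(penalty α (firstDist K α β₁ βb) *
        ∑ t ∈ Finset.range T, stability α (playDist α β₁ βb ℓ I t ω)) ∂μ
      + 10 * kappa K α β₁ βb Z := by
  have hZ := hv.pos_of_ae_stability_le hz
  have hS := hr.integrable_sqrt_sum_stability hv T
  have h1 : ∫ ω, ∑ t ∈ Finset.range T, stability α (playDist α β₁ βb ℓ I t ω) /
      (runState α β₁ βb ℓ I t ω).beta ∂μ ≤
      ∫ ω, (Z / β₁ + 2 * √(penalty α (firstDist K α β₁ βb) *
        ∑ t ∈ Finset.range T, stability α (playDist α β₁ βb ℓ I t ω))) ∂μ :=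
    integral_mono_ae (integrable_finsetSum _ fun t _ => hr.integrable_stability_div_beta hv t)
      ((integrable_const _).add (hS.const_mul 2))
      (hz.mono fun ω hω => hv.sum_stability_div_beta_le_sqrt hZ.le hω T)
  rw [integral_add (integrable_const _) (hS.const_mul 2), integral_const, probReal_univ, one_smul,
    integral_const_mul] at h1
  have h2 := hr.regret_le hv T
  have h3 := hv.initial_penalty_nonneg
  unfold kappa
  linarith

lemma IsBanditRun.integral_sqrt_sum_stability_le (hr : IsBanditRun μ α β₁ βb ℓ I)
    (hv : ValidParams K α β₁ βb) {Z : ℝ}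
    (hz : ∀ᵐ ω ∂μ, ∀ t, stability α (playDist α β₁ βb ℓ I t ω) ≤ Z) (T : ℕ) :
    ∫ ω, √(penalty α (firstDist K α β₁ βb) *
        ∑ t ∈ Finset.range T, stability α (playDist α β₁ βb ℓ I t ω)) ∂μ ≤
      √(penalty α (firstDist K α β₁ βb) * Z * T) := by
  have h := integral_mono_ae (hr.integrable_sqrt_sum_stability hv T)
    (integrable_const (√(penalty α (firstDist K α β₁ βb) * Z * T)))
    (hz.mono fun ω hω => ?_)
  · rwa [integral_const, probReal_univ, one_smul] at h
  · refine Real.sqrt_le_sqrt ?_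
    rw [mul_assoc]
    refine mul_le_mul_of_nonneg_left ?_ hv.penalty_firstDist_pos.le
    refine (Finset.sum_le_card_nsmul _ _ Z fun t _ => hω t).trans (le_of_eq ?_)
    rw [Finset.card_range, nsmul_eq_mul, mul_comm]

/-- The expected sum of the products of stability and penalty is at most `ω(Δ)` times the expected
sum of the gaps of the played arms. -/
lemma IsBanditRun.integral_sum_stability_mul_penalty_le (hr : IsBanditRun μ α β₁ βb ℓ I)
    (hv : ValidParams K α β₁ βb) {Δ : Fin K → ℝ} {iStar : Fin K} (hΔ0 : ∀ i, 0 ≤ Δ i)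
    (hΔ : ∀ i, i ≠ iStar → 0 < Δ i) (T : ℕ) :
    Integrable (fun ω => ∑ t ∈ Finset.range T, stability α (playDist α β₁ βb ℓ I t ω) *
        penalty α (playDist α β₁ βb ℓ I t ω)) μ ∧
    ∫ ω, ∑ t ∈ Finset.range T, stability α (playDist α β₁ βb ℓ I t ω) *
        penalty α (playDist α β₁ βb ℓ I t ω) ∂μ ≤
      omega α Δ iStar * ∫ ω, ∑ t ∈ Finset.range T, Δ (I t ω) ∂μ := by
  have hprod : ∀ t, Integrable (fun ω => stability α (playDist α β₁ βb ℓ I t ω) *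
        penalty α (playDist α β₁ βb ℓ I t ω)) μ := fun t =>
    integrable_of_mem_Icc ((hr.measurable_stability hv t).mul
        ((measurable_penalty α).comp (hr.measurable_playDist hv t)))
      (fun ω => mul_nonneg (hv.stability_playDist_nonneg t ω) (hv.penalty_playDist_pos t ω).le)
      (fun ω => mul_le_mul (hv.stability_playDist_le t ω) (hv.penalty_le (hv.playDist_mem t ω))
        (hv.penalty_playDist_pos t ω).le
        (div_nonneg (Real.rpow_nonneg (Nat.cast_nonneg K) _) hv.one_sub_pos.le))
  have hqm : ∀ t, Measurable fun ω => ∑ i, Δ i * playDist α β₁ βb ℓ I t ω i := fun t =>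
    Finset.measurable_fun_sum _ fun i _ =>
      ((measurable_pi_apply i).comp (hr.measurable_playDist hv t)).const_mul (Δ i)
  have hq1 : ∀ t ω, ∑ i, Δ i * playDist α β₁ βb ℓ I t ω i ≤ ∑ i, Δ i := fun t ω =>
    Finset.sum_le_sum fun i _ => mul_le_of_le_one_right (hΔ0 i)
      (le_one_of_mem_stdSimplex (hv.playDist_mem t ω) i)
  have hqI : ∀ t, Integrable (fun ω => ∑ i, Δ i * playDist α β₁ βb ℓ I t ω i) μ := fun t =>
    integrable_of_mem_Icc (hqm t)
      (fun ω => Finset.sum_nonneg fun i _ => mul_nonneg (hΔ0 i) ((hv.playDist_mem t ω).1 i))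
      (hq1 t)
  have harm : ∀ t, Integrable (fun ω => Δ (I t ω)) μ ∧
      ∫ ω, Δ (I t ω) ∂μ = ∫ ω, ∑ i, Δ i * playDist α β₁ βb ℓ I t ω i ∂μ := by
    intro t
    have h := hr.integral_arm hv t (F := fun i _ => Δ i) (C := ∑ i, Δ i)
      (fun i => measurable_const) (fun i _ => hΔ0 i)
      (fun ω => by simpa only [mul_comm] using hq1 t ω)
    simpa only [mul_comm] using h
  refine ⟨integrable_finsetSum _ fun t _ => hprod t, ?_⟩
  rw [integral_finsetSum _ fun t _ => hprod t, integral_finsetSum _ fun t _ => (harm t).1,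
    Finset.mul_sum]
  refine Finset.sum_le_sum fun t _ => ?_
  rw [(harm t).2, ← integral_const_mul]
  exact integral_mono (hprod t) ((hqI t).const_mul _) fun ω =>
    stability_mul_penalty_le hv.card_pos hv.pos hv.lt_one (hv.playDist_mem t ω) hΔ0 hΔ

lemma sqrt_add_le_sqrt_add_sqrt {x y : ℝ} (hx : 0 ≤ x) (hy : 0 ≤ y) :
    √(x + y) ≤ √x + √y := by
  refine Real.sqrt_le_iff.2 ⟨by positivity, ?_⟩
  nlinarith [Real.sq_sqrt hx, Real.sq_sqrt hy, Real.sqrt_nonneg x, Real.sqrt_nonneg y,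
    mul_nonneg (Real.sqrt_nonneg x) (Real.sqrt_nonneg y)]

/-- Solving the self-bounding inequality `R ≤ a + 30 √(B (R + C))` for `R`. -/
lemma le_of_self_bounding {R a B C : ℝ} (hB : 0 ≤ B) (hC : 0 ≤ C) (hR : 0 ≤ R)
    (h : R ≤ a + 30 * √(B * (R + C))) : R ≤ 2 * a + 900 * B + 60 * √(C * B) := by
  have h1 : √(B * (R + C)) ≤ √(B * R) + √(C * B) := by
    rw [mul_add, mul_comm C B]
    exact sqrt_add_le_sqrt_add_sqrt (by positivity) (by positivity)
  have h2 : √(B * R) = √B * √R := Real.sqrt_mul hB R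
  have h3 := Real.sq_sqrt hB
  have h4 := Real.sq_sqrt hR
  nlinarith [sq_nonneg (30 * √B - √R)]

/-- The regret bound under a self-bounding constraint. -/
lemma IsBanditRun.regret_le_of_selfBounding (hr : IsBanditRun μ α β₁ βb ℓ I)
    (hv : ValidParams K α β₁ βb) {Z : ℝ}
    (hz : ∀ᵐ ω ∂μ, ∀ t, stability α (playDist α β₁ βb ℓ I t ω) ≤ Z) (T : ℕ)
    {Δ : Fin K → ℝ} {iStar : Fin K} {C : ℝ} (hΔ0 : ∀ i, 0 ≤ Δ i)
    (hΔ : ∀ i, i ≠ iStar → 0 < Δ i) (hC : 0 ≤ C) (hsb : SelfBounding μ ℓ I Δ C T) :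
    regret μ ℓ I T ≤ 1000 * (omega α Δ iStar *
        logPlus (logArg (penalty α (firstDist K α β₁ βb)) Z T (omega α Δ iStar) C) +
      √(C * omega α Δ iStar *
        logPlus (logArg (penalty α (firstDist K α β₁ βb)) Z T (omega α Δ iStar) C)) +
      kappa K α β₁ βb Z) := by
  have hZ := hv.pos_of_ae_stability_le hz
  have hw : 0 < omega α Δ iStar := omega_pos hv.two_le hv.pos hv.lt_one hΔ
  set w := omega α Δ iStar
  have hΛ1 : 1 ≤ logPlus (logArg (penalty α (firstDist K α β₁ βb)) Z T w C) := le_max_left _ _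
  set Λ := logPlus (logArg (penalty α (firstDist K α β₁ βb)) Z T w C) with hΛ
  have hκ0 := hv.initial_penalty_nonneg
  have hZβ : 0 ≤ Z / β₁ := div_nonneg hZ.le hv.beta_pos.le
  have hκ : 0 ≤ kappa K α β₁ βb Z := by unfold kappa; linarith
  rcases le_or_gt (regret μ ℓ I T) 0 with hneg | hRpos
  · refine hneg.trans ?_
    positivity
  have hW : 0 < w ^ 2 + C * w := by positivity
  obtain ⟨hPint, hP⟩ := hr.integral_sum_stability_mul_penalty_le hv hΔ0 hΔ T
  have hP0 : ∀ ω, 0 ≤ Λ * ∑ t ∈ Finset.range T, stability α (playDist α β₁ βb ℓ I t ω) *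
      penalty α (playDist α β₁ βb ℓ I t ω) := fun ω =>
    mul_nonneg (by linarith) (Finset.sum_nonneg fun t _ =>
      mul_nonneg (hv.stability_playDist_nonneg t ω) (hv.penalty_playDist_pos t ω).le)
  have hsqrt : Integrable (fun ω => √(Λ * ∑ t ∈ Finset.range T,
      stability α (playDist α β₁ βb ℓ I t ω) * penalty α (playDist α β₁ βb ℓ I t ω))) μ := by
    -- `√x ≤ 1 + x`
    refine Integrable.mono' ((integrable_const 1).add (hPint.const_mul Λ))
      (hPint.const_mul Λ).1.aemeasurable.sqrt.aestronglyMeasurable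
      (Filter.Eventually.of_forall fun ω => ?_)
    rw [Real.norm_of_nonneg (Real.sqrt_nonneg _)]
    refine Real.sqrt_le_iff.2 ⟨?_, ?_⟩
    · have := hP0 ω
      simp only [Pi.add_apply]
      linarith
    · have := hP0 ω
      simp only [Pi.add_apply]
      nlinarith
  have h1 : ∫ ω, ∑ t ∈ Finset.range T, stability α (playDist α β₁ βb ℓ I t ω) /
      (runState α β₁ βb ℓ I t ω).beta ∂μ ≤
      ∫ ω, ((Z / β₁ + 4 * √(w ^ 2 + C * w)) + 3 * √(Λ * ∑ t ∈ Finset.range T,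
        stability α (playDist α β₁ βb ℓ I t ω) * penalty α (playDist α β₁ βb ℓ I t ω))) ∂μ :=
    integral_mono_ae (integrable_finsetSum _ fun t _ => hr.integrable_stability_div_beta hv t)
      ((integrable_const _).add (hsqrt.const_mul 3))
      (hz.mono fun ω hω => by
        have := hv.sum_stability_div_beta_le_logPlus hZ hW hω T
        rw [← add_assoc] at this
        exact this)
  rw [integral_add (integrable_const _) (hsqrt.const_mul 3), integral_const, probReal_univ,
    one_smul, integral_const_mul] at h1
  have h2 := integral_sqrt_le_sqrt_integral hP0 (hPint.const_mul Λ) hsqrt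
  rw [integral_const_mul] at h2
  have h3 : Λ * ∫ ω, ∑ t ∈ Finset.range T, stability α (playDist α β₁ βb ℓ I t ω) *
      penalty α (playDist α β₁ βb ℓ I t ω) ∂μ ≤ (w * Λ) * (regret μ ℓ I T + C) := by
    have hsb' : ∫ ω, ∑ t ∈ Finset.range T, Δ (I t ω) ∂μ ≤ regret μ ℓ I T + C := by
      unfold SelfBounding at hsb
      linarith
    calc _ ≤ Λ * (w * (regret μ ℓ I T + C)) := by gcongr; exact hP.trans (by gcongr)
      _ = _ := by ring
  have h4 := h2.trans (Real.sqrt_le_sqrt h3)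
  have h5 := hr.regret_le hv T
  have h6 : √(w ^ 2 + C * w) ≤ w * Λ + √(C * w * Λ) := by
    have e1 : √(w ^ 2 + C * w) ≤ √(w ^ 2) + √(C * w) :=
      sqrt_add_le_sqrt_add_sqrt (by positivity) (by positivity)
    rw [Real.sqrt_sq hw.le] at e1
    have e2 : √(C * w) ≤ √(C * w * Λ) :=
      Real.sqrt_le_sqrt (le_mul_of_one_le_right (by positivity) hΛ1)
    have e3 : w ≤ w * Λ := le_mul_of_one_le_right hw.le hΛ1
    linarith
  have h7 := le_of_self_bounding (R := regret μ ℓ I T) (a := 10 * (Z / β₁ + 4 * √(w ^ 2 + C * w)) +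
    (β₁ * penalty α (firstDist K α β₁ βb) + βb * penalty (1 - α) (firstDist K α β₁ βb)))
    (B := w * Λ) (C := C) (by positivity) hC hRpos.le (by linarith)
  rw [← mul_assoc C w Λ] at h7
  have h8 : 0 ≤ w * Λ := by positivity
  have h9 := Real.sqrt_nonneg (C * w * Λ)
  unfold kappa
  linarith

end

end TsallisBandit

theorem mainTheorem6 :
    -- one absolute constant for all the bounds
    ∃ c : ℝ, 0 < c ∧
    ∀ (K : ℕ), 2 ≤ K → ∀ (α : ℝ), 0 < α → α < 1 →
    ∀ (β₁ βb : ℝ), 4 * K / (1 - α) ≤ β₁ →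
      (α ≤ 1 / 2 → βb = 0) →
      (1 / 2 < α → 32 * K / ((1 - α) ^ 2 * β₁) ≤ βb) →
    ∀ {Ω : Type*} [MeasurableSpace Ω] (μ : Measure Ω) [IsProbabilityMeasure μ]
      (ℓ : ℕ → Ω → Fin K → ℝ) (I : ℕ → Ω → Fin K), IsBanditRun μ α β₁ βb ℓ I →
    -- an admissible `z_max` with `h₁ z_max = O((K-1)/(α(1-α)))` exists
    (∃ zmax : ℝ, 0 < zmax ∧
      (∀ t ω, stability α (playDist α β₁ βb ℓ I t ω) ≤ zmax) ∧
      penalty α (firstDist K α β₁ βb) * zmax ≤ c * ((K - 1) / (α * (1 - α)))) ∧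
    -- the regret bounds, for every admissible `z_max`
    (∀ zmax : ℝ, (∀ t, ∀ᵐ ω ∂μ, stability α (playDist α β₁ βb ℓ I t ω) ≤ zmax) →
      ∀ T : ℕ,
        -- adversarial regime
        (regret μ ℓ I T ≤
            c * ∫ ω, (√(penalty α (firstDist K α β₁ βb) *
                ∑ t ∈ Finset.range T, stability α (playDist α β₁ βb ℓ I t ω)) +
              kappa K α β₁ βb zmax) ∂μ) ∧
        (regret μ ℓ I T ≤
            c * (√(penalty α (firstDist K α β₁ βb) * zmax * T) + kappa K α β₁ βb zmax)) ∧
        -- adversarial regime with a self-bounding constraint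
        (∀ (Δ : Fin K → ℝ) (iStar : Fin K) (C : ℝ),
          (∀ i, 0 ≤ Δ i) → (∀ i, i ≠ iStar → 0 < Δ i) → 0 ≤ C →
          SelfBounding μ ℓ I Δ C T →
          regret μ ℓ I T ≤
            c * (omega α Δ iStar *
                  logPlus (logArg (penalty α (firstDist K α β₁ βb)) zmax T
                    (omega α Δ iStar) C) +
                √(C * omega α Δ iStar *
                  logPlus (logArg (penalty α (firstDist K α β₁ βb)) zmax T
                    (omega α Δ iStar) C)) +
                kappa K α β₁ βb zmax))) ∧
    -- the bound on `ω(Δ)`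
    (∀ (Δ : Fin K → ℝ) (iStar : Fin K), (∀ i, i ≠ iStar → 0 < Δ i) →
      omega α Δ iStar ≤ 2 * (K - 1) / (α * (1 - α) * gapMin Δ iStar)) := by
  refine ⟨1000, by norm_num, ?_⟩
  intro K hK α h0 h1 β₁ βb hβ₁ hb1 hb2 Ω _ μ _ ℓ I hr
  have hv : ValidParams K α β₁ βb := ⟨hK, h0, h1, hβ₁, hb1, hb2⟩
  have h1' := hv.one_sub_pos
  have hK0 : (0 : ℝ) < K := by exact_mod_cast hv.card_pos
  have hK1 : (0 : ℝ) ≤ K - 1 := by have := hv.two_le_cast; linarith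
  refine ⟨⟨(K : ℝ) ^ α / (1 - α), by positivity, fun t ω => hv.stability_playDist_le t ω, ?_⟩,
    fun zmax hz T => ?_, fun Δ iStar hΔ => omega_le hK h0 h1 hΔ⟩
  · have : 0 ≤ (K - 1) / (α * (1 - α)) := by positivity
    linarith [hv.penalty_firstDist_mul_le]
  have hz' := ae_all_iff.2 hz
  have hZ := hv.pos_of_ae_stability_le hz'
  have hκ : 0 ≤ kappa K α β₁ βb zmax := by
    have := hv.initial_penalty_nonneg
    have := div_nonneg hZ.le hv.beta_pos.le
    unfold kappa
    linarith
  have hadv := hr.regret_le_integral_sqrt hv hz' T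
  have hint := hr.integral_sqrt_sum_stability_le hv hz' T
  have hint0 : 0 ≤ ∫ ω, √(penalty α (firstDist K α β₁ βb) *
      ∑ t ∈ Finset.range T, stability α (playDist α β₁ βb ℓ I t ω)) ∂μ :=
    integral_nonneg fun ω => Real.sqrt_nonneg _
  refine ⟨?_, by linarith, fun Δ iStar C hΔ0 hΔ hC hsb =>
    hr.regret_le_of_selfBounding hv hz' T hΔ0 hΔ hC hsb⟩
  rw [integral_add (hr.integrable_sqrt_sum_stability hv T) (integrable_const _), integral_const,
    probReal_univ, one_smul]
  linarith
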